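/- Let $K$ be a $2$-adic field, i.e. a finite extension of $\mathbb{Q}_2$, with ring of integers $\mathcal{O}_K$. Let $q$ be the cardinality of its residue field, $e_K$ its absolute ramification index $e(K/\mathbb{Q}_2)$, and $v_K$ its normalised valuation. For a group $G$, let $\Sigma^{G}$ be the set of $K$-isomorphism classes of totally ramified quartic field extensions $L/K$ such that $\mathrm{Gal}(\widetilde{L}/K) \cong G$, where $\widetilde{L}$ is the normal closure of $L$ over $K$. For a finite set $S$ of isomorphism classes of finite extensions of $K$, define its mass by $$ \widetilde{m}(S) = \sum_{L \in S} \frac{(\#\mathrm{Aut}(L/K))^{-1}}{q^{v_K(d_{L/K})}}, $$ where $d_{L/K}$ is the discriminant ideal of $L/K$. Let $D_4$ be the dihedral group of order $8$, $C_4$ the cyclic group of order $4$, and $V_4$ the Klein four-group. Then the sets $\Sigma^{D_4}$, $\Sigma^{C_4}$ and $\Sigma^{V_4}$ are finite, and $$ \widetilde{m}(\Sigma^{D_4}) = \frac{1}{q^2+q+1}\cdot\left(q^{-3e_K-3} + q^{-3e_K-1} + q^{-2}\right) - \widetilde{m}(\Sigma^{C_4}) - 3\,\widetilde{m}(\Sigma^{V_4}).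 $$ -/

import Mathlib

/-! Totally ramified quartic extensions of a `2`-adic field `K`, i.e. of a finite extension of `ℚ_[2]`,
and their mass. The ring of integers of `K` is the integral closure of `ℤ_[2]` in `K`; an extension of
`K` of finite degree is taken inside the algebraic closure of `K`, up to `K`-isomorphism. -/

namespace TwoAdic

section Base

variable (K : Type*) [Field K] [Algebra ℤ_[2] K]

/-- The ring of integers `𝒪_K` of a `2`-adic field `K`, as a `ℤ_[2]`-subalgebra of `K`. -/
noncomputable abbrev integers : Subalgebra ℤ_[2] K := integralClosure ℤ_[2] K

section Extension

variable (L : Type*) [Field L] [Algebra K L]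

/-- The ring of integers of an extension `L` of `K`, as an `𝒪_K`-subalgebra of `L`: the integral closure
of `𝒪_K` in `L`. -/
noncomputable abbrev integersOver : Subalgebra (integers K) L := integralClosure (integers K) L

/-- `L/K` is totally ramified: the ramification index over `K` of the maximal ideal of `𝒪_L` is the degree
of `L/K`. (For a finite extension `L/K` there is exactly one maximal ideal.) -/
def IsTotallyRamified : Prop :=
  ∀ P : Ideal (integersOver K L), P.IsMaximal →
    P.ramificationIdx (integers K) = Module.finrank K L

/-- The discriminant ideal `d_{L/K}` of a finite extension `L/K`: the ideal of `𝒪_K` generated by the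
discriminants `det (Tr (bᵢ bⱼ))` of all `[L : K]`-tuples `b` of elements of `𝒪_L`. -/
noncomputable def discrIdeal : Ideal (integers K) :=
  Ideal.span (Set.range fun b : Fin (Module.finrank K L) → integersOver K L =>
    Algebra.discr (integers K) b)

end Extension

variable {K} in
theorem discrIdeal_le {L L' : Type*} [Field L] [Algebra K L] [Field L'] [Algebra K L']
    (f : L ≃ₐ[K] L') : discrIdeal K L ≤ discrIdeal K L' := by
  refine Ideal.span_le.2 ?_
  rintro _ ⟨b, rfl⟩
  let g : integersOver K L ≃ₐ[integers K] integersOver K L' :=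
    (f.restrictScalars (integers K)).mapIntegralClosure
  let r : Fin (Module.finrank K L) ≃ Fin (Module.finrank K L') :=
    finCongr f.toLinearEquiv.finrank_eq
  refine Ideal.subset_span ⟨(g ∘ b) ∘ r.symm, ?_⟩
  change Algebra.discr (integers K) ((g ∘ b) ∘ r.symm) = Algebra.discr (integers K) b
  rw [Algebra.discr_eq_discr_of_algEquiv b g]
  simp only [Algebra.discr_def]
  exact Matrix.det_submatrix_equiv_self r.symm (Algebra.traceMatrix (integers K) (g ∘ b))

variable {K} in
theorem discrIdeal_congr {L L' : Type*} [Field L] [Algebra K L] [Field L'] [Algebra K L']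
    (e : L ≃ₐ[K] L') : discrIdeal K L = discrIdeal K L' :=
  le_antisymm (discrIdeal_le e) (discrIdeal_le e.symm)

/-- Isomorphism of extensions of `K`, for subextensions of the algebraic closure of `K`. -/
instance extensionSetoid : Setoid (IntermediateField K (AlgebraicClosure K)) where
  r L L' := Nonempty (L ≃ₐ[K] L')
  iseqv := ⟨fun _ => ⟨AlgEquiv.refl⟩, fun ⟨e⟩ => ⟨e.symm⟩, fun ⟨e⟩ ⟨f⟩ => ⟨e.trans f⟩⟩

/-- Isomorphism classes of algebraic extensions of `K`. -/
abbrev ExtensionClass : Type _ := Quotient (extensionSetoid K)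

/-- The Galois closure group `Gal(L̃/K)` of `L/K`, where `L̃` is the normal closure of `L` over `K`. -/
abbrev GaloisClosureGroup (L : IntermediateField K (AlgebraicClosure K)) : Type _ :=
  Gal(IntermediateField.normalClosure K L (AlgebraicClosure K)/K)

variable [Algebra ℚ_[2] K] [IsScalarTower ℤ_[2] ℚ_[2] K]

variable {K} in
/-- An element of an algebraic extension of `ℚ_[2]` is integral over `ℤ_[2]` if and only if its
spectral norm (the unique extension of the `2`-adic absolute value) is at most `1`. -/
theorem isIntegral_iff_spectralNorm_le_one [Algebra.IsAlgebraic ℚ_[2] K] (x : K) :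
    IsIntegral ℤ_[2] x ↔ spectralNorm ℚ_[2] K x ≤ 1 := by
  have hx : IsIntegral ℚ_[2] x := (Algebra.IsAlgebraic.isAlgebraic x).isIntegral
  rw [spectralNorm, spectralValue_le_one_iff (minpoly.monic hx)]
  constructor
  · intro h n
    rw [minpoly.isIntegrallyClosed_eq_field_fractions' ℚ_[2] h, Polynomial.coeff_map]
    exact PadicInt.norm_le_one _
  · intro h
    have hl : minpoly ℚ_[2] x ∈ Polynomial.lifts (algebraMap ℤ_[2] ℚ_[2]) := by
      rw [Polynomial.lifts_iff_coeff_lifts]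
      exact fun n => ⟨⟨_, h n⟩, rfl⟩
    obtain ⟨p, hp, -, hm⟩ := Polynomial.lifts_and_natDegree_eq_and_monic hl (minpoly.monic hx)
    refine ⟨p, hm, ?_⟩
    rw [← Polynomial.aeval_def, ← Polynomial.aeval_map_algebraMap ℚ_[2], hp, minpoly.aeval]

/-- The ring of integers of a `2`-adic field is a local ring. -/
instance isLocalRing_integers [Algebra.IsAlgebraic ℚ_[2] K] : IsLocalRing (integers K) := by
  have key : ∀ a : integers K, IsUnit a ↔ spectralNorm ℚ_[2] K (a : K) = 1 := by
    intro a
    have ha := (isIntegral_iff_spectralNorm_le_one (a : K)).1 a.2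
    constructor
    · rintro ⟨u, rfl⟩
      have hi := (isIntegral_iff_spectralNorm_le_one
        (((u⁻¹ : (integers K)ˣ) : integers K) : K)).1 (Subtype.property _)
      have hmul : ((u : integers K) : K) * (((u⁻¹ : (integers K)ˣ) : integers K) : K) = 1 := by
        exact_mod_cast congrArg (Subtype.val) u.mul_inv
      have h1 := map_mul (spectralMulAlgNorm ℚ_[2] K) ((u : integers K) : K)
        (((u⁻¹ : (integers K)ˣ) : integers K) : K)
      rw [hmul, map_one] at h1
      simp only [spectralMulAlgNorm_def] at h1
      have h0 := spectralNorm_nonneg (K := ℚ_[2]) ((u : integers K) : K)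
      nlinarith
    · intro h
      have hne : (a : K) ≠ 0 := by
        intro h0
        rw [h0, spectralNorm_zero] at h
        exact zero_ne_one h
      have h1 := map_mul (spectralMulAlgNorm ℚ_[2] K) (a : K) (a : K)⁻¹
      rw [mul_inv_cancel₀ hne, map_one] at h1
      simp only [spectralMulAlgNorm_def] at h1
      rw [h, one_mul] at h1
      exact IsUnit.of_mul_eq_one
        (⟨(a : K)⁻¹, (isIntegral_iff_spectralNorm_le_one _).2 h1.symm.le⟩ : integers K)
        (Subtype.ext (mul_inv_cancel₀ hne))
  refine IsLocalRing.of_nonunits_add fun a b ha hb => ?_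
  rw [mem_nonunits_iff, key] at ha hb ⊢
  have ha' := lt_of_le_of_ne ((isIntegral_iff_spectralNorm_le_one (a : K)).1 a.2) ha
  have hb' := lt_of_le_of_ne ((isIntegral_iff_spectralNorm_le_one (b : K)).1 b.2) hb
  have := isNonarchimedean_spectralNorm (K := ℚ_[2]) (L := K) (a : K) (b : K)
  exact (lt_of_le_of_lt this (max_lt ha' hb')).ne

variable [FiniteDimensional ℚ_[2] K]

/-- The cardinality `q_K` of the residue field of `K`. -/
noncomputable def residueCard : ℕ := Nat.card (IsLocalRing.ResidueField (integers K))

/-- The absolute ramification index `e_K = e(K/ℚ₂)`. -/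
noncomputable def absRamificationIdx : ℕ :=
  (IsLocalRing.maximalIdeal (integers K)).ramificationIdx ℤ_[2]

section Extension

variable (L : Type*) [Field L] [Algebra K L]

/-- `v_K(d_{L/K})`: the exponent of the maximal ideal of `𝒪_K` in the discriminant ideal of `L/K`. -/
noncomputable def discrVal : ℕ :=
  multiplicity (IsLocalRing.maximalIdeal (integers K)) (discrIdeal K L)

/-- The contribution `(#Aut(L/K))⁻¹ / q^{v_K(d_{L/K})}` of `L` to the mass. -/
noncomputable def weight : ℝ :=
  (Nat.card (L ≃ₐ[K] L) : ℝ)⁻¹ / (residueCard K : ℝ) ^ discrVal K L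

end Extension

variable {K} in
theorem weight_congr {L L' : Type*} [Field L] [Algebra K L] [Field L'] [Algebra K L']
    (e : L ≃ₐ[K] L') : weight K L = weight K L' := by
  have h : Nat.card (L ≃ₐ[K] L) = Nat.card (L' ≃ₐ[K] L') := Nat.card_congr e.autCongr.toEquiv
  simp only [weight, discrVal, discrIdeal_congr e, h]

/-- `Σ^G`: the isomorphism classes of totally ramified quartic extensions `L/K` whose Galois closure
group is isomorphic to `G`. -/
def quartics (G : Type*) [Group G] : Set (ExtensionClass K) :=
  {c | ∃ L : IntermediateField K (AlgebraicClosure K), Quotient.mk (extensionSetoid K) L = c ∧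
    Module.finrank K L = 4 ∧ IsTotallyRamified K L ∧ Nonempty (GaloisClosureGroup K L ≃* G)}

/-- The contribution of an isomorphism class of extensions to the mass. -/
noncomputable def classWeight (c : ExtensionClass K) : ℝ :=
  Quotient.lift (fun L : IntermediateField K (AlgebraicClosure K) => weight K L)
    (fun _ _ h => Nonempty.elim h weight_congr) c

/-- The mass `m̃(S) = ∑_{L ∈ S} (#Aut(L/K))⁻¹ / q^{v_K(d_{L/K})}` of a (finite) set `S` of isomorphism
classes of extensions of `K`. -/
noncomputable def mass (S : Set (ExtensionClass K)) : ℝ := ∑ᶠ c ∈ S, classWeight K c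

end Base

/-- The cyclic group of order `4`. -/
abbrev C4 : Type := Multiplicative (ZMod 4)

/-- The Klein four-group. -/
abbrev V4 : Type := Multiplicative (ZMod 2 × ZMod 2)

/-- The dihedral group of order `8`. -/
abbrev D4 : Type := DihedralGroup 4

end TwoAdic

/-! The proof is a double count of pairs `E ⊂ L`, with `L/K` totally ramified quartic and `E/K`
quadratic. Inside the algebraic closure the isomorphism class of `L` has `4 / #Aut(L/K)` members, so
the mass of a set of classes is a quarter of the sum of `q ^ (-v_K(d_{L/K}))` over the subfields
that represent them (`mass_image`).

Group side. Let `G` be the Galois group of the normal closure of `L` and `H` the subgroup fixing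
`L`; `H` has index 4 and trivial core. Quadratic subfields of `L` are the subgroups of index two
above `H` (`ncard_quadSub`). If there is one, then `G` is D4, C4 or V4
(`nonempty_mulEquiv_of_indexTwo`), and their number is 1, 1 or 3 respectively. Hence a quarter of
the weighted sum over pairs is m̃(D4) + m̃(C4) + 3 m̃(V4).

Field side. Pairs are towers of two totally ramified quadratic extensions, and the discriminant
exponent of `L/K` is `2 d(E/K) + d(L/E)` (`discrVal_tower`). By Kummer theory and the unit
filtration modulo squares, a field with residue cardinality `q` and absolute ramification index `e`
has `2 q^e` totally ramified quadratic extensions of exponent `2e + 1` and `2 (q - 1) q^i` of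
exponent `2 (i + 1)` for `0 ≤ i < e` (`sum_ramQuadratics`). The field `E` has the same `q` and index
`2e` (`extend`). Now `∑ q^(-d)` equals `2 / q` for every `e` (`sum_inv_pow`), so `E` contributes `(2
/ q) q^(-2 d(E))`, and the sum over `E` is geometric of ratio `q^(-3)` (`sum_inv_sq_pow`); this is
where `q^2 + q + 1` comes from.

The valuations are all restrictions of one absolute value on the algebraic closure, the spectral
norm, which is Galois invariant. The predicate `IsDyadic` keeps exactly what the count needs and
passes to ramified quadratic extensions, so one count serves both floors of the tower. -/

namespace TwoAdic

/-! ### Dyadic fields and the unit filtration modulo squares. -/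

section Dyadic

variable {F : Type*} [Field F]

/-- The unit ball of a nonarchimedean absolute value. -/
def unitBall (v : AbsoluteValue F ℝ) (hv : IsNonarchimedean v) : ValuationSubring F where
  carrier := {x | v x ≤ 1}
  mul_mem' {a b} ha hb := by
    simp only [Set.mem_ofPred_eq, map_mul] at *
    exact mul_le_one₀ ha (v.nonneg b) hb
  one_mem' := by simp
  add_mem' {a b} ha hb := (hv a b).trans (max_le ha hb)
  zero_mem' := by simp
  neg_mem' {a} ha := by simpa using ha
  mem_or_inv_mem' x := by
    simp only [Set.mem_ofPred_eq, map_inv₀]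
    exact (le_total (v x) 1).imp id fun h => inv_le_one_of_one_le₀ h

theorem mem_unitBall {v : AbsoluteValue F ℝ} {hv : IsNonarchimedean v} {x : F} :
    x ∈ unitBall v hv ↔ v x ≤ 1 := Iff.rfl

theorem isUnit_unitBall {v : AbsoluteValue F ℝ} {hv : IsNonarchimedean v} (x : unitBall v hv) :
    IsUnit x ↔ v (x : F) = 1 := by
  constructor
  · rintro ⟨u, rfl⟩
    have h1 : v ((u : unitBall v hv) : F) * v (((u⁻¹ : (unitBall v hv)ˣ) : unitBall v hv) : F) = 1 := by
      rw [← map_mul, ← map_one v]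
      exact congrArg v (by exact_mod_cast congrArg Subtype.val u.mul_inv)
    have h2 : v ((u : unitBall v hv) : F) ≤ 1 := (u : unitBall v hv).2
    have h3 : v (((u⁻¹ : (unitBall v hv)ˣ) : unitBall v hv) : F) ≤ 1 :=
      ((u⁻¹ : (unitBall v hv)ˣ) : unitBall v hv).2
    nlinarith [v.nonneg ((u : unitBall v hv) : F)]
  · intro h
    have h0 : (x : F) ≠ 0 := fun h0 => by simp [h0] at h
    exact IsUnit.of_mul_eq_one ⟨(x : F)⁻¹, by rw [mem_unitBall, map_inv₀, h, inv_one]⟩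
      (Subtype.ext (mul_inv_cancel₀ h0))

theorem mem_maximalIdeal_unitBall {v : AbsoluteValue F ℝ} {hv : IsNonarchimedean v}
    (x : unitBall v hv) : x ∈ IsLocalRing.maximalIdeal (unitBall v hv) ↔ v (x : F) < 1 := by
  rw [IsLocalRing.mem_maximalIdeal, mem_nonunits_iff, isUnit_unitBall]
  exact ⟨fun h => lt_of_le_of_ne x.2 h, fun h => h.ne⟩

theorem residue_unitBall_eq_iff {v : AbsoluteValue F ℝ} {hv : IsNonarchimedean v}
    (x y : unitBall v hv) :
    IsLocalRing.residue _ x = IsLocalRing.residue _ y ↔ v ((x : F) - y) < 1 := by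
  rw [← sub_eq_zero, ← map_sub, IsLocalRing.residue_eq_zero_iff, mem_maximalIdeal_unitBall]
  rfl

/-- The residue field of a nonarchimedean absolute value. -/
abbrev residueOf (v : AbsoluteValue F ℝ) (hv : IsNonarchimedean v) : Type _ :=
  IsLocalRing.ResidueField (unitBall v hv)

/-- A discrete absolute value with finite residue field of characteristic `2` for which
Artin-Schreier equations with small right hand side are solvable. -/
structure IsDyadic (v : AbsoluteValue F ℝ) (ρ : ℝ) (q e : ℕ) : Prop where
  nonarch : IsNonarchimedean v
  pos : 0 < ρ
  lt_one : ρ < 1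
  unif : ∃ π, v π = ρ
  val : ∀ x, x ≠ 0 → ∃ n : ℤ, v x = ρ ^ n
  two : v 2 = ρ ^ e
  e_pos : 0 < e
  finite_residue : Finite (residueOf v nonarch)
  card_residue : Nat.card (residueOf v nonarch) = q
  hensel : ∀ c, v c < 1 → ∃ y, y ^ 2 + y = c

theorem map_add_eq_left {v : AbsoluteValue F ℝ} (hv : IsNonarchimedean v) {x y : F}
    (h : v y < v x) : v (x + y) = v x := by
  refine le_antisymm ((hv x y).trans (max_le le_rfl h.le)) ?_
  have := hv (x + y) (-y)
  rw [add_neg_cancel_right, v.map_neg] at this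
  rcases le_max_iff.1 this with h' | h'
  · exact h'
  · exact absurd h' h.not_ge

theorem map_add_eq_right {v : AbsoluteValue F ℝ} (hv : IsNonarchimedean v) {x y : F}
    (h : v x < v y) : v (x + y) = v y := by
  rw [add_comm, map_add_eq_left hv h]

theorem map_sub_le_max {v : AbsoluteValue F ℝ} (hv : IsNonarchimedean v) (x y : F) :
    v (x - y) ≤ max (v x) (v y) := by
  have := hv x (-y)
  rwa [v.map_neg, ← sub_eq_add_neg] at this

/-- The subgroup of squares of `Fˣ`. -/
def squares (F : Type*) [Field F] : Subgroup Fˣ := (powMonoidHom 2 : Fˣ →* Fˣ).range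

/-- The group of square classes of `F`. -/
def SquareClass (F : Type*) [Field F] : Type _ := Fˣ ⧸ squares F

noncomputable instance : CommGroup (SquareClass F) :=
  inferInstanceAs (CommGroup (Fˣ ⧸ squares F))

/-- The class of a unit modulo squares. -/
noncomputable def sqClass : Fˣ →* SquareClass F := QuotientGroup.mk' (squares F)

theorem sqClass_surjective : Function.Surjective (sqClass (F := F)) :=
  QuotientGroup.mk'_surjective _

theorem sqClass_eq_one_iff (u : Fˣ) : sqClass u = 1 ↔ ∃ s : Fˣ, u = s ^ 2 :=
  (QuotientGroup.eq_one_iff (N := squares F) u).trans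
    ⟨fun ⟨s, hs⟩ => ⟨s, hs.symm⟩, fun ⟨s, hs⟩ => ⟨s, hs.symm⟩⟩

theorem sqClass_eq_iff (u w : Fˣ) : sqClass u = sqClass w ↔ ∃ s : Fˣ, u = w * s ^ 2 := by
  rw [← inv_mul_eq_one, ← map_inv, ← map_mul, sqClass_eq_one_iff]
  constructor
  · rintro ⟨s, hs⟩
    refine ⟨s⁻¹, ?_⟩
    rw [inv_pow, ← hs]; group
  · rintro ⟨s, rfl⟩
    refine ⟨s⁻¹, ?_⟩
    rw [inv_pow]; group

namespace IsDyadic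

variable {v : AbsoluteValue F ℝ} {ρ : ℝ} {q e : ℕ} (h : IsDyadic v ρ q e)

/-- The `j`-th group of the filtration of the units of absolute value one. -/
def unitGroup (h : IsDyadic v ρ q e) (j : ℕ) : Subgroup Fˣ where
  carrier := {u | v u = 1 ∧ v ((u : F) - 1) ≤ ρ ^ j}
  mul_mem' {a b} ha hb := by
    refine ⟨by simp [ha.1, hb.1], ?_⟩
    have : ((a * b : Fˣ) : F) - 1 = a * (b - 1) + (a - 1) := by push_cast; ring
    rw [this]
    refine (h.nonarch _ _).trans (max_le ?_ ha.2)
    rw [map_mul, ha.1, one_mul]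
    exact hb.2
  one_mem' := ⟨by simp, by simpa using (pow_pos h.pos j).le⟩
  inv_mem' {a} ha := by
    refine ⟨by simp [ha.1], ?_⟩
    have : ((a⁻¹ : Fˣ) : F) - 1 = - ((a : Fˣ) : F)⁻¹ * (a - 1) := by
      have := a.ne_zero
      push_cast; field_simp; ring
    rw [this, map_mul, v.map_neg, map_inv₀, ha.1, inv_one, one_mul]
    exact ha.2

/-- The image of `unitGroup` in the group of square classes. -/
noncomputable def classGroup (h : IsDyadic v ρ q e) (j : ℕ) : Subgroup (SquareClass F) :=
  (h.unitGroup j).map sqClass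

theorem sqClass_mem_classGroup (u : Fˣ) (j : ℕ) :
    sqClass u ∈ h.classGroup j ↔ ∃ w ∈ h.unitGroup j, ∃ s : Fˣ, u = w * s ^ 2 := by
  simp only [classGroup, Subgroup.mem_map]
  exact exists_congr fun w => and_congr_right fun _ => by rw [eq_comm, sqClass_eq_iff]

include h

theorem zpow_lt_iff (m n : ℤ) : ρ ^ m < ρ ^ n ↔ n < m :=
  zpow_lt_zpow_iff_right_of_lt_one₀ h.pos h.lt_one

theorem zpow_le_iff (m n : ℤ) : ρ ^ m ≤ ρ ^ n ↔ n ≤ m :=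
  zpow_le_zpow_iff_right_of_lt_one₀ h.pos h.lt_one

theorem pow_lt_iff (m n : ℕ) : ρ ^ m < ρ ^ n ↔ n < m :=
  pow_lt_pow_iff_right_of_lt_one₀ h.pos h.lt_one

theorem pow_le_iff (m n : ℕ) : ρ ^ m ≤ ρ ^ n ↔ n ≤ m :=
  pow_le_pow_iff_right_of_lt_one₀ h.pos h.lt_one

theorem zpow_inj {m n : ℤ} (hmn : ρ ^ m = ρ ^ n) : m = n :=
  zpow_right_injective₀ h.pos h.lt_one.ne hmn

/-- An absolute value below `ρ ^ j` is at most `ρ ^ (j + 1)`. -/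
theorem le_of_lt {x : F} {j : ℤ} (hx : v x < ρ ^ j) : v x ≤ ρ ^ (j + 1) := by
  by_cases h0 : x = 0
  · simpa [h0] using (zpow_pos h.pos _).le
  · obtain ⟨n, hn⟩ := h.val x h0
    rw [hn, h.zpow_lt_iff] at hx
    rw [hn, h.zpow_le_iff]
    exact hx

theorem le_of_lt_pow {x : F} {j : ℕ} (hx : v x < ρ ^ j) : v x ≤ ρ ^ (j + 1) := by
  have := h.le_of_lt (x := x) (j := j) (by exact_mod_cast hx)
  exact_mod_cast this

theorem two_ne_zero : (2 : F) ≠ 0 := by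
  intro h2
  have := h.two
  rw [h2, map_zero] at this
  exact (pow_pos h.pos e).ne this

theorem two_lt_one : v 2 < 1 := by
  rw [h.two]
  exact pow_lt_one₀ h.pos.le h.lt_one h.e_pos.ne'

/-- Units close to `1` in the sense of Hensel's lemma are squares. -/
theorem exists_sq {u : F} (hu : v (u - 1) < ρ ^ (2 * e)) : ∃ s, u = s ^ 2 := by
  have h2 := h.two_ne_zero
  -- The substitution `s = 1 + 2y` turns `s² = u` into the Artin-Schreier equation `y² + y = (u - 1)
  -- / 4`, whose right hand side is small.
  obtain ⟨y, hy⟩ := h.hensel ((u - 1) / 4) (by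
    have : (4 : F) = 2 * 2 := by norm_num
    rw [map_div₀, this, map_mul, h.two, ← pow_add, ← two_mul]
    exact (div_lt_one (pow_pos h.pos _)).2 hu)
  have h4 : (4 : F) ≠ 0 := by
    have : (4 : F) = 2 * 2 := by norm_num
    rw [this]; exact mul_ne_zero h2 h2
  refine ⟨1 + 2 * y, ?_⟩
  field_simp at hy
  linear_combination -hy

/-- A principal unit of odd level below `2e` is not a square modulo a higher level. -/
theorem not_mem_classGroup {u : Fˣ} {k : ℕ} (hk : k < e) (hu : v ((u : F) - 1) = ρ ^ (2 * k + 1)) :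
    sqClass u ∉ h.classGroup (2 * k + 2) := by
  rw [sqClass_mem_classGroup]
  rintro ⟨w, hw, s, hs⟩
  have hs' : (u : F) = w * (s : F) ^ 2 := by rw [hs]; push_cast; rfl
  have hlt : ρ ^ (2 * k + 1) < 1 := pow_lt_one₀ h.pos.le h.lt_one (by omega)
  have hu1 : v (u : F) = 1 := by
    have := map_add_eq_right h.nonarch (x := (u : F) - 1) (y := 1) (by rw [hu, map_one]; exact hlt)
    simpa using this
  have hs1 : v (s : F) ^ 2 = 1 := by
    have := congrArg v hs'
    rw [map_mul, map_pow, hw.1, hu1, one_mul] at this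
    exact this.symm
  have key : v ((s : F) ^ 2 - 1) = ρ ^ (2 * k + 1) := by
    have e1 : (s : F) ^ 2 - 1 = (u - 1) + (- ((w - 1) * (s : F) ^ 2)) := by rw [hs']; ring
    rw [e1, map_add_eq_left h.nonarch, hu]
    rw [v.map_neg, map_mul, map_pow, hs1, mul_one, hu]
    exact lt_of_le_of_lt hw.2 ((h.pow_lt_iff _ _).2 (by omega))
  set r := (s : F) - 1
  have e2 : (s : F) ^ 2 - 1 = r * (r + 2) := by simp only [r]; ring
  rw [e2, map_mul] at key
  -- If `r` is larger than 2, both factors of `r (r + 2)` have the value of `r` and the exponent is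
  -- even, not `2k + 1`. Otherwise the product is at most `ρ ^ (2e)`, which is less than `ρ ^ (2k +
  -- 1)`.
  rcases lt_or_ge (v 2) (v r) with hr | hr
  · rw [map_add_eq_left h.nonarch hr] at key
    have hr0 : r ≠ 0 := by
      intro h0; rw [h0, map_zero] at hr; exact absurd hr (v.nonneg 2).not_gt
    obtain ⟨n, hn⟩ := h.val r hr0
    rw [hn, ← zpow_add₀ h.pos.ne', ← zpow_natCast] at key
    have := h.zpow_inj key
    push_cast at this
    omega
  · have h1 : v (r + 2) ≤ v 2 := (h.nonarch _ _).trans (max_le hr le_rfl)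
    have h2 : v r * v (r + 2) ≤ ρ ^ (2 * e) := by
      rw [two_mul, pow_add, ← h.two]
      exact mul_le_mul hr h1 (v.nonneg _) (v.nonneg _)
    rw [key, h.pow_le_iff] at h2
    omega

theorem classGroup_antitone {i j : ℕ} (hij : i ≤ j) : h.classGroup j ≤ h.classGroup i :=
  Subgroup.map_mono fun _ hu => ⟨hu.1, hu.2.trans ((h.pow_le_iff _ _).2 hij)⟩

/-- Reduction of an element of the unit ball. -/
noncomputable def red (x : F) (hx : v x ≤ 1) : residueOf v h.nonarch :=
  IsLocalRing.residue (unitBall v h.nonarch) ⟨x, hx⟩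

theorem red_eq_iff {x y : F} (hx : v x ≤ 1) (hy : v y ≤ 1) :
    h.red x hx = h.red y hy ↔ v (x - y) < 1 := residue_unitBall_eq_iff _ _

/-- A lift of a residue class. -/
noncomputable def lift (a : residueOf v h.nonarch) : F :=
  ((IsLocalRing.residue_surjective (R := unitBall v h.nonarch) a).choose : F)

theorem lift_le (a : residueOf v h.nonarch) : v (h.lift a) ≤ 1 :=
  ((IsLocalRing.residue_surjective (R := unitBall v h.nonarch) a).choose).2

theorem red_lift (a : residueOf v h.nonarch) : h.red (h.lift a) (h.lift_le a) = a :=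
  (IsLocalRing.residue_surjective (R := unitBall v h.nonarch) a).choose_spec

theorem lift_red {x : F} (hx : v x ≤ 1) : v (h.lift (h.red x hx) - x) < 1 := by
  rw [← h.red_eq_iff (h.lift_le _) hx, red_lift]

theorem lift_sub_lift_lt {a b : residueOf v h.nonarch} : v (h.lift a - h.lift b) < 1 ↔ a = b := by
  rw [← h.red_eq_iff (h.lift_le _) (h.lift_le _), red_lift, red_lift]

theorem charP_residue : CharP (residueOf v h.nonarch) 2 := by
  refine CharTwo.of_one_ne_zero_of_two_eq_zero one_ne_zero ?_
  rw [← map_ofNat (IsLocalRing.residue (unitBall v h.nonarch)) 2, IsLocalRing.residue_eq_zero_iff,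
    mem_maximalIdeal_unitBall]
  exact h.two_lt_one

/-- The residue field is perfect: units are squares modulo the maximal ideal. -/
theorem exists_sq_sub_lt {x : F} (hx : v x ≤ 1) : ∃ s, v s ≤ 1 ∧ v (x - s ^ 2) < 1 := by
  have := h.charP_residue
  have := h.finite_residue
  obtain ⟨t, ht⟩ := (Finite.injective_iff_surjective (f := fun a : residueOf v h.nonarch => a ^ 2)).1
    (fun a b hab => by
      have hab' : a ^ 2 = b ^ 2 := hab
      have : (a + b) ^ 2 = 0 := by rw [CharTwo.add_sq, hab', CharTwo.add_self_eq_zero]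
      exact CharTwo.add_eq_zero.1 ((pow_eq_zero_iff (by norm_num : (2:ℕ) ≠ 0)).1 this)) (h.red x hx)
  obtain ⟨s, rfl⟩ := IsLocalRing.residue_surjective (R := unitBall v h.nonarch) t
  refine ⟨s, s.2, ?_⟩
  simp only at ht
  rw [← map_pow, eq_comm] at ht
  exact (residue_unitBall_eq_iff _ _).1 ht

/-- Even levels below `2e` carry nothing new: since the residue field is perfect, the leading term
of `u - 1` at level `2k` can be removed by dividing `u` by a square. -/
theorem classGroup_even {k : ℕ} (hk : k < e) :
    h.classGroup (2 * k) = h.classGroup (2 * k + 1) := by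
  refine le_antisymm ?_ (h.classGroup_antitone (by omega))
  rintro _ ⟨u, hu, rfl⟩
  obtain ⟨π, hπ⟩ := h.unif
  have hπ0 : π ≠ 0 := by rintro rfl; rw [map_zero] at hπ; exact h.pos.ne hπ
  have hπk : v (π ^ k) = ρ ^ k := by rw [map_pow, hπ]
  have hpk : (0:ℝ) < ρ ^ k := pow_pos h.pos k
  -- For `k = 0` take a square root of the residue of `u`. For `k > 0` take `t = 1 + π^k s` with
  -- `s²` congruent to `(u - 1) / π^(2k)`; the cross term `2 π^k s` has level at least `e + k`,
  -- which exceeds `2k`.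
  obtain ⟨t, ht⟩ : ∃ t : F, v t = 1 ∧ v (u - t ^ 2) < ρ ^ (2 * k) := by
    rcases Nat.eq_zero_or_pos k with rfl | hk0
    · obtain ⟨s, hs1, hs⟩ := h.exists_sq_sub_lt hu.1.le
      refine ⟨s, ?_, by simpa using hs⟩
      have : v (s ^ 2) = 1 := by
        have e1 : s ^ 2 = u + -(u - s ^ 2) := by ring
        rw [e1, map_add_eq_left h.nonarch, hu.1]
        rw [v.map_neg, hu.1]; exact hs
      rw [map_pow] at this
      exact (pow_eq_one_iff_of_nonneg (v.nonneg s) (by norm_num)).1 this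
    · obtain ⟨s, hs1, hs⟩ := h.exists_sq_sub_lt (x := (u - 1) / (π ^ k) ^ 2) (by
        rw [map_div₀, map_pow, hπk, ← pow_mul, mul_comm k]
        exact (div_le_one (pow_pos h.pos _)).2 hu.2)
      have hsk : v (π ^ k * s) ≤ ρ ^ k := by
        rw [map_mul, hπk]; exact mul_le_of_le_one_right hpk.le hs1
      refine ⟨1 + π ^ k * s, ?_, ?_⟩
      · rw [map_add_eq_left h.nonarch, map_one]
        rw [map_one]
        exact hsk.trans_lt (pow_lt_one₀ h.pos.le h.lt_one hk0.ne')
      · have e1 : (u : F) - (1 + π ^ k * s) ^ 2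
          = (π ^ k) ^ 2 * ((u - 1) / (π ^ k) ^ 2 - s ^ 2) + -(2 * (π ^ k * s)) := by
          field_simp; ring
        rw [e1]
        refine (h.nonarch _ _).trans_lt (max_lt ?_ ?_)
        · rw [map_mul, map_pow, hπk, ← pow_mul, mul_comm k]
          exact mul_lt_of_lt_one_right (pow_pos h.pos _) hs
        · rw [v.map_neg, map_mul, h.two]
          calc ρ ^ e * v (π ^ k * s) ≤ ρ ^ e * ρ ^ k := mul_le_mul_of_nonneg_left hsk (pow_pos h.pos e).le
            _ = ρ ^ (e + k) := (pow_add _ _ _).symm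
            _ < ρ ^ (2 * k) := (h.pow_lt_iff _ _).2 (by omega)
  have ht0 : t ≠ 0 := by rintro rfl; simp at ht
  refine (h.sqClass_mem_classGroup _ _).2 ⟨u * (Units.mk0 t ht0 ^ 2)⁻¹, ⟨?_, ?_⟩, Units.mk0 t ht0,
    by group⟩
  · simp [hu.1, ht.1]
  · have e1 : ((u * (Units.mk0 t ht0 ^ 2)⁻¹ : Fˣ) : F) - 1 = (t ^ 2)⁻¹ * (u - t ^ 2) := by
      push_cast; simp; field_simp
    rw [e1, map_mul, map_inv₀, map_pow, ht.1, one_pow, inv_one, one_mul]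
    exact h.le_of_lt_pow ht.2

end IsDyadic

end Dyadic

/-! ### Orders of the groups of square classes. -/

section Dyadic

variable {F : Type*} [Field F]

namespace IsDyadic

variable {v : AbsoluteValue F ℝ} {ρ : ℝ} {q e : ℕ} (h : IsDyadic v ρ q e)

include h

theorem norm_one_add {c : F} (hc : v c < 1) : v (1 + c) = 1 := by
  rw [map_add_eq_left h.nonarch, map_one]
  rwa [map_one]

theorem one_add_ne_zero {c : F} (hc : v c < 1) : 1 + c ≠ 0 := by
  intro h0
  have := h.norm_one_add hc
  simp [h0] at this

/-- The unit `1 + c` for small `c`. -/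
def oneAdd {c : F} (hc : v c < 1) : Fˣ := Units.mk0 (1 + c) (h.one_add_ne_zero hc)

theorem coe_oneAdd {c : F} (hc : v c < 1) : (h.oneAdd hc : F) = 1 + c := rfl

theorem oneAdd_mem {c : F} (hc : v c < 1) {j : ℕ} (hj : v c ≤ ρ ^ j) :
    h.oneAdd hc ∈ h.unitGroup j :=
  ⟨h.norm_one_add hc, by rwa [coe_oneAdd, add_sub_cancel_left]⟩

/-- The units `1 + π^(2k+1) a`, with `a` running over lifts of the residue field, represent the
quotient of two consecutive groups. They stay distinct modulo squares because an odd level below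
`2e` cannot be removed by a square. -/
theorem card_classGroup_odd {k : ℕ} (hk : k < e) :
    Nat.card (h.classGroup (2 * k + 1)) = q * Nat.card (h.classGroup (2 * k + 2)) := by
  obtain ⟨π, hπ⟩ := h.unif
  have hπ0 : π ≠ 0 := by rintro rfl; rw [map_zero] at hπ; exact h.pos.ne hπ
  set j := 2 * k + 1
  have hπj : v (π ^ j) = ρ ^ j := by rw [map_pow, hπ]
  have hj1 : ρ ^ j < 1 := pow_lt_one₀ h.pos.le h.lt_one (by omega)
  have hle (a) : v (π ^ j * h.lift a) ≤ ρ ^ j := by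
    rw [map_mul, hπj]
    exact mul_le_of_le_one_right (pow_pos h.pos _).le (h.lift_le a)
  have hlt (a) : v (π ^ j * h.lift a) < 1 := (hle a).trans_lt hj1
  let g (a) : Fˣ := h.oneAdd (hlt a)
  have hg (a) : g a ∈ h.unitGroup j := h.oneAdd_mem _ (hle a)
  let f : residueOf v h.nonarch × h.classGroup (2 * k + 2) → h.classGroup j := fun p =>
    ⟨sqClass (g p.1) * p.2, mul_mem (Subgroup.mem_map_of_mem _ (hg p.1))
      (h.classGroup_antitone (by omega) p.2.2)⟩
  have hcard : Nat.card (residueOf v h.nonarch × h.classGroup (2 * k + 2)) =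
      q * Nat.card (h.classGroup (2 * k + 2)) := by rw [Nat.card_prod, h.card_residue]
  refine (Nat.card_congr (Equiv.ofBijective f ⟨?_, ?_⟩)).symm.trans hcard
  · rintro ⟨a, x⟩ ⟨b, y⟩ hab
    have hab' : sqClass (g a) * (x : SquareClass F) = sqClass (g b) * y := congrArg Subtype.val hab
    have hmem : sqClass (g a * (g b)⁻¹) ∈ h.classGroup (2 * k + 2) := by
      have : sqClass (g a * (g b)⁻¹) = y * (x : SquareClass F)⁻¹ := by
        rw [map_mul, map_inv, ← mul_inv_cancel_right (sqClass (g a)) (x : SquareClass F), hab',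
          mul_assoc (sqClass (g b)), mul_inv_eq_iff_eq_mul]
        exact mul_comm (sqClass (g b)) _
      rw [this]
      exact mul_mem y.2 (inv_mem x.2)
    -- For distinct residues the quotient of the two units has exact level `2k + 1`, against
    -- `not_mem_classGroup`.
    have hab1 : a = b := by
      by_contra hne
      refine h.not_mem_classGroup hk ?_ hmem
      have h1 : v (h.lift a - h.lift b) = 1 := by
        refine le_antisymm ?_ (not_lt.1 fun hl => hne (h.lift_sub_lift_lt.1 hl))
        exact (map_sub_le_max h.nonarch _ _).trans (max_le (h.lift_le a) (h.lift_le b))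
      have e1 : ((g a * (g b)⁻¹ : Fˣ) : F) - 1 =
          π ^ j * (h.lift a - h.lift b) * ((g b : Fˣ) : F)⁻¹ := by
        have := (g b).ne_zero
        push_cast
        field_simp
        simp only [g, coe_oneAdd]; ring
      rw [e1, map_mul, map_mul, h1, map_inv₀, (hg b).1, hπj, inv_one, mul_one, mul_one]
    subst hab1
    rw [Subtype.ext (mul_left_cancel hab')]
  · rintro ⟨_, u, hu, rfl⟩
    have hx : v ((u - 1) / π ^ j) ≤ 1 := by
      rw [map_div₀, hπj]
      exact (div_le_one (pow_pos h.pos _)).2 hu.2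
    set a := h.red _ hx with ha
    have hmem : u * (g a)⁻¹ ∈ h.unitGroup (2 * k + 2) := by
      refine ⟨by simp [hu.1, (hg a).1], ?_⟩
      have e1 : ((u * (g a)⁻¹ : Fˣ) : F) - 1 =
          - (π ^ j * (h.lift a - (u - 1) / π ^ j)) * ((g a : Fˣ) : F)⁻¹ := by
        have := (g a).ne_zero
        push_cast
        field_simp
        simp only [g, coe_oneAdd]; ring
      rw [e1, map_mul, v.map_neg, map_mul, map_inv₀, (hg a).1, hπj, inv_one, mul_one]
      have h3 : v (π ^ j * (h.lift a - (u - 1) / π ^ j)) < ρ ^ j := by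
        rw [map_mul, hπj]
        exact mul_lt_of_lt_one_right (pow_pos h.pos _) (h.lift_red hx)
      have := h.le_of_lt_pow h3
      rwa [map_mul, hπj] at this
    refine ⟨(a, ⟨_, Subgroup.mem_map_of_mem sqClass hmem⟩), Subtype.ext ?_⟩
    simp only [f]
    rw [← map_mul]
    rw [mul_comm, inv_mul_cancel_right]

/-- At level `2e` the map `a ↦ 1 + 4a` identifies the group of classes with the residue field modulo
the image of `P(a) = a² + a`. The kernel of `P` is `{0, 1}`, so this quotient has order 2. Its
nontrivial element is the class of the unramified quadratic extension. -/
theorem card_classGroup_two_mul : Nat.card (h.classGroup (2 * e)) = 2 := by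
  have hchar := h.charP_residue
  have hfin := h.finite_residue
  have h2 := h.two_ne_zero
  have h4 : (4 : F) ≠ 0 := by
    have : (4 : F) = 2 * 2 := by norm_num
    rw [this]; exact mul_ne_zero h2 h2
  have hv4 : v 4 = ρ ^ (2 * e) := by
    have : (4 : F) = 2 * 2 := by norm_num
    rw [this, map_mul, h.two, ← pow_add, two_mul]
  have hj1 : ρ ^ (2 * e) < 1 := pow_lt_one₀ h.pos.le h.lt_one (by have := h.e_pos; omega)
  have hle (x : F) (hx : v x ≤ 1) : v (4 * x) ≤ ρ ^ (2 * e) := by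
    rw [map_mul, hv4]
    exact mul_le_of_le_one_right (pow_pos h.pos _).le hx
  have hlt (x : F) (hx : v x ≤ 1) : v (4 * x) < 1 := (hle x hx).trans_lt hj1
  have hbot (u : Fˣ) (hu : v ((u : F) - 1) < ρ ^ (2 * e)) : sqClass u = 1 := by
    obtain ⟨s, hs⟩ := h.exists_sq hu
    have hs0 : s ≠ 0 := by rintro rfl; simp at hs
    exact (sqClass_eq_one_iff u).2 ⟨Units.mk0 s hs0, Units.ext (by simpa using hs)⟩
  let g (a) : Fˣ := h.oneAdd (hlt _ (h.lift_le a))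
  -- Beyond level `2e` every unit is a square, so the class of a unit close to `1 + 4x` only depends
  -- on the residue of `x`.
  have hmulcl (u : Fˣ) (hu : v (u : F) = 1) (x : F) (a) (hx : v (h.lift a - x) < 1)
      (hux : v (u - (1 + 4 * x)) < ρ ^ (2 * e)) : sqClass u = sqClass (g a) := by
    rw [← mul_inv_eq_one, ← map_inv, ← map_mul]
    apply hbot
    have e1 : ((u * (g a)⁻¹ : Fˣ) : F) - 1 =
        ((u - (1 + 4 * x)) + - (4 * (h.lift a - x))) * ((g a : Fˣ) : F)⁻¹ := by
      have := (g a).ne_zero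
      push_cast
      field_simp
      simp only [g, coe_oneAdd]; ring
    have hg1 : v (g a : F) = 1 := h.norm_one_add (hlt _ (h.lift_le a))
    rw [e1, map_mul, map_inv₀, hg1, inv_one, mul_one]
    refine (h.nonarch _ _).trans_lt (max_lt hux ?_)
    rw [v.map_neg, map_mul, hv4]
    exact mul_lt_of_lt_one_right (pow_pos h.pos _) hx
  let ψ : Multiplicative (residueOf v h.nonarch) →* SquareClass F := MonoidHom.mk'
    (fun a => sqClass (g a.toAdd)) (by
      intro a b
      rw [← map_mul]
      refine (hmulcl _ ?_ (h.lift a.toAdd + h.lift b.toAdd) _ ?_ ?_).symm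
      · rw [Units.val_mul, map_mul, coe_oneAdd, coe_oneAdd, h.norm_one_add (hlt _ (h.lift_le _)),
          h.norm_one_add (hlt _ (h.lift_le _)), one_mul]
      · have hsum : v (h.lift a.toAdd + h.lift b.toAdd) ≤ 1 :=
          (h.nonarch _ _).trans (max_le (h.lift_le _) (h.lift_le _))
        have : h.red _ hsum = (a * b).toAdd := by
          have h3 : h.red _ hsum = h.red _ (h.lift_le a.toAdd) + h.red _ (h.lift_le b.toAdd) :=
            map_add (IsLocalRing.residue (unitBall v h.nonarch)) ⟨_, h.lift_le _⟩ ⟨_, h.lift_le _⟩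
          rw [h3, h.red_lift, h.red_lift, toAdd_mul]
        rw [← this]
        exact h.lift_red hsum
      · rw [Units.val_mul, coe_oneAdd, coe_oneAdd]
        have e2 : (1 + 4 * h.lift a.toAdd) * (1 + 4 * h.lift b.toAdd)
            - (1 + 4 * (h.lift a.toAdd + h.lift b.toAdd))
            = 4 * h.lift a.toAdd * (4 * h.lift b.toAdd) := by ring
        rw [e2, map_mul]
        calc v (4 * h.lift a.toAdd) * v (4 * h.lift b.toAdd)
            ≤ ρ ^ (2 * e) * v (4 * h.lift b.toAdd) :=
              mul_le_mul_of_nonneg_right (hle _ (h.lift_le _)) (v.nonneg _)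
          _ < ρ ^ (2 * e) := mul_lt_of_lt_one_right (pow_pos h.pos _) (hlt _ (h.lift_le _)))
  have hrange : ψ.range = h.classGroup (2 * e) := by
    apply le_antisymm
    · rintro _ ⟨a, rfl⟩
      exact Subgroup.mem_map_of_mem _ (h.oneAdd_mem _ (hle _ (h.lift_le _)))
    · rintro _ ⟨u, hu, rfl⟩
      have hx : v ((u - 1) / 4) ≤ 1 := by
        rw [map_div₀, hv4]
        exact (div_le_one (pow_pos h.pos _)).2 hu.2
      refine ⟨Multiplicative.ofAdd (h.red _ hx), (hmulcl u hu.1 _ _ (h.lift_red hx) ?_).symm⟩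
      have : (u : F) - (1 + 4 * ((u - 1) / 4)) = 0 := by field_simp; ring
      rw [this, map_zero]
      exact pow_pos h.pos _
  let P : residueOf v h.nonarch →+ residueOf v h.nonarch := AddMonoidHom.mk' (fun a => a ^ 2 + a)
    (fun a b => by rw [CharTwo.add_sq]; ring)
  have hPker : Nat.card P.ker = 2 := by
    have : (P.ker : Set (residueOf v h.nonarch)) = {0, 1} := by
      ext a
      simp only [SetLike.mem_coe, AddMonoidHom.mem_ker, P, AddMonoidHom.mk'_apply,
        Set.mem_insert_iff, Set.mem_singleton_iff]
      constructor
      · intro ha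
        have : a * (a + 1) = 0 := by linear_combination ha
        exact (mul_eq_zero.1 this).imp id CharTwo.add_eq_zero.1
      · rintro (rfl | rfl)
        · simp
        · rw [one_pow, CharTwo.add_self_eq_zero]
    have h3 : Nat.card P.ker = Nat.card ({0, 1} : Set (residueOf v h.nonarch)) := by rw [← this]; rfl
    rw [h3, Nat.card_coe_set_eq, Set.ncard_pair zero_ne_one]
  -- The equation `1 + 4a = (1 + 2y)²` amounts to `y² + y = a`; a solution `y` is integral, as
  -- otherwise `y²` would dominate.
  have hker (a : residueOf v h.nonarch) : ψ (Multiplicative.ofAdd a) = 1 ↔ a ∈ P.range := by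
    change sqClass (g a) = 1 ↔ _
    rw [sqClass_eq_one_iff]
    constructor
    · rintro ⟨s, hs⟩
      have hs' : 1 + 4 * h.lift a = (s : F) ^ 2 := by
        have := congrArg Units.val hs
        simpa [g, coe_oneAdd] using this
      set y := ((s : F) - 1) / 2 with hy
      have hy2 : y ^ 2 + y = h.lift a := by
        have : (s : F) = 1 + 2 * y := by rw [hy]; field_simp; ring
        rw [this] at hs'
        have : 4 * (y ^ 2 + y) = 4 * h.lift a := by linear_combination -hs'
        exact mul_left_cancel₀ h4 this
      have hy1 : v y ≤ 1 := by
        by_contra hgt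
        rw [not_le] at hgt
        have hlt2 : v y < v (y ^ 2) := by
          rw [map_pow, pow_two]; exact lt_mul_of_one_lt_left (by linarith) hgt
        have := map_add_eq_left h.nonarch hlt2
        rw [hy2] at this
        have := h.lift_le a
        linarith
      refine ⟨h.red y hy1, ?_⟩
      change IsLocalRing.residue (unitBall v h.nonarch) _ ^ 2 + IsLocalRing.residue (unitBall v h.nonarch) _ = a
      rw [← map_pow, ← map_add]
      conv_rhs => rw [← h.red_lift a]
      exact congrArg (IsLocalRing.residue (unitBall v h.nonarch)) (Subtype.ext hy2)
    · rintro ⟨b, rfl⟩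
      obtain ⟨⟨y, hy⟩, rfl⟩ := IsLocalRing.residue_surjective (R := unitBall v h.nonarch) b
      have h2y : v (2 * y) < 1 := by
        rw [map_mul]
        exact mul_lt_one_of_nonneg_of_lt_one_left (v.nonneg _) h.two_lt_one hy
      rw [← sqClass_eq_one_iff]
      have h1 : sqClass (h.oneAdd h2y ^ 2) = 1 := (sqClass_eq_one_iff _).2 ⟨_, rfl⟩
      rw [← h1]
      have hyy : v (y ^ 2 + y) ≤ 1 := by
        refine (h.nonarch _ _).trans (max_le ?_ hy)
        rw [map_pow]; exact pow_le_one₀ (v.nonneg _) hy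
      refine (hmulcl _ ?_ (y ^ 2 + y) _ ?_ ?_).symm
      · rw [Units.val_pow_eq_pow_val, map_pow, coe_oneAdd, h.norm_one_add h2y, one_pow]
      · have : P (IsLocalRing.residue (unitBall v h.nonarch) ⟨y, hy⟩) = h.red _ hyy := rfl
        rw [this]
        exact h.lift_red hyy
      · rw [Units.val_pow_eq_pow_val, coe_oneAdd]
        have : (1 + 2 * y) ^ 2 - (1 + 4 * (y ^ 2 + y)) = 0 := by ring
        rw [this, map_zero]
        exact pow_pos h.pos _
  have hkercard : Nat.card ψ.ker = Nat.card P.range := by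
    refine Nat.card_congr (Equiv.subtypeEquiv Multiplicative.toAdd fun a => ?_)
    exact hker a.toAdd
  have c1 : Nat.card ψ.ker * Nat.card ψ.range = Nat.card (residueOf v h.nonarch) := by
    have := ψ.ker.card_mul_index
    rw [Subgroup.index_ker] at this
    exact this
  have c2 : Nat.card P.ker * Nat.card P.range = Nat.card (residueOf v h.nonarch) := by
    have := P.ker.card_mul_index
    rwa [AddSubgroup.index_ker] at this
  have : 0 < Nat.card P.range := Nat.card_pos
  rw [← hrange]
  rw [hkercard] at c1
  rw [hPker] at c2
  nlinarith

-- An element of even valuation becomes a unit after division by an even power of a uniformizer, and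
-- squares have even valuation.
theorem sqClass_mem_classGroup_zero (u : Fˣ) :
    sqClass u ∈ h.classGroup 0 ↔ ∃ m : ℤ, v (u : F) = ρ ^ (2 * m) := by
  obtain ⟨π, hπ⟩ := h.unif
  have hπ0 : π ≠ 0 := by rintro rfl; rw [map_zero] at hπ; exact h.pos.ne hπ
  rw [sqClass_mem_classGroup]
  constructor
  · rintro ⟨w, hw, s, rfl⟩
    obtain ⟨m, hm⟩ := h.val s s.ne_zero
    refine ⟨m, ?_⟩
    rw [Units.val_mul, map_mul, hw.1, one_mul, Units.val_pow_eq_pow_val, map_pow, hm, mul_comm,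
      zpow_mul]
    rfl
  · rintro ⟨m, hm⟩
    refine ⟨u * (Units.mk0 π hπ0 ^ (2 * m))⁻¹, ?_, Units.mk0 π hπ0 ^ m, ?_⟩
    · have h1 : v ((u * (Units.mk0 π hπ0 ^ (2 * m))⁻¹ : Fˣ) : F) = 1 := by
        rw [Units.val_mul, map_mul, hm, Units.val_inv_eq_inv_val, map_inv₀,
          Units.val_zpow_eq_zpow_val, map_zpow₀, Units.val_mk0, hπ]
        exact mul_inv_cancel₀ (zpow_pos h.pos _).ne'
      refine ⟨h1, ?_⟩
      refine (map_sub_le_max h.nonarch _ _).trans ?_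
      rw [h1, map_one, max_self, pow_zero]
    · rw [mul_comm 2 m, zpow_mul]
      exact (inv_mul_cancel_right _ _).symm

/-- Parity of the valuation is a surjection onto a group of order 2, with kernel the classes of
units. -/
theorem card_squareClass : Nat.card (SquareClass F) = 2 * Nat.card (h.classGroup 0) := by
  obtain ⟨π, hπ⟩ := h.unif
  have hπ0 : π ≠ 0 := by rintro rfl; rw [map_zero] at hπ; exact h.pos.ne hπ
  have hidx : (h.classGroup 0).index = 2 := by
    rw [Subgroup.index_eq_two_iff]
    refine ⟨sqClass (Units.mk0 π hπ0), fun b => ?_⟩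
    obtain ⟨u, rfl⟩ := sqClass_surjective b
    rw [← map_mul, h.sqClass_mem_classGroup_zero, h.sqClass_mem_classGroup_zero]
    obtain ⟨n, hn⟩ := h.val u u.ne_zero
    rw [Units.val_mul, map_mul, Units.val_mk0, hπ, hn, ← zpow_add_one₀ h.pos.ne']
    rcases Int.even_or_odd' n with ⟨m, rfl | rfl⟩
    · right
      refine ⟨⟨m, rfl⟩, ?_⟩
      rintro ⟨m', hm'⟩
      have := h.zpow_inj hm'
      omega
    · left
      refine ⟨⟨m + 1, by congr 1; ring⟩, ?_⟩
      rintro ⟨m', hm'⟩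
      have := h.zpow_inj hm'
      omega
  rw [← hidx, mul_comm, Subgroup.card_mul_index]

/-- Descending from level `2e`, where the order is 2, each pair of levels contributes a factor `q`.
At `k = e` this gives `2 q^e` classes of units. -/
theorem card_classGroup_even {k : ℕ} (hk : k ≤ e) :
    Nat.card (h.classGroup (2 * (e - k))) = 2 * q ^ k := by
  induction k with
  | zero => simpa using h.card_classGroup_two_mul
  | succ k ih =>
    rw [h.classGroup_even (by omega), h.card_classGroup_odd (by omega)]
    have : 2 * (e - (k + 1)) + 2 = 2 * (e - k) := by omega
    rw [this, ih (by omega)]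
    ring

theorem q_pos : 0 < q := by
  have := h.finite_residue
  rw [← h.card_residue]
  exact Nat.card_pos

theorem finite_squareClass : Finite (SquareClass F) := by
  apply Nat.finite_of_card_ne_zero
  have := h.card_classGroup_even le_rfl
  rw [Nat.sub_self, mul_zero] at this
  rw [h.card_squareClass, this]
  have := h.q_pos
  positivity

end IsDyadic

end Dyadic

/-! ### Ramified square classes sorted by discriminant. -/

namespace IsDyadic

variable {F : Type*} [Field F] {v : AbsoluteValue F ℝ} {ρ : ℝ} {q e : ℕ} (h : IsDyadic v ρ q e)

/-- The square classes in the `k`-th odd jump of the filtration. -/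
def layer (h : IsDyadic v ρ q e) (k : ℕ) : Set (SquareClass F) :=
  {g | g ∈ h.classGroup (2 * k + 1) ∧ g ∉ h.classGroup (2 * k + 2)}

/-- The square classes of odd valuation. -/
def oddClasses (h : IsDyadic v ρ q e) : Set (SquareClass F) := {g | g ∉ h.classGroup 0}

/-- The square classes whose square roots generate ramified extensions. -/
def ramClasses (h : IsDyadic v ρ q e) : Set (SquareClass F) :=
  h.oddClasses ∪ ⋃ k ∈ (Finset.range e : Set ℕ), h.layer k

open Classical in
/-- The discriminant exponent attached to a square class. -/
noncomputable def discExp (h : IsDyadic v ρ q e) (g : SquareClass F) : ℕ :=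
  if g ∈ h.oddClasses then 2 * e + 1 else
    -- The default 0 only concerns classes outside `ramClasses`. A layer has a unique index by
    -- `layer_unique`, so the choice is harmless.
    2 * (e - if hk : ∃ k, g ∈ h.layer k then hk.choose else 0)

include h

theorem disjoint_layer {i j : ℕ} (hij : i < j) : Disjoint (h.layer i) (h.layer j) :=
  Set.disjoint_left.2 fun _ hi hj => hi.2 (h.classGroup_antitone (by omega) hj.1)

theorem layer_unique {i j : ℕ} {g : SquareClass F} (hi : g ∈ h.layer i) (hj : g ∈ h.layer j) :
    i = j := by
  rcases lt_trichotomy i j with hl | hl | hl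
  · exact absurd hj (Set.disjoint_left.1 (h.disjoint_layer hl) hi)
  · exact hl
  · exact absurd hi (Set.disjoint_left.1 (h.disjoint_layer hl) hj)

theorem disjoint_odd_layer (j : ℕ) : Disjoint h.oddClasses (h.layer j) :=
  Set.disjoint_left.2 fun _ hi hj => hi (h.classGroup_antitone (by omega) hj.1)

theorem discExp_odd {g : SquareClass F} (hg : g ∈ h.oddClasses) : h.discExp g = 2 * e + 1 :=
  if_pos hg

theorem discExp_layer {g : SquareClass F} {k : ℕ} (hg : g ∈ h.layer k) :
    h.discExp g = 2 * (e - k) := by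
  have hk : ∃ k, g ∈ h.layer k := ⟨k, hg⟩
  rw [discExp, if_neg (fun ho => Set.disjoint_left.1 (h.disjoint_odd_layer k) ho hg), dif_pos hk,
    h.layer_unique hk.choose_spec hg]

theorem ncard_oddClasses : h.oddClasses.ncard = 2 * q ^ e := by
  have := h.finite_squareClass
  have h1 := h.card_squareClass
  have h2 := h.card_classGroup_even le_rfl
  rw [Nat.sub_self, mul_zero] at h2
  have h3 := Set.ncard_add_ncard_compl ((h.classGroup 0 : Set (SquareClass F)))
  have h4 : (h.classGroup 0 : Set (SquareClass F)).ncard = Nat.card (h.classGroup 0) :=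
    (Nat.card_coe_set_eq _).symm
  have h5 : ((h.classGroup 0 : Set (SquareClass F))ᶜ) = h.oddClasses := rfl
  rw [h5] at h3
  omega

/-- A layer is the difference of two consecutive groups, of orders `2 q^(i+1)` and `2 q^i`. The
index `e - 1 - i` is chosen so that the discriminant exponent is `2 (i + 1)`. -/
theorem ncard_layer {i : ℕ} (hi : i < e) :
    (h.layer (e - 1 - i)).ncard + 2 * q ^ i = 2 * q ^ (i + 1) := by
  have := h.finite_squareClass
  have h1 := h.card_classGroup_even (k := i) hi.le
  have h2 := h.card_classGroup_even (k := i + 1) hi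
  have e1 : e - (i + 1) = e - 1 - i := by omega
  rw [e1, h.classGroup_even (by omega)] at h2
  have e2 : 2 * (e - i) = 2 * (e - 1 - i) + 2 := by omega
  rw [e2] at h1
  have h3 : h.layer (e - 1 - i) = (h.classGroup (2 * (e - 1 - i) + 1) : Set (SquareClass F)) \
    (h.classGroup (2 * (e - 1 - i) + 2) : Set (SquareClass F)) := rfl
  have hsub : (h.classGroup (2 * (e - 1 - i) + 2) : Set (SquareClass F)) ⊆
    (h.classGroup (2 * (e - 1 - i) + 1) : Set (SquareClass F)) := h.classGroup_antitone (by omega)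
  have h4 := Set.ncard_sdiff_add_ncard_of_subset hsub
  rw [← h3, ← Nat.card_coe_set_eq, ← Nat.card_coe_set_eq] at h4
  change _ + Nat.card (h.classGroup _) = Nat.card (h.classGroup _) at h4
  rw [h1, h2, Nat.card_coe_set_eq] at h4
  exact h4

/-- The weight `φ` is left arbitrary because two weights are needed later: `q^(-d)` for the upper
floor of a tower and `q^(-2d)` for the lower one. -/
theorem sum_ramClasses (φ : ℕ → ℝ) : ∑ᶠ g ∈ h.ramClasses, φ (h.discExp g) =
    2 * q ^ e * φ (2 * e + 1) + ∑ i ∈ Finset.range e, 2 * (q - 1) * q ^ i * φ (2 * (i + 1)) := by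
  have := h.finite_squareClass
  have hconst (S : Set (SquareClass F)) (d : ℕ) (hS : ∀ g ∈ S, h.discExp g = d) :
      ∑ᶠ g ∈ S, φ (h.discExp g) = S.ncard * φ d := by
    rw [finsum_mem_congr rfl (fun g hg => by rw [hS g hg]),
      finsum_mem_eq_finite_toFinset_sum _ (Set.toFinite S), Finset.sum_const, nsmul_eq_mul,
      Set.ncard_eq_toFinset_card S (Set.toFinite S)]
  rw [ramClasses, finsum_mem_union ?_ (Set.toFinite _) (Set.toFinite _),
    hconst _ _ (fun g hg => h.discExp_odd hg), h.ncard_oddClasses]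
  · congr 1
    · push_cast; ring
    rw [finsum_mem_biUnion ?_ (Finset.finite_toSet _) (fun _ _ => Set.toFinite _)]
    · have : ∑ᶠ i ∈ (Finset.range e : Set ℕ), ∑ᶠ g ∈ h.layer i, φ (h.discExp g) =
          ∑ i ∈ Finset.range e, (h.layer i).ncard * φ (2 * (e - i)) := by
        rw [finsum_mem_coe_finset]
        exact Finset.sum_congr rfl fun i _ => hconst _ _ fun g hg => h.discExp_layer hg
      refine this.trans ?_
      rw [← Finset.sum_range_reflect]
      refine Finset.sum_congr rfl fun i hi => ?_
      rw [Finset.mem_range] at hi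
      have h1 := h.ncard_layer hi
      have h2 : ((h.layer (e - 1 - i)).ncard : ℝ) + 2 * q ^ i = 2 * q ^ (i + 1) := by
        exact_mod_cast h1
      have e1 : e - (e - 1 - i) = i + 1 := by omega
      rw [e1]
      linear_combination φ (2 * (i + 1)) * h2
    · intro i _ j _ hij
      rcases lt_or_gt_of_ne hij with hl | hl
      · exact h.disjoint_layer hl
      · exact (h.disjoint_layer hl).symm
  · rw [Set.disjoint_iUnion_right]
    intro i
    rw [Set.disjoint_iUnion_right]
    exact fun _ => h.disjoint_odd_layer i

end IsDyadic

/-! ### Quadratic extensions and Kummer theory. -/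

section Quadratic

variable {F Ω : Type*} [Field F] [Field Ω] [Algebra F Ω]

/-- The restriction of an absolute value to a subfield. -/
noncomputable def restrictAbs (F : Type*) [Field F] [Algebra F Ω] (N : AbsoluteValue Ω ℝ) :
    AbsoluteValue F ℝ := N.comp (algebraMap F Ω).injective

theorem restrictAbs_apply (N : AbsoluteValue Ω ℝ) (x : F) :
    restrictAbs F N x = N (algebraMap F Ω x) := rfl

theorem mem_range_of_fixed [IsGalois F Ω] {x : Ω} (hx : ∀ σ : Ω ≃ₐ[F] Ω, σ x = x) :
    ∃ a : F, algebraMap F Ω a = x := by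
  have := (InfiniteGalois.mem_bot_iff_fixed x).2 hx
  rwa [IntermediateField.mem_bot] at this

/-- The other root of a quadratic equation is a conjugate. -/
theorem exists_conj [IsGalois F Ω] {x : Ω} {a b : F}
    (hx : x ^ 2 + algebraMap F Ω a * x + algebraMap F Ω b = 0)
    (hxF : ∀ c : F, algebraMap F Ω c ≠ x) : ∃ σ : Ω ≃ₐ[F] Ω, σ x = -algebraMap F Ω a - x := by
  by_contra hne
  push Not at hne
  obtain ⟨c, hc⟩ := mem_range_of_fixed (F := F) (x := x) (fun σ => by
    have h1 := congrArg σ hx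
    simp only [map_add, map_mul, map_pow, AlgEquiv.commutes, map_zero] at h1
    have h2 : (σ x - x) * (σ x - (-algebraMap F Ω a - x)) = 0 := by linear_combination h1 - hx
    rcases mul_eq_zero.1 h2 with h3 | h3
    · exact sub_eq_zero.1 h3
    · exact absurd (sub_eq_zero.1 h3) (hne σ))
  exact hxF c hc

/-- Galois invariance of the absolute value replaces completeness. If a root `y` were not in `F`,
its conjugate `-1 - y` would have the same absolute value; their product `-c` is small, so both are
small, yet they add up to `-1`. -/
theorem exists_artinSchreier_root [IsGalois F Ω] [IsAlgClosed Ω] {N : AbsoluteValue Ω ℝ}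
    (hN : IsNonarchimedean N) (hinv : ∀ (σ : Ω ≃ₐ[F] Ω) (x : Ω), N (σ x) = N x) (c : F)
    (hc : restrictAbs F N c < 1) : ∃ y : F, y ^ 2 + y = c := by
  obtain ⟨y, hy⟩ := IsAlgClosed.exists_root
    (Polynomial.X ^ 2 + Polynomial.X - Polynomial.C (algebraMap F Ω c)) (by
      have : (Polynomial.X ^ 2 + Polynomial.X - Polynomial.C (algebraMap F Ω c)).degree = 2 := by
        compute_degree!
      rw [this]; norm_num)
  have hy' : y ^ 2 + y - algebraMap F Ω c = 0 := by simpa using hy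
  by_cases hyF : ∃ a : F, algebraMap F Ω a = y
  · obtain ⟨a, rfl⟩ := hyF
    refine ⟨a, (algebraMap F Ω).injective ?_⟩
    rw [map_add, map_pow]
    linear_combination hy'
  · push Not at hyF
    obtain ⟨σ, hσ⟩ := exists_conj (x := y) (a := (1 : F)) (b := -c)
      (by rw [map_one, map_neg]; linear_combination hy') hyF
    rw [map_one] at hσ
    have h1 : N (-1 - y) = N y := by rw [← hσ, hinv]
    have h2 : N y * N y < 1 := by
      nth_rewrite 2 [← h1]
      rw [← map_mul]
      have : y * (-1 - y) = - algebraMap F Ω c := by linear_combination -hy'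
      rw [this, N.map_neg]
      exact hc
    have h3 : N y < 1 := by nlinarith [N.nonneg y]
    have h4 := hN (-1 - y) y
    rw [sub_add_cancel, N.map_neg, map_one, h1, max_self] at h4
    exact absurd h3 h4.not_gt

theorem finrank_adjoin_eq_two {x : Ω} {a b : F}
    (hx : x ^ 2 + algebraMap F Ω a * x + algebraMap F Ω b = 0)
    (hxF : ∀ c : F, algebraMap F Ω c ≠ x) :
    Module.finrank F (IntermediateField.adjoin F {x}) = 2 := by
  set p : Polynomial F := Polynomial.X ^ 2 + Polynomial.C a * Polynomial.X + Polynomial.C b with hp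
  have hdeg : p.natDegree = 2 := by rw [hp]; compute_degree!
  have hmonic : p.Monic := by rw [hp]; monicity!
  have hroot : Polynomial.aeval x p = 0 := by simpa [hp] using hx
  have hint : IsIntegral F x := ⟨p, hmonic, hroot⟩
  rw [IntermediateField.adjoin.finrank hint]
  refine le_antisymm ?_ ?_
  · rw [← hdeg]
    exact Polynomial.natDegree_le_of_dvd (minpoly.dvd F x hroot) hmonic.ne_zero
  · rw [minpoly.two_le_natDegree_iff hint]
    rintro ⟨c, hc⟩
    exact hxF c hc

theorem exists_quadratic_of_finrank {E : IntermediateField F Ω} (hE : Module.finrank F E = 2) {x : Ω}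
    (hx : x ∈ E) (hxF : ∀ c : F, algebraMap F Ω c ≠ x) :
    IntermediateField.adjoin F {x} = E ∧
      ∃ a b : F, x ^ 2 + algebraMap F Ω a * x + algebraMap F Ω b = 0 := by
  have hfin : FiniteDimensional F E := Module.finite_of_finrank_pos (by omega)
  have hint : IsIntegral F x := by
    have := IsIntegral.of_finite F (⟨x, hx⟩ : E)
    exact this.map E.val
  have hle : IntermediateField.adjoin F {x} ≤ E := by
    rw [IntermediateField.adjoin_le_iff]; simpa using hx
  have h2 : 2 ≤ (minpoly F x).natDegree := by
    rw [minpoly.two_le_natDegree_iff hint]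
    rintro ⟨c, hc⟩
    exact hxF c hc
  have heq : IntermediateField.adjoin F {x} = E := by
    refine IntermediateField.eq_of_le_of_finrank_le hle ?_
    rw [hE, IntermediateField.adjoin.finrank hint]
    exact h2
  refine ⟨heq, ?_⟩
  have hdeg : (minpoly F x).natDegree = 2 := by
    rw [← IntermediateField.adjoin.finrank hint, heq, hE]
  have hm := minpoly.monic hint
  have h0 := minpoly.aeval F x
  rw [Polynomial.aeval_eq_sum_range, hdeg] at h0
  refine ⟨(minpoly F x).coeff 1, (minpoly F x).coeff 0, ?_⟩
  have hc : (minpoly F x).coeff 2 = 1 := by rw [← hdeg]; exact hm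
  simp only [Finset.sum_range_succ, Finset.sum_range_zero, hc, Algebra.smul_def, pow_zero, pow_one,
    map_one] at h0
  linear_combination h0

variable (Ω) in
/-- The extension of `F` generated by the square roots of a square class. -/
def sqrtField (g : SquareClass F) : IntermediateField F Ω :=
  IntermediateField.adjoin F {x : Ω | ∃ u : Fˣ, sqClass u = g ∧ x ^ 2 = algebraMap F Ω u}

/-- Any other square root of a representative of the class is `± r s` with `s` in `F`, so one root
suffices. -/
theorem sqrtField_eq {r : Ω} {u : Fˣ} (hr : r ^ 2 = algebraMap F Ω u) :
    sqrtField Ω (sqClass u) = IntermediateField.adjoin F {r} := by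
  apply le_antisymm
  · rw [sqrtField, IntermediateField.adjoin_le_iff]
    rintro x ⟨w, hw, hx⟩
    obtain ⟨s, rfl⟩ := (sqClass_eq_iff _ _).1 hw
    have : (x - r * algebraMap F Ω s) * (x + r * algebraMap F Ω s) = 0 := by
      rw [Units.val_mul, Units.val_pow_eq_pow_val, map_mul, map_pow] at hx
      linear_combination hx - (algebraMap F Ω s) ^ 2 * hr
    have hmem : r * algebraMap F Ω s ∈ IntermediateField.adjoin F {r} :=
      mul_mem (IntermediateField.mem_adjoin_simple_self F r) (IntermediateField.algebraMap_mem _ _)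
    rcases mul_eq_zero.1 this with h1 | h1
    · rw [sub_eq_zero.1 h1]; exact hmem
    · rw [eq_neg_of_add_eq_zero_left h1]; exact neg_mem hmem
  · rw [IntermediateField.adjoin_le_iff, Set.singleton_subset_iff]
    exact IntermediateField.subset_adjoin _ _ ⟨u, rfl, hr⟩

theorem exists_sqrt [IsAlgClosed Ω] (u : Fˣ) : ∃ r : Ω, r ^ 2 = algebraMap F Ω u :=
  IsAlgClosed.exists_pow_nat_eq _ (by norm_num)

theorem fixes_adjoin {r y : Ω} {σ : Ω ≃ₐ[F] Ω} (hσ : σ r = r)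
    (hy : y ∈ IntermediateField.adjoin F {r}) : σ y = y := by
  have hle : IntermediateField.adjoin F {r} ≤
      IntermediateField.fixedField (Subgroup.zpowers σ) := by
    rw [IntermediateField.adjoin_le_iff, Set.singleton_subset_iff]
    rintro ⟨τ, n, rfl⟩
    have : ∀ n : ℤ, (σ ^ n) r = r := fun n => by
      have h1 : σ ∈ MulAction.stabilizer (Ω ≃ₐ[F] Ω) r := hσ
      exact (Subgroup.zpow_mem _ h1 n : _)
    exact this n
  exact hle hy ⟨σ, Subgroup.mem_zpowers σ⟩

/-- When `√u` and `√w` generate the same field, an automorphism changes the sign of both or of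
neither; their product is therefore fixed, lies in `F`, and shows that `u w` is a square. -/
theorem sqrtField_injective [IsGalois F Ω] [IsAlgClosed Ω] [CharZero Ω] :
    Function.Injective (sqrtField (F := F) Ω) := by
  intro g g' hgg
  obtain ⟨u, rfl⟩ := sqClass_surjective g
  obtain ⟨w, rfl⟩ := sqClass_surjective g'
  obtain ⟨r, hr⟩ := exists_sqrt (Ω := Ω) u
  obtain ⟨s, hs⟩ := exists_sqrt (Ω := Ω) w
  rw [sqrtField_eq hr, sqrtField_eq hs] at hgg
  have hr_mem : r ∈ IntermediateField.adjoin F {s} := hgg ▸ IntermediateField.mem_adjoin_simple_self F r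
  have hs_mem : s ∈ IntermediateField.adjoin F {r} := hgg ▸ IntermediateField.mem_adjoin_simple_self F s
  have hpm (σ : Ω ≃ₐ[F] Ω) {x : Ω} {t : Fˣ} (hx : x ^ 2 = algebraMap F Ω t) : σ x = x ∨ σ x = -x := by
    have h1 := congrArg σ hx
    rw [map_pow, AlgEquiv.commutes, ← hx] at h1
    exact sq_eq_sq_iff_eq_or_eq_neg.1 h1
  obtain ⟨c, hc⟩ := mem_range_of_fixed (F := F) (x := r * s) (fun σ => by
    rw [map_mul]
    rcases hpm σ hr with h1 | h1
    · rw [h1, fixes_adjoin h1 hs_mem]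
    · rcases hpm σ hs with h2 | h2
      · have := fixes_adjoin h2 hr_mem
        rw [this, h2]
      · rw [h1, h2]; ring)
  have hc2 : c ^ 2 = u * w := by
    apply (algebraMap F Ω).injective
    rw [map_pow, map_mul, hc, ← hr, ← hs]; ring
  have hc0 : c ≠ 0 := by
    rintro rfl
    have h0 : (u : F) * w ≠ 0 := mul_ne_zero u.ne_zero w.ne_zero
    exact h0 (by rw [← hc2]; ring)
  refine (sqClass_eq_iff _ _).2 ⟨Units.mk0 c hc0 * w⁻¹, Units.ext ?_⟩
  have := w.ne_zero
  push_cast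
  rw [Units.val_mk0, mul_pow, hc2]
  field_simp

end Quadratic


/-! ### Totally ramified quadratic extensions and their discriminants. -/

section Quadratic

variable {F Ω : Type*} [Field F] [Field Ω] [Algebra F Ω]

/-- A field `F` inside `Ω` on which the absolute value `N` of `Ω` is dyadic, with `N` invariant under
the automorphisms over `F`. -/
structure IsDyadicBase (F : Type*) [Field F] [Algebra F Ω] (N : AbsoluteValue Ω ℝ) (ρ : ℝ) (q e : ℕ) :
    Prop where
  dyadic : IsDyadic (restrictAbs F N) ρ q e
  nonarch : IsNonarchimedean N
  inv : ∀ (σ : Ω ≃ₐ[F] Ω) (x : Ω), N (σ x) = N x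

/-- The totally ramified quadratic extensions of `F`: those containing an element of valuation one half. -/
def ramQuadratics (F : Type*) [Field F] [Algebra F Ω] (N : AbsoluteValue Ω ℝ) (ρ : ℝ) :
    Set (IntermediateField F Ω) :=
  {E | Module.finrank F E = 2 ∧ ∃ ϖ ∈ E, N ϖ ^ 2 = ρ}

/-- `E` is generated by a root of an Eisenstein polynomial with discriminant of valuation `d`. -/
def HasDisc (N : AbsoluteValue Ω ℝ) (ρ : ℝ) (E : IntermediateField F Ω) (d : ℕ) : Prop :=
  ∃ ϖ ∈ E, N ϖ ^ 2 = ρ ∧ ∃ a b : F, ϖ ^ 2 + algebraMap F Ω a * ϖ + algebraMap F Ω b = 0 ∧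
    restrictAbs F N (a ^ 2 - 4 * b) = ρ ^ d

namespace IsDyadicBase

variable {N : AbsoluteValue Ω ℝ} {ρ : ℝ} {q e : ℕ} (H : IsDyadicBase F N ρ q e)
include H

/-- Values of `F` are integral powers of `ρ`, and `x` would have exponent one half. -/
theorem not_mem_range {x : Ω} (hx : N x ^ 2 = ρ) (c : F) : algebraMap F Ω c ≠ x := by
  rintro rfl
  by_cases hc : c = 0
  · rw [hc, map_zero, map_zero] at hx
    exact H.dyadic.pos.ne (by rw [← hx]; norm_num)
  · obtain ⟨n, hn⟩ := H.dyadic.val c hc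
    rw [restrictAbs_apply] at hn
    rw [hn, ← zpow_natCast, ← zpow_mul] at hx
    have := H.dyadic.zpow_inj (hx.trans (zpow_one ρ).symm)
    push_cast at this
    omega

/-- A root is small, since otherwise `x²` would dominate the other two terms; then `a x` is
negligible against `b`, and `x²` has the value of `b`. -/
theorem norm_eisenstein {x : Ω} {a b : F}
    (hx : x ^ 2 + algebraMap F Ω a * x + algebraMap F Ω b = 0)
    (ha : restrictAbs F N a ≤ ρ) (hb : restrictAbs F N b = ρ) : N x ^ 2 = ρ := by
  rw [restrictAbs_apply] at ha hb
  have hρ := H.dyadic.pos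
  have hρ1 := H.dyadic.lt_one
  have h0 := N.nonneg x
  have h1 : x ^ 2 = -(algebraMap F Ω a * x) + -algebraMap F Ω b := by linear_combination hx
  have hax : N (-(algebraMap F Ω a * x)) ≤ ρ * N x := by
    rw [N.map_neg, map_mul]; exact mul_le_mul_of_nonneg_right ha h0
  have hxlt : N x < 1 := by
    by_contra hge
    rw [not_lt] at hge
    have h2 := H.nonarch (-(algebraMap F Ω a * x)) (-algebraMap F Ω b)
    rw [← h1, map_pow, N.map_neg (algebraMap F Ω b), hb] at h2
    rcases le_max_iff.1 h2 with h3 | h3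
    · have := h3.trans hax; nlinarith
    · nlinarith
  rw [← map_pow, h1, map_add_eq_right H.nonarch, N.map_neg, hb]
  rw [N.map_neg (algebraMap F Ω b), hb]
  refine hax.trans_lt ?_
  nlinarith

theorem two_ne_zero : (2 : Ω) ≠ 0 := by
  have := H.dyadic.two_ne_zero
  intro h2
  exact this ((algebraMap F Ω).injective (by rw [map_ofNat, h2, map_zero]))

/-- Scaling by a power of the uniformizer makes the radicand `b` a uniformizer. Then `X² - b` is
Eisenstein with discriminant `4b`, of exponent `2e + 1`. -/
theorem sqrtField_odd [IsAlgClosed Ω] {g : SquareClass F} (hg : g ∈ H.dyadic.oddClasses) :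
    sqrtField Ω g ∈ ramQuadratics F N ρ ∧ HasDisc N ρ (sqrtField Ω g) (2 * e + 1) := by
  obtain ⟨u, rfl⟩ := sqClass_surjective g
  obtain ⟨r, hr⟩ := exists_sqrt (Ω := Ω) u
  obtain ⟨π, hπ⟩ := H.dyadic.unif
  have hρ := H.dyadic.pos
  have hπ0 : π ≠ 0 := by rintro rfl; rw [map_zero] at hπ; exact hρ.ne hπ
  obtain ⟨n, hn⟩ := H.dyadic.val u u.ne_zero
  obtain ⟨m, rfl⟩ : ∃ m, n = 2 * m + 1 := by
    rcases Int.even_or_odd' n with ⟨m, rfl | rfl⟩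
    · exact absurd ((H.dyadic.sqClass_mem_classGroup_zero u).2 ⟨m, hn⟩) hg
    · exact ⟨m, rfl⟩
  have hub : restrictAbs F N (u * (π ^ (-m)) ^ 2) = ρ := by
    rw [map_mul, hn, map_pow, map_zpow₀, hπ, ← zpow_natCast, ← zpow_mul, ← zpow_add₀ hρ.ne']
    have : 2 * m + 1 + -m * (2 : ℕ) = 1 := by push_cast; ring
    rw [this, zpow_one]
  set w := r * algebraMap F Ω (π ^ (-m)) with hw
  have hw2 : w ^ 2 = algebraMap F Ω (u * (π ^ (-m)) ^ 2) := by
    rw [hw, mul_pow, hr, map_mul, map_pow]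
  have hNw : N w ^ 2 = ρ := by rw [← map_pow, hw2]; exact hub
  have hrF (c : F) : algebraMap F Ω c ≠ r := by
    rintro rfl
    exact H.not_mem_range hNw (c * π ^ (-m)) (by rw [map_mul])
  have hmem : w ∈ sqrtField Ω (sqClass u) := by
    rw [sqrtField_eq hr]
    exact mul_mem (IntermediateField.mem_adjoin_simple_self F r) (IntermediateField.algebraMap_mem _ _)
  refine ⟨⟨?_, w, hmem, hNw⟩, w, hmem, hNw, 0, -(u * (π ^ (-m)) ^ 2), ?_, ?_⟩
  · rw [sqrtField_eq hr]
    exact finrank_adjoin_eq_two (a := 0) (b := -u) (by rw [map_zero, map_neg, hr]; ring) hrF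
  · rw [hw2, map_zero, map_neg]; ring
  · have : (0 : F) ^ 2 - 4 * -(u * (π ^ (-m)) ^ 2) = 2 * 2 * (u * (π ^ (-m)) ^ 2) := by ring
    rw [this, map_mul, hub, map_mul, H.dyadic.two]
    ring

/-- The element `(√u - 1) / π^k` is a root of `X² + 2π^(-k) X - (u - 1) π^(-2k)`. This is Eisenstein
because `u - 1` has exact level `2k + 1` and `k < e`; its discriminant `4 u π^(-2k)` has exponent `2
(e - k)`. -/
theorem sqrtField_layer [IsAlgClosed Ω] {g : SquareClass F} {k : ℕ} (hk : k < e)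
    (hg : g ∈ H.dyadic.layer k) :
    sqrtField Ω g ∈ ramQuadratics F N ρ ∧ HasDisc N ρ (sqrtField Ω g) (2 * (e - k)) := by
  obtain ⟨⟨u, hu, rfl⟩, hg2⟩ := hg
  obtain ⟨r, hr⟩ := exists_sqrt (Ω := Ω) u
  obtain ⟨π, hπ⟩ := H.dyadic.unif
  have hρ := H.dyadic.pos
  have hπ0 : π ≠ 0 := by rintro rfl; rw [map_zero] at hπ; exact hρ.ne hπ
  -- The level is exact, for otherwise the class would already lie in the next group.
  have hv : restrictAbs F N ((u : F) - 1) = ρ ^ (2 * k + 1) := by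
    refine le_antisymm hu.2 (not_lt.1 fun hlt => hg2 ?_)
    exact Subgroup.mem_map_of_mem sqClass ⟨hu.1, H.dyadic.le_of_lt_pow hlt⟩
  have hπΩ : algebraMap F Ω π ≠ 0 := by simpa using hπ0
  set w := (r - 1) * algebraMap F Ω ((π ^ k)⁻¹) with hw
  have hroot : w ^ 2 + algebraMap F Ω (2 * (π ^ k)⁻¹) * w +
      algebraMap F Ω (-((u - 1) * ((π ^ k)⁻¹) ^ 2)) = 0 := by
    rw [hw]
    simp only [map_mul, map_neg, map_pow, map_sub, map_one, map_ofNat]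
    linear_combination ((algebraMap F Ω (π ^ k)⁻¹)) ^ 2 * hr
  have hπk : restrictAbs F N (π ^ k)⁻¹ = (ρ ^ k)⁻¹ := by rw [map_inv₀, map_pow, hπ]
  have hpk : ρ ^ k ≠ 0 := (pow_pos hρ k).ne'
  have h2 : restrictAbs F N (2 * (π ^ k)⁻¹) = ρ ^ (e - k) := by
    rw [map_mul, hπk, H.dyadic.two, pow_sub₀ _ hρ.ne' hk.le]
  have hNw : N w ^ 2 = ρ := by
    refine H.norm_eisenstein hroot ?_ ?_
    · rw [h2]
      calc ρ ^ (e - k) ≤ ρ ^ 1 := (H.dyadic.pow_le_iff _ _).2 (by omega)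
        _ = ρ := pow_one _
    · rw [AbsoluteValue.map_neg, map_mul, hv, map_pow, hπk]
      field_simp; ring
  have hrF (c : F) : algebraMap F Ω c ≠ r := by
    rintro rfl
    exact H.not_mem_range hNw ((c - 1) * (π ^ k)⁻¹) (by rw [map_mul, map_sub, map_one])
  have hmem : w ∈ sqrtField Ω (sqClass u) := by
    rw [sqrtField_eq hr]
    exact mul_mem (sub_mem (IntermediateField.mem_adjoin_simple_self F r) (one_mem _))
      (IntermediateField.algebraMap_mem _ _)
  refine ⟨⟨?_, w, hmem, hNw⟩, w, hmem, hNw, _, _, hroot, ?_⟩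
  · rw [sqrtField_eq hr]
    exact finrank_adjoin_eq_two (a := 0) (b := -u) (by rw [map_zero, map_neg, hr]; ring) hrF
  · have : (2 * (π ^ k)⁻¹) ^ 2 - 4 * -((u - 1) * ((π ^ k)⁻¹) ^ 2) = (2 * (π ^ k)⁻¹) ^ 2 * (u : F) := by
      ring
    rw [this, map_mul, map_pow, h2, hu.1, mul_one, ← pow_mul, mul_comm]

/-- The element of valuation one half is a root of an Eisenstein polynomial `X² + aX + b`, and `E`
is generated by the square root of `a² - 4b`. Comparing `a²` with `4b` places this discriminant in
the filtration. -/
theorem exists_class [IsGalois F Ω] [IsAlgClosed Ω] {E : IntermediateField F Ω}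
    (hE : E ∈ ramQuadratics F N ρ) : ∃ g ∈ H.dyadic.ramClasses, sqrtField Ω g = E := by
  obtain ⟨hfin, w, hw, hNw⟩ := hE
  have hwF := H.not_mem_range hNw
  have hρ := H.dyadic.pos
  have hρ1 := H.dyadic.lt_one
  obtain ⟨hadj, a, b, hroot⟩ := exists_quadratic_of_finrank hfin hw hwF
  obtain ⟨σ, hσ⟩ := exists_conj hroot hwF
  have hb : restrictAbs F N b = ρ := by
    have h1 : algebraMap F Ω b = w * σ w := by rw [hσ]; linear_combination hroot
    rw [restrictAbs_apply, h1, map_mul, H.inv, ← hNw, pow_two]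
  have hNw1 : N w < 1 := by
    by_contra hge
    rw [not_lt] at hge
    nlinarith
  have ha : restrictAbs F N a < 1 := by
    have h1 : algebraMap F Ω a = -w + -σ w := by rw [hσ]; ring
    rw [restrictAbs_apply, h1]
    refine (H.nonarch _ _).trans_lt (max_lt ?_ ?_)
    · rwa [N.map_neg]
    · rwa [N.map_neg, H.inv]
  set r := 2 * w + algebraMap F Ω a with hr
  have hrF (c : F) : algebraMap F Ω c ≠ r := by
    intro hc
    refine hwF ((c - a) / 2) ?_
    have := H.two_ne_zero
    rw [map_div₀, map_sub, hc, map_ofNat, hr]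
    field_simp; ring
  have hr2 : r ^ 2 = algebraMap F Ω (a ^ 2 - 4 * b) := by
    rw [hr, map_sub, map_mul, map_pow, map_ofNat]
    linear_combination 4 * hroot
  have hD0 : a ^ 2 - 4 * b ≠ 0 := by
    intro h0
    rw [h0, map_zero] at hr2
    exact hrF 0 (by rw [map_zero, pow_eq_zero_iff (by norm_num : 2 ≠ 0) |>.1 hr2])
  have hrE : r ∈ E := add_mem (mul_mem (by exact_mod_cast natCast_mem E 2) hw)
    (IntermediateField.algebraMap_mem _ _)
  have hfield : sqrtField Ω (sqClass (Units.mk0 _ hD0)) = E := by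
    rw [sqrtField_eq (r := r) hr2]
    exact (exists_quadratic_of_finrank hfin hrE hrF).1
  refine ⟨_, ?_, hfield⟩
  have h4b : restrictAbs F N (4 * b) = ρ ^ (2 * e + 1) := by
    have : (4 : F) = 2 * 2 := by norm_num
    rw [map_mul, this, map_mul, H.dyadic.two, hb]
    ring
  -- For `a` smaller than 2 the term `4b` dominates and the exponent is `2e + 1`, which is odd.
  -- Otherwise, with `a` of exponent `i ≤ e`, the class is that of `1 - 4b / a²`, of level `2 (e -
  -- i) + 1`: the layer `e - i`.
  rcases lt_or_ge (restrictAbs F N a) (ρ ^ e) with hlt | hge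
  · left
    have h1 : restrictAbs F N (a ^ 2 - 4 * b) = ρ ^ (2 * e + 1) := by
      rw [sub_eq_add_neg, map_add_eq_right H.dyadic.nonarch, AbsoluteValue.map_neg, h4b]
      rw [AbsoluteValue.map_neg, h4b, map_pow]
      have := H.dyadic.le_of_lt_pow hlt
      calc restrictAbs F N a ^ 2 ≤ (ρ ^ (e + 1)) ^ 2 := pow_le_pow_left₀ (AbsoluteValue.nonneg _ _) this 2
        _ = ρ ^ (2 * e + 2) := by rw [← pow_mul]; congr 1; ring
        _ < ρ ^ (2 * e + 1) := (H.dyadic.pow_lt_iff _ _).2 (by omega)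
    intro hmem
    rw [SetLike.mem_coe.symm, SetLike.mem_coe, H.dyadic.sqClass_mem_classGroup_zero] at hmem
    obtain ⟨m, hm⟩ := hmem
    rw [Units.val_mk0, h1, ← zpow_natCast] at hm
    have := H.dyadic.zpow_inj hm
    push_cast at this
    omega
  · right
    have ha0 : a ≠ 0 := by
      rintro rfl
      rw [map_zero] at hge
      exact absurd hge (pow_pos hρ e).not_ge
    obtain ⟨n, hn⟩ := H.dyadic.val a ha0
    rw [hn, ← zpow_natCast, H.dyadic.zpow_le_iff] at hge
    rw [hn, ← zpow_zero ρ, H.dyadic.zpow_lt_iff] at ha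
    obtain ⟨i, rfl⟩ := Int.eq_ofNat_of_zero_le ha.le
    have hie : i ≤ e := by exact_mod_cast hge
    have hi0 : 0 < i := by exact_mod_cast ha
    rw [zpow_natCast] at hn
    have hc : restrictAbs F N (-(4 * b) / a ^ 2) = ρ ^ (2 * (e - i) + 1) := by
      rw [map_div₀, AbsoluteValue.map_neg, h4b, map_pow, hn, ← pow_mul, div_eq_mul_inv,
        ← pow_sub₀ _ hρ.ne' (by omega)]
      congr 1; omega
    have hc1 : restrictAbs F N (-(4 * b) / a ^ 2) < 1 := by
      rw [hc]; exact pow_lt_one₀ hρ.le hρ1 (by omega)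
    have hcl : sqClass (Units.mk0 _ hD0) = sqClass (H.dyadic.oneAdd hc1) := by
      refine (sqClass_eq_iff _ _).2 ⟨Units.mk0 a ha0, Units.ext ?_⟩
      rw [Units.val_mul, Units.val_pow_eq_pow_val, Units.val_mk0, Units.val_mk0,
        IsDyadic.coe_oneAdd]
      field_simp; ring
    rw [hcl]
    refine Set.mem_biUnion (x := e - i) (by simp; omega) ⟨?_, ?_⟩
    · exact Subgroup.mem_map_of_mem _ (H.dyadic.oneAdd_mem _ hc.le)
    · refine H.dyadic.not_mem_classGroup (by omega) ?_
      rw [IsDyadic.coe_oneAdd, add_sub_cancel_left, hc]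

/-- The totally ramified quadratic extensions of a dyadic field, counted by discriminant. -/
theorem sum_ramQuadratics [IsGalois F Ω] [IsAlgClosed Ω] [CharZero Ω] :
    (ramQuadratics F N ρ).Finite ∧ ∃ δ : IntermediateField F Ω → ℕ,
      (∀ E ∈ ramQuadratics F N ρ, HasDisc N ρ E (δ E)) ∧
      ∀ φ : ℕ → ℝ, ∑ᶠ E ∈ ramQuadratics F N ρ, φ (δ E) =
        2 * q ^ e * φ (2 * e + 1) + ∑ i ∈ Finset.range e, 2 * (q - 1) * q ^ i * φ (2 * (i + 1)) := by
  have hinj := sqrtField_injective (F := F) (Ω := Ω)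
  have hfin := H.dyadic.finite_squareClass
  have himg : ramQuadratics F N ρ = sqrtField Ω '' H.dyadic.ramClasses := by
    ext E
    constructor
    · exact fun hE => H.exists_class hE
    · rintro ⟨g, hg | hg, rfl⟩
      · exact (H.sqrtField_odd hg).1
      · simp only [Set.mem_iUnion, Finset.coe_range, Set.mem_Iio] at hg
        obtain ⟨k, hk, hg⟩ := hg
        exact (H.sqrtField_layer hk hg).1
  have hd : ∀ g ∈ H.dyadic.ramClasses, HasDisc N ρ (sqrtField Ω g) (H.dyadic.discExp g) := by
    rintro g (hg | hg)
    · rw [H.dyadic.discExp_odd hg]; exact (H.sqrtField_odd hg).2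
    · simp only [Set.mem_iUnion, Finset.coe_range, Set.mem_Iio] at hg
      obtain ⟨k, hk, hg⟩ := hg
      rw [H.dyadic.discExp_layer hg]
      exact (H.sqrtField_layer hk hg).2
  have hleft := Function.leftInverse_invFun hinj
  refine ⟨himg ▸ Set.toFinite _, fun E => H.dyadic.discExp (Function.invFun (sqrtField Ω) E), ?_, ?_⟩
  · rw [himg]
    rintro _ ⟨g, hg, rfl⟩
    simp only [hleft g]
    exact hd g hg
  · intro φ
    rw [himg, finsum_mem_image hinj.injOn]
    simp only [hleft _]
    exact H.dyadic.sum_ramClasses φ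

end IsDyadicBase

end Quadratic


/-! ### A ramified quadratic extension of a dyadic field is dyadic. -/

section Quadratic

variable {F Ω : Type*} [Field F] [Field Ω] [Algebra F Ω]

namespace IsDyadicBase

variable {N : AbsoluteValue Ω ℝ} {ρ : ℝ} {q e : ℕ} (H : IsDyadicBase F N ρ q e)
include H

omit H in
theorem linearIndependent_pair {E : IntermediateField F Ω} {w : E}
    (hwF : ∀ c : F, algebraMap F Ω c ≠ w) : LinearIndependent F ![1, w] := by
  rw [LinearIndependent.pair_iff]
  intro s t hst
  have hst' : algebraMap F Ω s + algebraMap F Ω t * w = 0 := by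
    have := congrArg (algebraMap E Ω) hst
    simpa [Algebra.smul_def] using this
  have ht : t = 0 := by
    by_contra ht
    refine hwF (-s / t) ?_
    have : algebraMap F Ω t ≠ 0 := by simpa using ht
    rw [map_div₀, map_neg, div_eq_iff this]
    linear_combination -hst'
  refine ⟨?_, ht⟩
  rw [ht, map_zero, zero_mul, add_zero] at hst'
  simpa using hst'

/-- The basis `1, ϖ` of a quadratic extension. -/
noncomputable def pairBasis {E : IntermediateField F Ω} (hE : Module.finrank F E = 2) {w : E}
    (hwF : ∀ c : F, algebraMap F Ω c ≠ w) : Module.Basis (Fin 2) F E :=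
  basisOfLinearIndependentOfCardEqFinrank (linearIndependent_pair hwF) (by rw [hE]; rfl)

omit H in
theorem coe_pairBasis {E : IntermediateField F Ω} (hE : Module.finrank F E = 2) {w : E}
    (hwF : ∀ c : F, algebraMap F Ω c ≠ w) : ⇑(pairBasis hE hwF) = ![1, w] :=
  coe_basisOfLinearIndependentOfCardEqFinrank _ _

omit H in
theorem exists_coords {E : IntermediateField F Ω} (hE : Module.finrank F E = 2) {w : Ω} (hw : w ∈ E)
    (hwF : ∀ c : F, algebraMap F Ω c ≠ w) (x : Ω) (hx : x ∈ E) :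
    ∃ a b : F, x = algebraMap F Ω a + algebraMap F Ω b * w := by
  have h1 := (pairBasis (w := ⟨w, hw⟩) hE hwF).sum_repr ⟨x, hx⟩
  have h2 := congrArg (algebraMap E Ω) h1
  rw [coe_pairBasis, Fin.sum_univ_two] at h2
  refine ⟨(pairBasis (w := ⟨w, hw⟩) hE hwF).repr ⟨x, hx⟩ 0,
    (pairBasis (w := ⟨w, hw⟩) hE hwF).repr ⟨x, hx⟩ 1, Eq.trans h2.symm ?_⟩
  simp [Algebra.smul_def]

/-- The absolute value on `F + F ϖ`. -/
theorem norm_coords {w : Ω} (hw : N w ^ 2 = ρ) (a b : F) :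
    N (algebraMap F Ω a + algebraMap F Ω b * w) =
      max (restrictAbs F N a) (restrictAbs F N b * N w) := by
  have hρ := H.dyadic.pos
  have hw0 : N w ≠ 0 := by rintro h0; rw [h0] at hw; norm_num at hw; exact hρ.ne hw
  by_cases ha : a = 0
  · subst ha
    rw [map_zero, zero_add, map_mul, map_zero, max_eq_right (mul_nonneg (AbsoluteValue.nonneg _ _) (N.nonneg _))]
    rfl
  by_cases hb : b = 0
  · subst hb
    rw [map_zero, zero_mul, add_zero, map_zero, zero_mul, max_eq_left (AbsoluteValue.nonneg _ _)]
    rfl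
  have hne : N (algebraMap F Ω a) ≠ N (algebraMap F Ω b * w) := by
    intro heq
    have hb' : algebraMap F Ω b ≠ 0 := by simpa using hb
    refine H.not_mem_range (x := algebraMap F Ω (a / b)) ?_ (a / b) rfl
    rw [map_div₀, map_div₀, heq, map_mul, mul_div_cancel_left₀ _ ((N.ne_zero_iff).2 hb'), hw]
  have hmul : N (algebraMap F Ω b * w) = restrictAbs F N b * N w := by rw [map_mul]; rfl
  rw [← hmul]
  rcases lt_or_gt_of_ne hne with hl | hl
  · rw [map_add_eq_right H.nonarch hl]
    exact (max_eq_right hl.le).symm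
  · rw [map_add_eq_left H.nonarch hl]
    exact (max_eq_left hl.le).symm

/-- The value 1 is excluded, since `b w` has half-integral exponent. This is why integral elements
have the residue of their `F`-coordinate. -/
theorem norm_mul_lt_one {w : Ω} (hw : N w ^ 2 = ρ) {b : F} (hb : restrictAbs F N b * N w ≤ 1) :
    restrictAbs F N b * N w < 1 := by
  refine lt_of_le_of_ne hb fun h1 => ?_
  by_cases hb0 : b = 0
  · rw [hb0, map_zero, zero_mul] at h1; norm_num at h1
  refine H.not_mem_range (x := algebraMap F Ω b⁻¹) ?_ b⁻¹ rfl
  rw [map_inv₀, map_inv₀, ← restrictAbs_apply, ← hw]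
  congr 1
  exact inv_eq_of_mul_eq_one_right h1

theorem norm_eq_sqrt_zpow {E : IntermediateField F Ω} (hE : Module.finrank F E = 2) {w : Ω}
    (hwE : w ∈ E) (hw : N w ^ 2 = ρ) {x : Ω} (hx : x ∈ E) (hx0 : x ≠ 0) :
    ∃ n : ℤ, N x = N w ^ n := by
  have hρ := H.dyadic.pos
  have hw0 : N w ≠ 0 := by rintro h0; rw [h0] at hw; norm_num at hw; exact hρ.ne hw
  obtain ⟨a, b, rfl⟩ := exists_coords hE hwE (H.not_mem_range hw) x hx
  have hvF (c : F) (hc : c ≠ 0) : ∃ n : ℤ, restrictAbs F N c = N w ^ (2 * n) := by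
    obtain ⟨n, hn⟩ := H.dyadic.val c hc
    exact ⟨n, by rw [hn, ← hw, zpow_mul]; rfl⟩
  have hpos := N.pos hx0
  rw [H.norm_coords hw] at hpos ⊢
  rcases max_choice (restrictAbs F N a) (restrictAbs F N b * N w) with h1 | h1 <;> rw [h1] at hpos ⊢
  · obtain ⟨n, hn⟩ := hvF a (by rintro rfl; simp at hpos)
    exact ⟨_, hn⟩
  · obtain ⟨n, hn⟩ := hvF b (by rintro rfl; simp at hpos)
    exact ⟨2 * n + 1, by rw [hn, zpow_add_one₀ hw0]⟩

/-- A totally ramified quadratic extension of a dyadic field is dyadic, with the same residue field. -/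
theorem extend [IsGalois F Ω] [IsAlgClosed Ω] {E : IntermediateField F Ω}
    (hE : Module.finrank F E = 2) {w : Ω} (hwE : w ∈ E) (hw : N w ^ 2 = ρ) :
    IsDyadicBase E N (N w) q (2 * e) := by
  have hρ := H.dyadic.pos
  have hw0 : N w ≠ 0 := by rintro h0; rw [h0] at hw; norm_num at hw; exact hρ.ne hw
  have hna : IsNonarchimedean (restrictAbs E N) := fun x y => by
    rw [restrictAbs_apply, map_add]; exact H.nonarch _ _
  have hinv : ∀ (σ : Ω ≃ₐ[E] Ω) (x : Ω), N (σ x) = N x := fun σ x => H.inv (σ.restrictScalars F) x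
  have hlift (a : residueOf (restrictAbs F N) H.dyadic.nonarch) :
      restrictAbs E N (algebraMap F E (H.dyadic.lift a)) ≤ 1 := H.dyadic.lift_le a
  -- Only a bijection of residue fields is needed, to transport finiteness and cardinality. It is
  -- surjective because an integral `a + b w` differs from `a` by an element of absolute value below
  -- 1.
  let f : residueOf (restrictAbs F N) H.dyadic.nonarch → residueOf (restrictAbs E N) hna := fun a =>
    IsLocalRing.residue (unitBall (restrictAbs E N) hna) ⟨algebraMap F E (H.dyadic.lift a), hlift a⟩
  have hf : Function.Bijective f := by
    constructor
    · intro a b hab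
      have h1 := (residue_unitBall_eq_iff _ _).1 hab
      rw [← H.dyadic.lift_sub_lift_lt]
      rw [← map_sub] at h1
      exact h1
    · intro y
      obtain ⟨⟨⟨x, hxE⟩, hx⟩, rfl⟩ := IsLocalRing.residue_surjective y
      obtain ⟨a, b, rfl⟩ := exists_coords hE hwE (H.not_mem_range hw) x hxE
      have hx' : N (algebraMap F Ω a + algebraMap F Ω b * w) ≤ 1 := hx
      rw [H.norm_coords hw, max_le_iff] at hx'
      refine ⟨H.dyadic.red a hx'.1, (residue_unitBall_eq_iff _ _).2 ?_⟩
      change N (algebraMap F Ω (H.dyadic.lift (H.dyadic.red a hx'.1)) -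
        (algebraMap F Ω a + algebraMap F Ω b * w)) < 1
      have e1 : algebraMap F Ω (H.dyadic.lift (H.dyadic.red a hx'.1)) -
        (algebraMap F Ω a + algebraMap F Ω b * w) =
        algebraMap F Ω (H.dyadic.lift (H.dyadic.red a hx'.1) - a) + algebraMap F Ω (-b) * w := by
        rw [map_sub, map_neg]; ring
      rw [e1, H.norm_coords hw, AbsoluteValue.map_neg]
      exact max_lt (H.dyadic.lift_red hx'.1) (H.norm_mul_lt_one hw hx'.2)
  have hfin := H.dyadic.finite_residue
  exact {
    nonarch := H.nonarch
    inv := hinv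
    dyadic := {
      nonarch := hna
      pos := lt_of_le_of_ne (N.nonneg w) (Ne.symm hw0)
      lt_one := by
        by_contra hge
        rw [not_lt] at hge
        have := H.dyadic.lt_one
        nlinarith
      unif := ⟨⟨w, hwE⟩, rfl⟩
      val := fun x hx => H.norm_eq_sqrt_zpow hE hwE hw x.2 (by simpa using hx)
      two := by
        have h2 := H.dyadic.two
        rw [restrictAbs_apply, map_ofNat] at h2
        rw [restrictAbs_apply, map_ofNat, h2, ← hw, ← pow_mul]
      e_pos := by have := H.dyadic.e_pos; omega
      finite_residue := Finite.of_surjective f hf.2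
      card_residue := by rw [← H.dyadic.card_residue]; exact (Nat.card_congr (Equiv.ofBijective f hf)).symm
      hensel := fun c hc => exists_artinSchreier_root H.nonarch hinv c hc } }

end IsDyadicBase

end Quadratic

/-! ### The two geometric sums. -/

/-- The mass formula for totally ramified quadratic extensions. -/
theorem sum_inv_pow {q e : ℕ} (hq : 2 ≤ q) :
    2 * (q : ℝ) ^ e * ((q : ℝ) ^ (2 * e + 1))⁻¹ +
      ∑ i ∈ Finset.range e, 2 * ((q : ℝ) - 1) * q ^ i * ((q : ℝ) ^ (2 * (i + 1)))⁻¹ = 2 * (q : ℝ)⁻¹ := by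
  have hq0 : (q : ℝ) ≠ 0 := by positivity
  -- Passing from `e` to `e + 1` lowers the odd contribution from `2 q^(-e-1)` to `2 q^(-e-2)`, and
  -- the new summand `2 (q - 1) q^(-e-2)` makes up the difference.
  induction e with
  | zero => simp
  | succ e ih =>
    rw [Finset.sum_range_succ]
    have : ∑ i ∈ Finset.range e, 2 * ((q : ℝ) - 1) * q ^ i * ((q : ℝ) ^ (2 * (i + 1)))⁻¹ =
      2 * (q : ℝ)⁻¹ - 2 * (q : ℝ) ^ e * ((q : ℝ) ^ (2 * e + 1))⁻¹ := by linear_combination ih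
    rw [this]
    field_simp
    ring

/-- The weights are `q^(-2d)` because the exponent of the lower field counts twice in a tower. The
factor `2q` is kept on the right so that it meets the `2 / q` of the upper floor in `4`. -/
theorem sum_inv_sq_pow {q e : ℕ} (hq : 2 ≤ q) :
    2 * (q : ℝ) ^ e * (((q : ℝ) ^ (2 * e + 1)) ^ 2)⁻¹ +
      ∑ i ∈ Finset.range e, 2 * ((q : ℝ) - 1) * q ^ i * (((q : ℝ) ^ (2 * (i + 1))) ^ 2)⁻¹ =
      2 * q * (1 / ((q : ℝ) ^ 2 + q + 1) * ((q : ℝ) ^ (-3 * (e : ℤ) - 3) + (q : ℝ) ^ (-3 * (e : ℤ) - 1)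
        + (q : ℝ) ^ (-2 : ℤ))) := by
  have hq0 : (q : ℝ) ≠ 0 := by positivity
  have hq1 : (q : ℝ) ^ 2 + q + 1 ≠ 0 := by positivity
  induction e with
  | zero =>
    simp only [Finset.range_zero, Finset.sum_empty, Nat.cast_zero, mul_zero, zero_sub]
    rw [show (-3 : ℤ) = -((3 : ℕ) : ℤ) by norm_num, show (-2 : ℤ) = -((2 : ℕ) : ℤ) by norm_num,
      show (-1 : ℤ) = -((1 : ℕ) : ℤ) by norm_num]
    simp only [zpow_neg, zpow_natCast]
    field_simp
    ring
  | succ e ih =>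
    rw [Finset.sum_range_succ]
    have h1 := ih
    have e1 : (-3 * ((e + 1 : ℕ) : ℤ) - 3) = -((3 * e + 6 : ℕ) : ℤ) := by push_cast; ring
    have e2 : (-3 * ((e + 1 : ℕ) : ℤ) - 1) = -((3 * e + 4 : ℕ) : ℤ) := by push_cast; ring
    have e3 : (-3 * (e : ℤ) - 3) = -((3 * e + 3 : ℕ) : ℤ) := by push_cast; ring
    have e4 : (-3 * (e : ℤ) - 1) = -((3 * e + 1 : ℕ) : ℤ) := by push_cast; ring
    rw [e3, e4] at h1
    rw [e1, e2]
    rw [zpow_neg, zpow_neg, zpow_natCast, zpow_natCast] at *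
    have h2 := eq_sub_of_add_eq' h1
    rw [h2]
    field_simp
    ring


/-! ### Transitive groups of degree 4 with a block of size 2. -/

section Groups

variable {G : Type*} [Group G]

/-- A group of order `8` generated by an element `r` of order `4` and an involution `h` inverting it. -/
theorem nonempty_mulEquiv_D4 [Finite G] (hcard : Nat.card G = 8) {r h : G} (hr4 : r ^ 4 = 1)
    (hr2 : r ^ 2 ≠ 1) (hh : h * h = 1) (hrel : h * r * h = r⁻¹) (hcomm : r * h ≠ h * r) :
    Nonempty (G ≃* D4) := by
  let p : ZMod 4 → G := fun i => r ^ i.val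
  have hmul (i j : ZMod 4) : p (i + j) = p i * p j := by
    simp only [p]
    rw [ZMod.val_add, ← pow_add, pow_eq_pow_mod (i.val + j.val) hr4]
  have h0 : p 0 = 1 := by simp [p]
  have hneg (i : ZMod 4) : p (-i) = (p i)⁻¹ := by
    rw [eq_inv_iff_mul_eq_one, ← hmul, neg_add_cancel, h0]
  have hconj (i : ZMod 4) : h * p i = p (-i) * h := by
    have h1 : h⁻¹ = h := inv_eq_of_mul_eq_one_right hh
    have h2 : h * p i * h⁻¹ = p (-i) := by
      rw [hneg]
      simp only [p]
      rw [← conj_pow, h1, hrel, inv_pow]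
    rw [← h2, inv_mul_cancel_right]
  have hconj' (i : ZMod 4) : p i * h = h * p (-i) := by rw [hconj, neg_neg]
  let f : D4 →* G := MonoidHom.mk' (fun x => match x with
    | DihedralGroup.r i => p i
    | DihedralGroup.sr i => h * p i) (by
      rintro (i | i) (j | j)
      · exact hmul i j
      · change h * p (j - i) = p i * (h * p j)
        rw [← mul_assoc, hconj', mul_assoc, ← hmul]; congr 2; ring
      · change h * p (i + j) = h * p i * p j
        rw [hmul, mul_assoc]
      · change p (j - i) = h * p i * (h * p j)
        rw [hconj, mul_assoc, ← mul_assoc h, hh, one_mul, ← hmul]; congr 1; ring)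
  have hr1 : r ≠ 1 := by rintro rfl; simp at hr2
  have hord : orderOf r = 4 := orderOf_eq_prime_pow (p := 2) (n := 1) (by simpa using hr2) hr4
  have hinj : Function.Injective f := by
    rw [injective_iff_map_eq_one]
    rintro (i | i) hi
    · change r ^ i.val = 1 at hi
      have := orderOf_dvd_of_pow_eq_one hi
      rw [hord] at this
      have h3 := Nat.eq_zero_of_dvd_of_lt this i.val_lt
      rw [(ZMod.val_eq_zero i).1 h3]
      rfl
    · change h * r ^ i.val = 1 at hi
      refine absurd ?_ hcomm
      have : h = (r ^ i.val)⁻¹ := eq_inv_of_mul_eq_one_left hi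
      rw [this]
      exact ((Commute.refl r).pow_right _).inv_right
  have hbij : Function.Bijective f := by
    rw [Nat.bijective_iff_injective_and_card]
    exact ⟨hinj, by rw [hcard, DihedralGroup.nat_card]⟩
  exact ⟨(MulEquiv.ofBijective f hbij).symm⟩

/-- The intermediate subgroups of index two. -/
def indexTwo (H : Subgroup G) : Set (Subgroup G) := {M | H ≤ M ∧ M.index = 2}

theorem eq_bot_of_normal {H : Subgroup G} (hcore : H.normalCore = ⊥) (hn : H.Normal) : H = ⊥ := by
  rw [← hcore, Subgroup.normalCore_eq_self]

/-- Two distinct subgroups of index two meet in a normal subgroup of index 4, which must be `H`,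
hence trivial. Every square lies in both of them. So an element of nontrivial square forces
uniqueness. -/
theorem sq_eq_one_of_two [Finite G] {H : Subgroup G} (hidx : H.index = 4) (hcore : H.normalCore = ⊥)
    {M M' : Subgroup G} (hM : M ∈ indexTwo H) (hM' : M' ∈ indexTwo H) (hne : M ≠ M') :
    H = ⊥ ∧ ∀ g : G, g ^ 2 = 1 := by
  have hMn : M.Normal := Subgroup.normal_of_index_eq_two hM.2
  have hMn' : M'.Normal := Subgroup.normal_of_index_eq_two hM'.2
  have hle : H ≤ M ⊓ M' := le_inf hM.1 hM'.1
  have hlt : (M ⊓ M').index = 4 := by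
    have h1 : (M ⊓ M').index ∣ 4 := hidx ▸ Subgroup.index_dvd_of_le hle
    have h2 : M.index ∣ (M ⊓ M').index := Subgroup.index_dvd_of_le inf_le_left
    have h3 : (M ⊓ M').index ≠ 2 := by
      intro h3
      have e1 : M ⊓ M' = M := by
        refine le_antisymm inf_le_left (Subgroup.relIndex_eq_one.1 ?_)
        have := Subgroup.relIndex_mul_index (inf_le_left : M ⊓ M' ≤ M)
        rw [h3, hM.2] at this
        omega
      have e2 : M ⊓ M' = M' := by
        refine le_antisymm inf_le_right (Subgroup.relIndex_eq_one.1 ?_)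
        have := Subgroup.relIndex_mul_index (inf_le_right : M ⊓ M' ≤ M')
        rw [h3, hM'.2] at this
        omega
      exact hne (e1.symm.trans e2)
    rw [hM.2] at h2
    have h4 := Nat.le_of_dvd (by norm_num) h1
    interval_cases (M ⊓ M').index <;> omega
  have heq : H = M ⊓ M' := by
    refine le_antisymm hle (Subgroup.relIndex_eq_one.1 ?_)
    have := Subgroup.relIndex_mul_index hle
    rw [hidx, hlt] at this
    omega
  have hbot : H = ⊥ := eq_bot_of_normal hcore (heq ▸ inferInstance)
  refine ⟨hbot, fun g => ?_⟩
  have : g ^ 2 ∈ M ⊓ M' := ⟨Subgroup.sq_mem_of_index_two hM.2 g, Subgroup.sq_mem_of_index_two hM'.2 g⟩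
  rwa [← heq, hbot, Subgroup.mem_bot] at this

theorem indexTwo_nonempty [Finite G] {H : Subgroup G} (hidx : H.index = 4)
    (hcard : Nat.card G = 4 ∨ Nat.card G = 8) : (indexTwo H).Nonempty := by
  have h1 := H.card_mul_index
  rw [hidx] at h1
  have : Fact (Nat.Prime 2) := ⟨Nat.prime_two⟩
  rcases hcard with hc | hc
  · obtain ⟨M, hM, hle⟩ := Sylow.exists_subgroup_card_pow_prime_le 2 (n := 0) (m := 1)
      (by rw [hc]; norm_num) H (by rw [hc] at h1; omega) (by norm_num)
    have := M.card_mul_index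
    exact ⟨M, hle, by rw [hM, hc] at this; omega⟩
  · obtain ⟨M, hM, hle⟩ := Sylow.exists_subgroup_card_pow_prime_le 2 (n := 1) (m := 2)
      (by rw [hc]; norm_num) H (by rw [hc] at h1; omega) (by norm_num)
    have := M.card_mul_index
    exact ⟨M, hle, by rw [hM, hc] at this; omega⟩

theorem ncard_indexTwo_eq_one [Finite G] {H : Subgroup G} (hidx : H.index = 4)
    (hcore : H.normalCore = ⊥) (hcard : Nat.card G = 4 ∨ Nat.card G = 8) {g : G} (hg : g ^ 2 ≠ 1) :
    (indexTwo H).ncard = 1 := by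
  obtain ⟨M, hM⟩ := indexTwo_nonempty hidx hcard
  rw [Set.ncard_eq_one]
  refine ⟨M, Set.eq_singleton_iff_unique_mem.2 ⟨hM, fun M' hM' => ?_⟩⟩
  by_contra hne
  exact hg ((sq_eq_one_of_two hidx hcore hM' hM hne).2 g)

theorem ncard_indexTwo_D4 [Finite G] {H : Subgroup G} (hidx : H.index = 4)
    (hcore : H.normalCore = ⊥) (f : G ≃* D4) : (indexTwo H).ncard = 1 := by
  refine ncard_indexTwo_eq_one hidx hcore (Or.inr ?_) (g := f.symm (DihedralGroup.r 1)) ?_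
  · rw [Nat.card_congr f.toEquiv, DihedralGroup.nat_card]
  · rw [← map_pow, ne_eq, EmbeddingLike.map_eq_one_iff]
    decide

theorem ncard_indexTwo_C4 [Finite G] {H : Subgroup G} (hidx : H.index = 4)
    (hcore : H.normalCore = ⊥) (f : G ≃* C4) : (indexTwo H).ncard = 1 := by
  refine ncard_indexTwo_eq_one hidx hcore (Or.inl ?_) (g := f.symm (Multiplicative.ofAdd 1)) ?_
  · rw [Nat.card_congr f.toEquiv]; simp
  · rw [← map_pow, ne_eq, EmbeddingLike.map_eq_one_iff]
    decide

theorem ncard_indexTwo_V4 [Finite G] {H : Subgroup G} (hidx : H.index = 4) (f : G ≃* V4) :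
    (indexTwo H).ncard = 3 := by
  have hc : Nat.card G = 4 := by rw [Nat.card_congr f.toEquiv]; simp
  have hsq (g : G) : g ^ 2 = 1 := by
    apply f.injective
    rw [map_pow, map_one]
    generalize f g = x
    revert x
    decide
  have hH : H = ⊥ := by
    have := H.card_mul_index
    rw [hidx, hc] at this
    exact Subgroup.card_eq_one.1 (by omega)
  have hz (g : G) (hg : g ≠ 1) : orderOf g = 2 := orderOf_eq_prime (hsq g) hg
  have himg : indexTwo H = Subgroup.zpowers '' {g : G | g ≠ 1} := by
    ext M
    constructor
    · rintro ⟨-, hM⟩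
      have h1 := M.card_mul_index
      rw [hM, hc] at h1
      have h2 : Nat.card M = 2 := by omega
      have : M ≠ ⊥ := by rintro rfl; simp at h2
      obtain ⟨⟨g, hgM⟩, hg1'⟩ := Subgroup.ne_bot_iff_exists_ne_one.1 this
      have hg1 : g ≠ 1 := by simpa using hg1'
      refine ⟨g, hg1, Subgroup.eq_of_le_of_card_ge ?_ ?_⟩
      · rw [Subgroup.zpowers_le]; exact hgM
      · rw [h2, Nat.card_zpowers, hz _ hg1]
    · rintro ⟨g, hg, rfl⟩
      refine ⟨by rw [hH]; exact bot_le, ?_⟩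
      have h1 := (Subgroup.zpowers g).card_mul_index
      rw [Nat.card_zpowers, hz g hg, hc] at h1
      omega
  have hinj : Set.InjOn (Subgroup.zpowers : G → Subgroup G) {g : G | g ≠ 1} := by
    intro a ha b hb hab
    have h1 : a ∈ Subgroup.zpowers b := hab ▸ Subgroup.mem_zpowers a
    rw [← mem_powers_iff_mem_zpowers, Submonoid.mem_powers_iff] at h1
    obtain ⟨n, rfl⟩ := h1
    rcases Nat.even_or_odd' n with ⟨m, rfl | rfl⟩
    · exact absurd (by rw [pow_mul, hsq, one_pow]) ha
    · rw [pow_add, pow_mul, hsq, one_pow, one_mul, pow_one]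
  rw [himg, hinj.ncard_image]
  have h3 := Set.ncard_add_ncard_compl ({1} : Set G)
  rw [Set.ncard_singleton, hc] at h3
  have h4 : ({1} : Set G)ᶜ = {g : G | g ≠ 1} := rfl
  rw [h4] at h3
  omega

/-- If `H` is normal it is trivial and `G` has order 4. Otherwise `H` has index two in `M` and meets
its conjugate by some `g` outside `M` trivially. This forces `H` to have order 2 and `M` to be
generated by two commuting involutions exchanged by `g`, which is D4. -/
theorem nonempty_mulEquiv_of_indexTwo [Finite G] {H : Subgroup G} (hidx : H.index = 4)
    (hcore : H.normalCore = ⊥) (hne : (indexTwo H).Nonempty) :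
    Nonempty (G ≃* D4) ∨ Nonempty (G ≃* C4) ∨ Nonempty (G ≃* V4) := by
  obtain ⟨M, hHM, hM⟩ := hne
  have hGcard := H.card_mul_index
  rw [hidx] at hGcard
  by_cases hn : H.Normal
  · right
    have hbot := eq_bot_of_normal hcore hn
    rw [hbot, Subgroup.card_bot, one_mul] at hGcard
    by_cases hsq : ∀ g : G, g ^ 2 = 1
    · right
      have : IsKleinFour G := ⟨hGcard.symm, by
        refine ((Nat.dvd_prime Nat.prime_two).1
          (Monoid.exponent_dvd_of_forall_pow_eq_one hsq)).resolve_left fun h1 => ?_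
        rw [Monoid.exp_eq_one_iff, ← Finite.card_le_one_iff_subsingleton, ← hGcard] at h1
        norm_num at h1⟩
      exact IsKleinFour.nonempty_mulEquiv
    · left
      push Not at hsq
      obtain ⟨g, hg⟩ := hsq
      have hord : orderOf g = 4 := by
        refine orderOf_eq_prime_pow (p := 2) (n := 1) (by simpa using hg) ?_
        rw [show 2 ^ (1 + 1) = Nat.card G by rw [← hGcard]; norm_num]
        exact pow_card_eq_one'
      have : IsCyclic G := isCyclic_of_orderOf_eq_card g (by rw [hord, hGcard])
      exact ⟨mulEquivOfCyclicCardEq (by rw [← hGcard]; simp)⟩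
  · left
    have hMn : M.Normal := Subgroup.normal_of_index_eq_two hM
    have hrel : H.relIndex M = 2 := by
      have := Subgroup.relIndex_mul_index hHM
      rw [hidx, hM] at this
      omega
    have hHn : (H.subgroupOf M).Normal := Subgroup.normal_of_index_eq_two hrel
    have hconjM (m : G) (hm : m ∈ M) (x : G) (hx : x ∈ H) : m * x * m⁻¹ ∈ H := by
      have := hHn.conj_mem ⟨x, hHM hx⟩ (by rwa [Subgroup.mem_subgroupOf]) ⟨m, hm⟩
      rwa [Subgroup.mem_subgroupOf] at this
    have hmulM (a b : G) (ha : a ∈ M) (hb : b ∈ M) : a * b ∈ H ↔ (a ∈ H ↔ b ∈ H) := by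
      have := Subgroup.mul_mem_iff_of_index_two (H := H.subgroupOf M) hrel (a := ⟨a, ha⟩) (b := ⟨b, hb⟩)
      simp only [Subgroup.mem_subgroupOf] at this
      exact this
    obtain ⟨g, x0, hx0, hgx0⟩ : ∃ g x, x ∈ H ∧ g * x * g⁻¹ ∉ H := by
      by_contra hcon
      push Not at hcon
      exact hn ⟨fun x hx g => hcon g x hx⟩
    have hgM : g ∉ M := fun hg => hgx0 (hconjM g hg x0 hx0)
    -- `M` normalises `H` and has index two, so `H` has only two conjugates; an element common to
    -- both is in the core.
    have hcore1 (y : G) (hy : y ∈ H) (hy' : g⁻¹ * y * g ∈ H) : y = 1 := by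
      have : y ∈ H.normalCore := by
        intro x
        by_cases hx : x ∈ M
        · exact hconjM x hx y hy
        · have hxg : x * g ∈ M := (Subgroup.mul_mem_iff_of_index_two hM).2 (by simp [hx, hgM])
          have := hconjM (x * g) hxg _ hy'
          have e1 : x * g * (g⁻¹ * y * g) * (x * g)⁻¹ = x * y * x⁻¹ := by group
          rwa [e1] at this
      rwa [hcore, Subgroup.mem_bot] at this
    have hout (a : G) (ha : a ∈ H) (ha1 : a ≠ 1) : g * a * g⁻¹ ∉ H := fun hmem => ha1 (by
      have := hcore1 (g * a * g⁻¹) hmem (by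
        have : g⁻¹ * (g * a * g⁻¹) * g = a := by group
        rwa [this])
      simpa using this)
    have hin (a : G) (ha : a ∈ H) : g * a * g⁻¹ ∈ M := hMn.conj_mem a (hHM ha) g
    -- The conjugates of `a` and `b` by `g` lie in `M` outside `H`, so their product lies in `H`; as
    -- it is also conjugate to `a b`, this product is trivial. Hence `H` has a single nontrivial
    -- element.
    have hab (a b : G) (ha : a ∈ H) (hb : b ∈ H) (ha1 : a ≠ 1) (hb1 : b ≠ 1) : a * b = 1 := by
      by_contra hab
      refine hout (a * b) (mul_mem ha hb) hab ?_
      have : g * (a * b) * g⁻¹ = (g * a * g⁻¹) * (g * b * g⁻¹) := by group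
      rw [this, hmulM _ _ (hin a ha) (hin b hb)]
      exact iff_of_false (hout a ha ha1) (hout b hb hb1)
    set h := x0
    have hh1 : h ≠ 1 := by
      intro h1
      rw [h1] at hgx0
      simp at hgx0
    have hh : h * h = 1 := hab h h hx0 hx0 hh1 hh1
    have hHel (b : G) (hb : b ∈ H) (hb1 : b ≠ 1) : b = h :=
      mul_right_cancel (b := h) ((hab b h hb hx0 hb1 hh1).trans hh.symm)
    have hHcard : Nat.card H = 2 := by
      have : (H : Set G) = {1, h} := by
        ext b
        simp only [SetLike.mem_coe, Set.mem_insert_iff, Set.mem_singleton_iff]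
        constructor
        · exact fun hb => or_iff_not_imp_left.2 (hHel b hb)
        · rintro (rfl | rfl)
          · exact one_mem H
          · exact hx0
      have h2 : Nat.card H = (H : Set G).ncard := Nat.card_coe_set_eq _
      rw [h2, this, Set.ncard_pair hh1.symm]
    have hG8 : Nat.card G = 8 := by rw [← hGcard, hHcard]
    have hcommM (m : G) (hm : m ∈ M) : m * h = h * m := by
      have h2 := hHel _ (hconjM m hm h hx0) (by simpa using hh1)
      nth_rewrite 2 [← h2]
      group
    set h' := g * h * g⁻¹ with hh'
    have hh'M : h' ∈ M := hin h hx0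
    have hh'H : h' ∉ H := hout h hx0 hh1
    have hne : h' ≠ h := fun h1 => hh'H (h1 ▸ hx0)
    have hh'2 : h' * h' = 1 := by
      have : h' * h' = g * (h * h) * g⁻¹ := by rw [hh']; group
      rw [this, hh]; group
    have hgM2 : g ^ 2 ∈ M := Subgroup.sq_mem_of_index_two hM g
    have hgh' : g * h' * g⁻¹ = h := by
      have : g * h' * g⁻¹ = g ^ 2 * h * (g ^ 2)⁻¹ := by
        simp only [hh', pow_two, mul_assoc, mul_inv_rev]
      rw [this, hcommM _ hgM2, mul_inv_cancel_right]
    have hcomm' : h * h' = h' * h := (hcommM h' hh'M).symm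
    -- `g²` lies in `M = {1, h, h', h h'}` and commutes with `g`, whereas `g` exchanges `h` and
    -- `h'`.
    have hg2 : g ^ 2 = 1 ∨ g ^ 2 = h * h' := by
      by_cases hgH : g ^ 2 ∈ H
      · left
        by_contra hg1
        have h2 := hHel _ hgH hg1
        apply hne
        rw [hh', ← h2]; group
      · right
        have h3 : g ^ 2 * h' ∈ H := (hmulM _ _ hgM2 hh'M).2 (iff_of_false hgH hh'H)
        by_cases h4 : g ^ 2 * h' = 1
        · exfalso
          have h5 : g ^ 2 = h' := by
            rw [← hh'2] at h4
            exact mul_right_cancel h4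
          apply hne
          rw [← hgh', ← h5]; group
        · have h5 := hHel _ h3 h4
          rw [← h5, mul_assoc, hh'2, mul_one]
    have hhh : (h * h') ^ 2 = 1 := by
      rw [pow_two]
      calc h * h' * (h * h') = h * (h' * h) * h' := by group
        _ = h * (h * h') * h' := by rw [hcomm']
        _ = (h * h) * (h' * h') := by group
        _ = 1 := by rw [hh, hh'2, one_mul]
    -- The rotation of order 4 is `g h` when `g` is an involution and `g` itself otherwise.
    obtain ⟨r, hr2, hrh⟩ : ∃ r : G, r ^ 2 = h * h' ∧ r * h * r⁻¹ = h' := by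
      rcases hg2 with h1 | h1
      · refine ⟨g * h, ?_, ?_⟩
        · calc (g * h) ^ 2 = (g * h * g⁻¹) * g ^ 2 * h := by rw [pow_two, pow_two]; group
            _ = h' * h := by rw [h1, mul_one]
            _ = h * h' := hcomm'.symm
        · rw [hh']; group
      · exact ⟨g, h1, rfl⟩
    have hinvh : h⁻¹ = h := inv_eq_of_mul_eq_one_right hh
    refine nonempty_mulEquiv_D4 hG8 (r := r) (h := h) ?_ ?_ hh ?_ ?_
    · rw [show 4 = 2 * 2 from rfl, pow_mul, hr2, hhh]
    · rw [hr2]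
      intro h1
      apply hne
      have : h * h' = h * h := h1.trans hh.symm
      exact mul_left_cancel this
    · have hr3 : r⁻¹ = r ^ 2 * r := by
        have h4 : r ^ 2 * r * r = 1 := by
          calc r ^ 2 * r * r = (r ^ 2) ^ 2 := by group
            _ = 1 := by rw [hr2, hhh]
        exact (eq_inv_of_mul_eq_one_left h4).symm
      rw [hr3, hr2, ← hrh]
      group
    · intro h1
      apply hne
      rw [← hrh, h1, mul_inv_cancel_right]

end Groups


/-! ### Quadratic subfields through the Galois correspondence. -/

section QuadraticSubfields

variable {K : Type*} [Field K] [CharZero K]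

/-- The quadratic subextensions of an extension. -/
def quadSub {Ω : Type*} [Field Ω] [Algebra K Ω] (L : IntermediateField K Ω) :
    Set (IntermediateField K Ω) := {E | E ≤ L ∧ Module.finrank K E = 2}

/-- The Galois group of the normal closure relative to the given extension. -/
noncomputable def relGaloisGroup (L : IntermediateField K (AlgebraicClosure K)) :
    Subgroup (GaloisClosureGroup K L) :=
  (IntermediateField.restrict L.le_normalClosure).fixingSubgroup

omit [CharZero K] in
theorem finiteDimensional_closure (L : IntermediateField K (AlgebraicClosure K))
    (hL : Module.finrank K L = 4) :
    FiniteDimensional K (IntermediateField.normalClosure K L (AlgebraicClosure K)) := by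
  have : FiniteDimensional K L := Module.finite_of_finrank_pos (by omega)
  exact normalClosure.is_finiteDimensional K L (AlgebraicClosure K)

theorem isGalois_closure (L : IntermediateField K (AlgebraicClosure K)) :
    IsGalois K (IntermediateField.normalClosure K L (AlgebraicClosure K)) := by
  have : Normal K (IntermediateField.normalClosure K L (AlgebraicClosure K)) :=
    normalClosure.normal K L (AlgebraicClosure K)
  exact ⟨⟩

theorem index_relGaloisGroup (L : IntermediateField K (AlgebraicClosure K))
    (hL : Module.finrank K L = 4) : (relGaloisGroup L).index = 4 := by
  have := isGalois_closure L
  rw [relGaloisGroup, ← IntermediateField.finrank_eq_fixingSubgroup_index, ← hL]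
  exact (IntermediateField.restrictAlgEquiv L.le_normalClosure).toLinearEquiv.finrank_eq.symm

/-- The fixed field of the core is normal over `K` and contains `L`, so it is the whole normal
closure. -/
theorem normalCore_relGaloisGroup (L : IntermediateField K (AlgebraicClosure K))
    (hL : Module.finrank K L = 4) : (relGaloisGroup L).normalCore = ⊥ := by
  have := isGalois_closure L
  have := finiteDimensional_closure L hL
  set C := (relGaloisGroup L).normalCore
  have hnorm : Normal K (IntermediateField.fixedField C) := inferInstance
  have hle : IntermediateField.restrict L.le_normalClosure ≤ IntermediateField.fixedField C := by
    rw [IntermediateField.le_iff_le]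
    exact Subgroup.normalCore_le _
  have hle2 : L ≤ IntermediateField.lift (IntermediateField.fixedField C) := by
    refine (IntermediateField.lift_restrict L.le_normalClosure).symm.le.trans ?_
    exact IntermediateField.map_mono _ hle
  have hnorm2 : Normal K (IntermediateField.lift (IntermediateField.fixedField C)) :=
    Normal.of_algEquiv (IntermediateField.liftAlgEquiv _)
  have hle3 := IntermediateField.normalClosure_le_iff_of_normal.2 hle2
  have htop : IntermediateField.fixedField C = ⊤ := by
    rw [eq_top_iff]
    intro x _
    exact (IntermediateField.mem_lift x).1 (hle3 x.2)
  rw [← IntermediateField.fixingSubgroup_fixedField C, htop, IntermediateField.fixingSubgroup_top]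

theorem ncard_quadSub (L : IntermediateField K (AlgebraicClosure K))
    (hL : Module.finrank K L = 4) : (quadSub L).ncard = (indexTwo (relGaloisGroup L)).ncard := by
  have := isGalois_closure L
  have := finiteDimensional_closure L hL
  have himg : quadSub L = (fun M : Subgroup (GaloisClosureGroup K L) =>
      IntermediateField.lift (IntermediateField.fixedField M)) '' indexTwo (relGaloisGroup L) := by
    ext E
    constructor
    · rintro ⟨hE, h2⟩
      have hE' := hE.trans L.le_normalClosure
      refine ⟨(IntermediateField.restrict hE').fixingSubgroup, ⟨?_, ?_⟩, ?_⟩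
      · refine IntermediateField.fixingSubgroup_le ?_
        intro x hx
        rw [IntermediateField.mem_restrict] at hx ⊢
        exact hE hx
      · rw [← IntermediateField.finrank_eq_fixingSubgroup_index, ← h2]
        exact (IntermediateField.restrictAlgEquiv hE').toLinearEquiv.finrank_eq.symm
      · change IntermediateField.lift (IntermediateField.fixedField _) = E
        rw [IsGalois.fixedField_fixingSubgroup, IntermediateField.lift_restrict]
    · rintro ⟨M, ⟨hM, hM2⟩, rfl⟩
      refine ⟨?_, ?_⟩
      · change IntermediateField.lift _ ≤ L
        refine le_trans ?_ (IntermediateField.lift_restrict L.le_normalClosure).le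
        refine IntermediateField.map_mono _ ?_
        rw [← IsGalois.fixedField_fixingSubgroup (IntermediateField.restrict L.le_normalClosure)]
        exact IntermediateField.fixedField_antitone hM
      · change Module.finrank K (IntermediateField.lift (IntermediateField.fixedField M)) = 2
        rw [← (IntermediateField.liftAlgEquiv (IntermediateField.fixedField M)).toLinearEquiv.finrank_eq,
          IntermediateField.finrank_eq_fixingSubgroup_index,
          IntermediateField.fixingSubgroup_fixedField, hM2]
  rw [himg, Set.ncard_image_of_injective]
  intro M M' h
  have h1 := IntermediateField.lift_injective _ h
  rw [← IntermediateField.fixingSubgroup_fixedField M, h1,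
    IntermediateField.fixingSubgroup_fixedField M']

omit [CharZero K] in
theorem closureGroup_congr {L L' : IntermediateField K (AlgebraicClosure K)} (f : L ≃ₐ[K] L') :
    Nonempty (GaloisClosureGroup K L ≃* GaloisClosureGroup K L') := by
  have h : IntermediateField.normalClosure K L (AlgebraicClosure K) =
      IntermediateField.normalClosure K L' (AlgebraicClosure K) := by
    rw [normalClosure_def, normalClosure_def]
    refine le_antisymm (iSup_le fun g => ?_) (iSup_le fun g => ?_)
    · refine le_iSup_of_le (g.comp f.symm.toAlgHom) ?_
      rintro _ ⟨x, rfl⟩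
      exact ⟨f x, by simp⟩
    · refine le_iSup_of_le (g.comp f.toAlgHom) ?_
      rintro _ ⟨x, rfl⟩
      exact ⟨f.symm x, by simp⟩
  exact ⟨(IntermediateField.equivOfEq h).autCongr⟩

end QuadraticSubfields


/-! ### Multiplicative norms on discrete valuation rings. -/

section NormRing

variable {O : Type*} [CommRing O] [IsDomain O]

/-- In a discrete valuation ring, a multiplicative norm is determined by the multiplicity. -/
theorem norm_eq_pow_multiplicity [IsDiscreteValuationRing O] (ν : O →* ℝ)
    (hunit : ∀ x, IsUnit x → ν x = 1) {ϖ : O} (hϖ : Irreducible ϖ) {x : O} (hx : x ≠ 0) :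
    ν x = ν ϖ ^ multiplicity (IsLocalRing.maximalIdeal O) (Ideal.span {x}) := by
  obtain ⟨n, u, hu⟩ := IsDiscreteValuationRing.associated_pow_irreducible hx hϖ
  have h1 : Ideal.span {x} = IsLocalRing.maximalIdeal O ^ n := by
    rw [(IsDiscreteValuationRing.irreducible_iff_uniformizer ϖ).1 hϖ, Ideal.span_singleton_pow, ← hu]
    exact (Ideal.span_singleton_mul_right_unit u.isUnit x).symm
  have hm : IsLocalRing.maximalIdeal O ≠ 0 := IsDiscreteValuationRing.not_a_field O
  have hm' : ¬ IsUnit (IsLocalRing.maximalIdeal O) := by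
    rw [Ideal.isUnit_iff]; exact (IsLocalRing.maximalIdeal.isMaximal O).ne_top
  rw [h1, multiplicity_pow_self hm hm', ← map_pow, ← hu, map_mul, hunit u u.isUnit, mul_one]

theorem isLocalRing_of_norm (ν : O →* ℝ) (hunit : ∀ x, IsUnit x ↔ ν x = 1) (hle : ∀ x, ν x ≤ 1)
    (hna : ∀ x y, ν (x + y) ≤ max (ν x) (ν y)) : IsLocalRing O := by
  refine IsLocalRing.of_nonunits_add fun a b ha hb => ?_
  rw [mem_nonunits_iff, hunit] at ha hb ⊢
  exact ((hna a b).trans_lt (max_lt (lt_of_le_of_ne (hle a) ha) (lt_of_le_of_ne (hle b) hb))).ne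

end NormRing

theorem isDiscreteValuationRing_of_local {O : Type*} [CommRing O] [IsLocalRing O] [hd : IsDedekindDomain O] (h : ¬ IsField O) :
    IsDiscreteValuationRing O :=
  ((IsDiscreteValuationRing.TFAE O h).out 0 2 :).2 hd

/-! ### The absolute value of the algebraic closure and the base field. -/

section Base

variable (K : Type*) [Field K] [Algebra ℚ_[2] K] [FiniteDimensional ℚ_[2] K]

instance isAlgebraic_closure : Algebra.IsAlgebraic ℚ_[2] (AlgebraicClosure K) :=
  Algebra.IsAlgebraic.trans ℚ_[2] K (AlgebraicClosure K)

/-- The absolute value on the algebraic closure of a `2`-adic field. -/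
noncomputable def absN : AbsoluteValue (AlgebraicClosure K) ℝ where
  toFun := spectralNorm ℚ_[2] (AlgebraicClosure K)
  map_mul' x y := map_mul (spectralMulAlgNorm ℚ_[2] (AlgebraicClosure K)) x y
  nonneg' x := spectralNorm_nonneg x
  eq_zero' _ := map_eq_zero_iff_eq_zero (spectralMulAlgNorm ℚ_[2] (AlgebraicClosure K))
  add_le' x y := map_add_le_add (spectralMulAlgNorm ℚ_[2] (AlgebraicClosure K)) x y

theorem nonarch_absN : IsNonarchimedean (absN K) := isNonarchimedean_spectralNorm

theorem absN_equiv (σ : AlgebraicClosure K ≃ₐ[K] AlgebraicClosure K) (x : AlgebraicClosure K) :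
    absN K (σ x) = absN K x :=
  (spectralNorm_eq_of_equiv (σ.restrictScalars ℚ_[2]) x).symm

variable [Algebra ℤ_[2] K] [IsScalarTower ℤ_[2] ℚ_[2] K]

theorem isIntegral_iff_absN (x : AlgebraicClosure K) : IsIntegral ℤ_[2] x ↔ absN K x ≤ 1 :=
  isIntegral_iff_spectralNorm_le_one x

theorem isIntegral_iff_absN_base (x : K) :
    IsIntegral ℤ_[2] x ↔ absN K (algebraMap K (AlgebraicClosure K) x) ≤ 1 := by
  rw [← isIntegral_iff_absN, isIntegral_algebraMap_iff (algebraMap K (AlgebraicClosure K)).injective]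

variable {K} in
theorem isIntegral_iff_absN_ext (L : IntermediateField K (AlgebraicClosure K)) (x : L) :
    IsIntegral (integers K) x ↔ absN K x ≤ 1 := by
  rw [← isIntegral_iff_absN]
  have h1 : IsIntegral (integers K) x ↔ IsIntegral (integers K) (x : AlgebraicClosure K) :=
    (isIntegral_algebraMap_iff (algebraMap L (AlgebraicClosure K)).injective).symm
  rw [h1]
  constructor
  · intro h
    have : Algebra.IsIntegral ℤ_[2] (integers K) := integralClosure.AlgebraIsIntegral ..
    exact isIntegral_trans x.1 h
  · exact fun h => h.tower_top

omit [FiniteDimensional ℚ_[2] K] [Algebra ℤ_[2] K] [IsScalarTower ℤ_[2] ℚ_[2] K] in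
theorem charZero_base : CharZero K := charZero_of_injective_algebraMap (algebraMap ℚ_[2] K).injective

instance isDedekindDomain_integers : IsDedekindDomain (integers K) :=
  integralClosure.isDedekindDomain ℤ_[2] ℚ_[2] K

instance isFractionRing_integers : IsFractionRing (integers K) K :=
  integralClosure.isFractionRing_of_finite_extension ℚ_[2] K

instance finite_integers : Module.Finite ℤ_[2] (integers K) :=
  IsIntegralClosure.finite ℤ_[2] ℚ_[2] K (integers K)

variable {K} in
/-- The units of the ring of integers are its elements of absolute value one. -/
theorem isUnit_integers_iff (x : integers K) :
    IsUnit x ↔ absN K (algebraMap K (AlgebraicClosure K) x) = 1 := by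
  have hle (y : integers K) := (isIntegral_iff_absN_base K y).1 y.2
  constructor
  · rintro ⟨u, rfl⟩
    have h1 : absN K (algebraMap K _ ((u : integers K) : K)) *
        absN K (algebraMap K _ (((u⁻¹ : (integers K)ˣ) : integers K) : K)) = 1 := by
      rw [← map_mul, ← map_mul, ← map_one (absN K), ← map_one (algebraMap K (AlgebraicClosure K))]
      exact congrArg (fun z => absN K (algebraMap K _ z))
        (by exact_mod_cast congrArg Subtype.val u.mul_inv)
    nlinarith [hle u, hle (u⁻¹ : (integers K)ˣ), (absN K).nonneg (algebraMap K _ ((u : integers K) : K))]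
  · intro h
    have h0 : (x : K) ≠ 0 := by
      intro h0; rw [h0, map_zero, map_zero] at h; exact zero_ne_one h
    exact IsUnit.of_mul_eq_one ⟨(x : K)⁻¹, (isIntegral_iff_absN_base K _).2
      (by rw [map_inv₀, map_inv₀, h, inv_one])⟩ (Subtype.ext (mul_inv_cancel₀ h0))

omit [Algebra ℤ_[2] K] [IsScalarTower ℤ_[2] ℚ_[2] K] in
theorem absN_two_lt_one : absN K 2 < 1 := by
  have h1 : absN K (algebraMap ℚ_[2] (AlgebraicClosure K) 2) = ‖(2 : ℚ_[2])‖ := spectralNorm_extends _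
  rw [map_ofNat] at h1
  rw [h1]
  have := Padic.norm_p_lt_one (p := 2)
  exact_mod_cast this

instance isDiscreteValuationRing_integers : IsDiscreteValuationRing (integers K) := by
  refine isDiscreteValuationRing_of_local fun hf => ?_
  have := charZero_base K
  have h2 : (2 : integers K) ≠ 0 := by
    intro h; exact two_ne_zero (α := K) (by exact_mod_cast congrArg Subtype.val h)
  obtain ⟨y, hy⟩ := hf.mul_inv_cancel h2
  have := (isUnit_integers_iff (2 : integers K)).1 (IsUnit.of_mul_eq_one y hy)
  have h3 : ((2 : integers K) : K) = 2 := rfl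
  rw [h3, map_ofNat] at this
  exact (absN_two_lt_one K).ne this

/-- The absolute value of the algebraic closure on the integers of the base field. -/
noncomputable def normInt : integers K →* ℝ where
  toFun x := absN K (algebraMap K (AlgebraicClosure K) x)
  map_one' := by simp
  map_mul' x y := by simp

instance faithfulSMul_integers : FaithfulSMul ℤ_[2] (integers K) := by
  have h1 : Function.Injective (algebraMap ℤ_[2] K) := by
    rw [IsScalarTower.algebraMap_eq ℤ_[2] ℚ_[2] K]
    exact (algebraMap ℚ_[2] K).injective.comp (IsFractionRing.injective ℤ_[2] ℚ_[2])
  refine (faithfulSMul_iff_algebraMap_injective _ _).2 fun x y h => h1 ?_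
  exact congrArg Subtype.val h

theorem finite_residueField : Finite (IsLocalRing.ResidueField (integers K)) := by
  have h1 : Finite (IsLocalRing.ResidueField ℤ_[2]) :=
    Finite.of_equiv (ZMod 2) (PadicInt.residueField (p := 2)).symm.toEquiv
  exact IsLocalRing.ResidueField.finite_of_finite h1

theorem liesOver_maximalIdeal : (IsLocalRing.maximalIdeal (integers K)).LiesOver
    (IsLocalRing.maximalIdeal ℤ_[2]) := by
  refine ⟨(IsLocalRing.eq_maximalIdeal ?_).symm⟩
  exact Ideal.isMaximal_comap_of_isIntegral_of_isMaximal (R := ℤ_[2]) (IsLocalRing.maximalIdeal (integers K))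

/-- The ideal generated by 2 is the extension of the maximal ideal of `ℤ_[2]`, so its multiplicity
is the ramification index. -/
theorem absN_two {ϖ : integers K} (hϖ : Irreducible ϖ) :
    absN K 2 = absN K (algebraMap K _ (ϖ : K)) ^ absRamificationIdx K := by
  have := charZero_base K
  have h2 : (2 : integers K) ≠ 0 := by
    intro h; exact two_ne_zero (α := K) (by exact_mod_cast congrArg Subtype.val h)
  have h1 := norm_eq_pow_multiplicity (normInt K) (fun x hx => (isUnit_integers_iff x).1 hx) hϖ h2
  have h3 : normInt K 2 = absN K 2 := by
    change absN K (algebraMap K _ ((2 : integers K) : K)) = _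
    have h3 : ((2 : integers K) : K) = 2 := rfl
    rw [h3, map_ofNat]
  have h4 : (IsLocalRing.maximalIdeal ℤ_[2]).map (algebraMap ℤ_[2] (integers K)) = Ideal.span {2} := by
    rw [PadicInt.maximalIdeal_eq_span_p, Ideal.map_span, Set.image_singleton,
      Nat.cast_ofNat, map_ofNat]
  have h5 := liesOver_maximalIdeal K
  rw [h3] at h1
  rw [h1, absRamificationIdx, Ideal.IsDedekindDomain.ramificationIdx_eq_multiplicity
    (IsLocalRing.maximalIdeal ℤ_[2]), h4]
  · rfl
  · rw [h4, ne_eq, Ideal.span_singleton_eq_bot]; exact h2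

/-- A `2`-adic field is a dyadic base inside its algebraic closure. -/
theorem isDyadicBase {ϖ : integers K} (hϖ : Irreducible ϖ) :
    IsDyadicBase K (absN K) (absN K (algebraMap K _ (ϖ : K))) (residueCard K) (absRamificationIdx K) := by
  have := charZero_base K
  have : IsGalois K (AlgebraicClosure K) := ⟨⟩
  have hna : IsNonarchimedean (restrictAbs K (absN K)) := fun x y => by
    rw [restrictAbs_apply, map_add]; exact nonarch_absN K _ _
  have hϖ0 : (ϖ : K) ≠ 0 := fun h => hϖ.ne_zero (Subtype.ext h)
  set ρ := absN K (algebraMap K _ (ϖ : K)) with hρdef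
  have hρ0 : 0 < ρ := (absN K).pos (by simpa using hϖ0)
  have hρ1 : ρ < 1 := by
    refine lt_of_le_of_ne ((isIntegral_iff_absN_base K _).1 ϖ.2) fun h => ?_
    exact hϖ.not_isUnit ((isUnit_integers_iff ϖ).2 h)
  have hval (x : integers K) (hx : x ≠ 0) : ∃ n : ℕ, absN K (algebraMap K _ (x : K)) = ρ ^ n :=
    ⟨_, norm_eq_pow_multiplicity (normInt K) (fun x hx => (isUnit_integers_iff x).1 hx) hϖ hx⟩
  have e : integers K ≃+* unitBall (restrictAbs K (absN K)) hna :=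
    { toFun := fun x => ⟨x, (isIntegral_iff_absN_base K _).1 x.2⟩
      invFun := fun x => ⟨x, (isIntegral_iff_absN_base K _).2 x.2⟩
      left_inv := fun _ => rfl
      right_inv := fun _ => rfl
      map_mul' := fun _ _ => rfl
      map_add' := fun _ _ => rfl }
  have e' := IsLocalRing.ResidueField.mapEquiv e
  have h2 := absN_two K hϖ
  have hfin := finite_residueField K
  exact {
    nonarch := nonarch_absN K
    inv := absN_equiv K
    dyadic := {
      nonarch := hna
      pos := hρ0
      lt_one := hρ1
      unif := ⟨ϖ, rfl⟩
      val := by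
        intro x hx
        obtain ⟨a, b, hb, rfl⟩ := IsFractionRing.div_surjective (A := integers K) x
        have hb0 : b ≠ 0 := nonZeroDivisors.ne_zero hb
        have ha0 : a ≠ 0 := by rintro rfl; simp at hx
        obtain ⟨n, hn⟩ := hval a ha0
        obtain ⟨m, hm⟩ := hval b hb0
        refine ⟨n - m, ?_⟩
        rw [map_div₀, zpow_sub₀ hρ0.ne', zpow_natCast, zpow_natCast, ← hn, ← hm]
        rfl
      two := by rw [restrictAbs_apply, map_ofNat, h2]
      e_pos := by
        rw [Nat.pos_iff_ne_zero]
        intro h0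
        rw [h0, pow_zero] at h2
        exact (absN_two_lt_one K).ne h2
      finite_residue := Finite.of_equiv _ e'.toEquiv
      card_residue := (Nat.card_congr e'.toEquiv).symm
      hensel := fun c hc => exists_artinSchreier_root (nonarch_absN K) (absN_equiv K) c hc } }

end Base


/-! ### Discriminants in towers. -/

section DiscrTower

open Matrix Kronecker

/-- The discriminant of the product basis in a tower of finite extensions. -/
theorem discr_smulTower {K E L ι κ : Type*} [Field K] [Field E] [Field L] [Algebra K E] [Algebra E L]
    [Algebra K L] [IsScalarTower K E L] [Fintype ι] [Fintype κ] [DecidableEq ι] [DecidableEq κ]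
    (b : Module.Basis ι K E) (c : Module.Basis κ E L) :
    Algebra.discr K (b.smulTower' c) =
      Algebra.discr K b ^ Fintype.card κ * Algebra.norm K (Algebra.discr E c) := by
  have : FiniteDimensional K E := Module.Basis.finiteDimensional_of_finite b
  have : FiniteDimensional E L := Module.Basis.finiteDimensional_of_finite c
  -- By transitivity the entry is the trace from `E` of `b i * b j * t`, with `t` the trace of `c k
  -- * c l`. Expanding `t * b j` in the basis `b` factors the matrix into copies of the trace matrix
  -- of `b` and blocks of multiplication by `t`.
  have hmat : Algebra.traceMatrix K (b.smulTower' c) =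
      ((1 : Matrix κ κ K) ⊗ₖ Algebra.traceMatrix K b) *
        ((Algebra.traceMatrix E c).map (Algebra.leftMulMatrix b)).comp _ _ _ _ _ := by
    ext ⟨k, i⟩ ⟨l, j⟩
    rw [Matrix.mul_apply, Fintype.sum_prod_type, Finset.sum_eq_single k]
    · simp only [kroneckerMap_apply, one_apply_eq, one_mul, comp_apply, map_apply,
        Algebra.traceMatrix_apply, Algebra.traceForm_apply, Module.Basis.smulTower'_apply]
      have h1 : b i • c k * b j • c l = (b i * b j) • (c k * c l) := by
        rw [smul_mul_smul_comm]
      rw [h1, ← Algebra.trace_trace (S := E), map_smul, smul_eq_mul]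
      set t := Algebra.trace E L (c k * c l)
      have h2 : b i * b j * t = ∑ m, Algebra.leftMulMatrix b t m j • (b i * b m) := by
        have h3 : t * b j = ∑ m, Algebra.leftMulMatrix b t m j • b m := by
          simp only [Algebra.leftMulMatrix_eq_repr_mul]
          exact (b.sum_repr _).symm
        rw [mul_assoc, mul_comm (b j), h3, Finset.mul_sum]
        exact Finset.sum_congr rfl fun m _ => mul_smul_comm _ _ _
      rw [h2, map_sum]
      exact Finset.sum_congr rfl fun m _ => by rw [map_smul, smul_eq_mul, mul_comm]
    · intro k' _ hk
      exact Finset.sum_eq_zero fun m _ => by simp [kroneckerMap_apply, one_apply_ne hk.symm]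
    · simp
  rw [Algebra.discr_def, hmat, det_mul, det_kronecker, det_one, one_pow, one_mul]
  congr 1
  -- The blocks are the image of a matrix over the commutative ring `E`, so the determinant of the
  -- whole is the norm of its determinant over `E`.
  have := Matrix.det_det (M := Algebra.traceMatrix E c) (Algebra.leftMulMatrix b : E →+* Matrix ι ι K)
  rw [Algebra.norm_eq_matrix_det b, Algebra.discr_def]
  exact this.symm

end DiscrTower

/-! ### Absolute values of norms, and integral coordinates. -/

section Norm

variable {F Ω : Type*} [Field F] [Field Ω] [Algebra F Ω]

theorem map_embedding_eq [IsGalois F Ω] {N : AbsoluteValue Ω ℝ}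
    (hinv : ∀ (σ : Ω ≃ₐ[F] Ω) (x : Ω), N (σ x) = N x) (E : IntermediateField F Ω)
    (f : E →ₐ[F] Ω) (x : E) : N (f x) = N x := by
  have h1 := hinv (AlgEquiv.ofBijective _ (AlgHom.normal_bijective F Ω Ω (f.liftNormal Ω))) x
  rw [← h1]
  exact congrArg N (f.liftNormal_commutes Ω x).symm

theorem restrictAbs_norm [IsGalois F Ω] [IsAlgClosed Ω] {N : AbsoluteValue Ω ℝ}
    (hinv : ∀ (σ : Ω ≃ₐ[F] Ω) (x : Ω), N (σ x) = N x) (E : IntermediateField F Ω)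
    [FiniteDimensional F E] (x : E) :
    restrictAbs F N (Algebra.norm F x) = N x ^ Module.finrank F E := by
  rw [restrictAbs_apply, Algebra.norm_eq_prod_embeddings F Ω, map_prod,
    Finset.prod_congr rfl (fun f _ => map_embedding_eq hinv E f x), Finset.prod_const,
    Finset.card_univ, AlgHom.card]

end Norm

namespace IsDyadicBase

variable {F Ω : Type*} [Field F] [Field Ω] [Algebra F Ω]

theorem discr_pairBasis {E : IntermediateField F Ω} (hE : Module.finrank F E = 2) {w : E}
    (hwF : ∀ c : F, algebraMap F Ω c ≠ w) {a b : F}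
    (hw : (w : Ω) ^ 2 + algebraMap F Ω a * w + algebraMap F Ω b = 0) :
    Algebra.discr F (pairBasis hE hwF) = a ^ 2 - 4 * b := by
  have hw2 : w * w = (-b) • (1 : E) + (-a) • w := by
    apply Subtype.ext
    have : (w : Ω) * w = (-algebraMap F Ω b) * 1 + (-algebraMap F Ω a) * w := by
      linear_combination hw
    simpa [Algebra.smul_def] using this
  have h0 : pairBasis hE hwF 0 = 1 := by rw [coe_pairBasis]; rfl
  have h1 : pairBasis hE hwF 1 = w := by rw [coe_pairBasis]; rfl
  generalize pairBasis hE hwF = B at h0 h1 ⊢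
  have hone : Algebra.trace F E 1 = 2 := by
    have := Algebra.trace_algebraMap (R := F) (S := E) (1 : F)
    rw [hE, map_one] at this
    rw [this]; norm_num
  have htr : Algebra.trace F E w = -a := by
    have hr : B.repr (w * B 0) 0 = 0 := by rw [h0, mul_one, ← h1, Module.Basis.repr_self]; simp
    have hr' : B.repr (w * B 1) 1 = -a := by
      rw [h1, hw2, ← h0, ← h1, map_add, map_smul, map_smul, Module.Basis.repr_self,
        Module.Basis.repr_self]
      simp
    rw [Algebra.trace_eq_matrix_trace B, Matrix.trace_fin_two,
      Algebra.leftMulMatrix_eq_repr_mul, Algebra.leftMulMatrix_eq_repr_mul, hr, hr', zero_add]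
  have htr2 : Algebra.trace F E (w * w) = a ^ 2 - 2 * b := by
    rw [hw2, map_add, map_smul, map_smul, hone, htr, smul_eq_mul, smul_eq_mul]; ring
  rw [Algebra.discr_def, Matrix.det_fin_two]
  simp only [Algebra.traceMatrix_apply, Algebra.traceForm_apply, h0, h1, one_mul, mul_one, hone, htr, htr2]
  ring

variable {N : AbsoluteValue Ω ℝ} {ρ : ℝ} {q e : ℕ} (H : IsDyadicBase F N ρ q e)
include H

/-- There is no cancellation between `a` and `b w`, and `b w` integral of half-integral exponent
leaves `b` integral. So `1, w` is an integral basis, and the discriminant of the Eisenstein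
polynomial is that of the extension. -/
theorem coords_le_one {w : Ω} (hw : N w ^ 2 = ρ) {a b : F}
    (h : N (algebraMap F Ω a + algebraMap F Ω b * w) ≤ 1) :
    restrictAbs F N a ≤ 1 ∧ restrictAbs F N b ≤ 1 := by
  rw [H.norm_coords hw, max_le_iff] at h
  refine ⟨h.1, ?_⟩
  by_cases hb : b = 0
  · rw [hb, map_zero]; exact zero_le_one
  obtain ⟨n, hn⟩ := H.dyadic.val b hb
  have hlt := H.norm_mul_lt_one hw h.2
  have hρ := H.dyadic.pos
  have h2 : ρ ^ (2 * n + 1) < ρ ^ (0 : ℤ) := by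
    rw [zpow_zero, zpow_add_one₀ hρ.ne', mul_comm 2, zpow_mul, ← hn, ← hw, zpow_ofNat, ← mul_pow]
    exact pow_lt_one₀ (mul_nonneg (AbsoluteValue.nonneg _ _) (N.nonneg _)) hlt (by norm_num)
  rw [zpow_lt_zpow_iff_right_of_lt_one₀ hρ H.dyadic.lt_one] at h2
  rw [hn]
  exact zpow_le_one₀ hρ H.dyadic.lt_one.le (by omega)

end IsDyadicBase


/-! ### The discriminant ideal from an integral basis. -/

section Discr

variable (K : Type*) [Field K] [Algebra ℚ_[2] K] [FiniteDimensional ℚ_[2] K]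
  [Algebra ℤ_[2] K] [IsScalarTower ℤ_[2] ℚ_[2] K]

variable {K} in
theorem algebraMap_discr {L : Type*} [Field L] [Algebra K L] [FiniteDimensional K L]
    {ι : Type*} [Fintype ι] [DecidableEq ι] (b : ι → integersOver K L) :
    algebraMap (integers K) K (Algebra.discr (integers K) b) =
      Algebra.discr K fun i => (b i : L) := by
  have := charZero_base K
  have : Module.IsTorsionFree (integers K) L := .trans_faithfulSMul _ K L
  have := IsIntegralClosure.finite (integers K) K L (integersOver K L)
  have := IsIntegralClosure.module_free (integers K) K L (integersOver K L)
  have := IsIntegralClosure.isLocalization (integers K) K L (integersOver K L)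
  rw [Algebra.discr_def, Algebra.discr_def, RingHom.map_det]
  congr 1
  ext i j
  simp only [RingHom.mapMatrix_apply, Matrix.map_apply, Algebra.traceMatrix_apply,
    Algebra.traceForm_apply]
  exact (Algebra.trace_localization (Rₘ := K) (Sₘ := L) (integers K)
    (nonZeroDivisors (integers K)) (b i * b j)).symm

variable {K} in
/-- The discriminant ideal is generated by the discriminant of an integral basis. -/
theorem discrIdeal_eq_span {L : Type*} [Field L] [Algebra K L] {ι : Type*} [Fintype ι]
    [DecidableEq ι] (B : Module.Basis ι K L) (hB : ∀ i, IsIntegral (integers K) (B i))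
    (hcoord : ∀ x : L, IsIntegral (integers K) x → ∀ i, IsIntegral ℤ_[2] (B.repr x i)) :
    ∃ d : integers K, (d : K) = Algebra.discr K B ∧ discrIdeal K L = Ideal.span {d} := by
  have : FiniteDimensional K L := Module.Basis.finiteDimensional_of_finite B
  let B' : ι → integersOver K L := fun i => ⟨B i, hB i⟩
  have hd : ((Algebra.discr (integers K) B' : integers K) : K) = Algebra.discr K B :=
    algebraMap_discr B'
  refine ⟨Algebra.discr (integers K) B', hd, le_antisymm ?_ ?_⟩
  · refine Ideal.span_le.2 ?_
    rintro _ ⟨b, rfl⟩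
    let r : Fin (Module.finrank K L) ≃ ι :=
      (finCongr (Module.finrank_eq_card_basis B)).trans (Fintype.equivFin ι).symm
    have hb : Algebra.discr (integers K) b = Algebra.discr (integers K) (b ∘ r.symm) := by
      simp only [Algebra.discr_def]
      exact (Matrix.det_submatrix_equiv_self r.symm (Algebra.traceMatrix (integers K) b)).symm
    let P : Matrix ι ι (integers K) :=
      Matrix.of fun i j => ⟨B.repr (b (r.symm j)) i, hcoord _ (b (r.symm j)).2 i⟩
    have hP : b ∘ r.symm = Matrix.vecMul B' (P.map (algebraMap (integers K) (integersOver K L))) := by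
      ext j
      refine (B.sum_repr (b (r.symm j))).symm.trans ?_
      simp only [Matrix.vecMul, dotProduct, Matrix.map_apply, AddSubmonoidClass.coe_finsetSum,
        MulMemClass.coe_mul]
      refine Finset.sum_congr rfl fun i _ => ?_
      rw [Algebra.smul_def, mul_comm]
      rfl
    change Algebra.discr (integers K) b ∈ _
    rw [hb, hP, Algebra.discr_of_matrix_vecMul]
    exact Ideal.mul_mem_left _ _ (Ideal.mem_span_singleton_self _)
  · rw [Ideal.span_singleton_le_iff_mem]
    let r : Fin (Module.finrank K L) ≃ ι :=
      (finCongr (Module.finrank_eq_card_basis B)).trans (Fintype.equivFin ι).symm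
    refine Ideal.subset_span ⟨B' ∘ r, ?_⟩
    simp only [Algebra.discr_def]
    exact Matrix.det_submatrix_equiv_self r (Algebra.traceMatrix (integers K) B')

variable {K} in
/-- The exponent of the discriminant is the valuation of the discriminant of an integral basis. -/
theorem absN_discr {L : Type*} [Field L] [Algebra K L] {ι : Type*} [Fintype ι]
    [DecidableEq ι] (B : Module.Basis ι K L) (hB : ∀ i, IsIntegral (integers K) (B i))
    (hcoord : ∀ x : L, IsIntegral (integers K) x → ∀ i, IsIntegral ℤ_[2] (B.repr x i))
    {ϖ : integers K} (hϖ : Irreducible ϖ) :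
    absN K (algebraMap K _ (Algebra.discr K B)) = absN K (algebraMap K _ (ϖ : K)) ^ discrVal K L := by
  have := charZero_base K
  have : FiniteDimensional K L := Module.Basis.finiteDimensional_of_finite B
  obtain ⟨d, hd, hspan⟩ := discrIdeal_eq_span B hB hcoord
  have hd0 : d ≠ 0 := by
    rintro rfl
    exact Algebra.discr_not_zero_of_basis K B hd.symm
  rw [discrVal, hspan, ← hd]
  exact norm_eq_pow_multiplicity (normInt K) (fun x hx => (isUnit_integers_iff x).1 hx) hϖ hd0

end Discr

/-! ### Total ramification read off the absolute value. -/

section Ramification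

variable (K : Type*) [Field K] [Algebra ℚ_[2] K] [FiniteDimensional ℚ_[2] K]
  [Algebra ℤ_[2] K] [IsScalarTower ℤ_[2] ℚ_[2] K] (L : IntermediateField K (AlgebraicClosure K))

/-- The absolute value of the algebraic closure on the integers of an intermediate field. -/
noncomputable def normOver : integersOver K L →* ℝ where
  toFun x := absN K ((x : L) : AlgebraicClosure K)
  map_one' := by simp
  map_mul' x y := by simp

variable {K L} in
theorem isUnit_integersOver_iff (x : integersOver K L) : IsUnit x ↔ normOver K L x = 1 := by
  have hle (y : integersOver K L) : normOver K L y ≤ 1 := (isIntegral_iff_absN_ext L y).1 y.2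
  constructor
  · rintro ⟨u, rfl⟩
    have h1 : normOver K L u * normOver K L (u⁻¹ : (integersOver K L)ˣ) = 1 := by
      rw [← map_mul, u.mul_inv, map_one]
    have h0 : 0 ≤ normOver K L u := (absN K).nonneg _
    nlinarith [hle u, hle (u⁻¹ : (integersOver K L)ˣ)]
  · intro h
    have h0 : (x : L) ≠ 0 := by
      intro h0
      change absN K ((x : L) : AlgebraicClosure K) = 1 at h
      rw [h0, ZeroMemClass.coe_zero, map_zero] at h; exact zero_ne_one h
    refine IsUnit.of_mul_eq_one ⟨(x : L)⁻¹, (isIntegral_iff_absN_ext L _).2 ?_⟩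
      (Subtype.ext (mul_inv_cancel₀ h0))
    have h' : absN K ((x : L) : AlgebraicClosure K) = 1 := h
    rw [IntermediateField.coe_inv, map_inv₀, h', inv_one]

instance isLocalRing_integersOver : IsLocalRing (integersOver K L) :=
  isLocalRing_of_norm (normOver K L) isUnit_integersOver_iff
    (fun x => (isIntegral_iff_absN_ext L x).1 x.2) (fun _ _ => nonarch_absN K _ _)

variable {K} in
/-- The absolute value on a finite extension and its ramification index. -/
theorem exists_uniformizer [FiniteDimensional K L] {ϖ : integers K} (hϖ : Irreducible ϖ) :
    ∃ (r : ℕ) (p : L), (IsTotallyRamified K L ↔ r = Module.finrank K L) ∧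
      absN K (algebraMap K _ (ϖ : K)) = absN K p ^ r ∧
      ∀ x : L, x ≠ 0 → absN K x ≤ 1 → ∃ n : ℕ, absN K x = absN K p ^ n := by
  have := charZero_base K
  have hD : IsDedekindDomain (integersOver K L) := integralClosure.isDedekindDomain (integers K) K L
  have hϖ' : algebraMap (integers K) (integersOver K L) ϖ ≠ 0 := by
    intro h
    have h1 : algebraMap K L ϖ = 0 := congrArg Subtype.val h
    exact hϖ.ne_zero (Subtype.ext ((map_eq_zero _).1 h1))
  have hval : normOver K L (algebraMap (integers K) (integersOver K L) ϖ) =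
    absN K (algebraMap K _ (ϖ : K)) := rfl
  have hlt : absN K (algebraMap K _ (ϖ : K)) ≠ 1 := fun h =>
    hϖ.not_isUnit ((isUnit_integers_iff ϖ).2 h)
  have : IsDiscreteValuationRing (integersOver K L) := by
    refine isDiscreteValuationRing_of_local fun hf => ?_
    obtain ⟨y, hy⟩ := hf.mul_inv_cancel hϖ'
    exact hlt (hval ▸ (isUnit_integersOver_iff _).1 (IsUnit.of_mul_eq_one y hy))
  obtain ⟨p, hp⟩ := IsDiscreteValuationRing.exists_irreducible (integersOver K L)
  have key (x : integersOver K L) (hx : x ≠ 0) := norm_eq_pow_multiplicity (normOver K L)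
    (fun x hx => (isUnit_integersOver_iff x).1 hx) hp hx
  have hlies : (IsLocalRing.maximalIdeal (integersOver K L)).LiesOver
      (IsLocalRing.maximalIdeal (integers K)) := by
    refine ⟨(IsLocalRing.eq_maximalIdeal ?_).symm⟩
    exact Ideal.isMaximal_comap_of_isIntegral_of_isMaximal (R := integers K)
      (IsLocalRing.maximalIdeal (integersOver K L))
  have hmap : (IsLocalRing.maximalIdeal (integers K)).map
      (algebraMap (integers K) (integersOver K L)) =
      Ideal.span {algebraMap (integers K) (integersOver K L) ϖ} := by
    rw [(IsDiscreteValuationRing.irreducible_iff_uniformizer ϖ).1 hϖ, Ideal.map_span,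
      Set.image_singleton]
  refine ⟨(IsLocalRing.maximalIdeal (integersOver K L)).ramificationIdx (integers K), p, ?_, ?_, ?_⟩
  · constructor
    · intro h
      exact h _ (IsLocalRing.maximalIdeal.isMaximal _)
    · intro h P hP
      rw [IsLocalRing.eq_maximalIdeal hP, h]
  · rw [← hval, key _ hϖ', Ideal.IsDedekindDomain.ramificationIdx_eq_multiplicity
      (IsLocalRing.maximalIdeal (integers K)), hmap]
    · rfl
    · rw [hmap, ne_eq, Ideal.span_singleton_eq_bot]; exact hϖ'
  · intro x hx hx1
    exact ⟨_, key ⟨x, (isIntegral_iff_absN_ext L x).2 hx1⟩ fun h => hx (congrArg Subtype.val h)⟩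

variable {K L} in
/-- Total ramification through the absolute value. -/
theorem isTotallyRamified_of_norm [FiniteDimensional K L] {ϖ : integers K} (hϖ : Irreducible ϖ) {w : L}
    (hw : absN K w ^ Module.finrank K L = absN K (algebraMap K _ (ϖ : K)))
    (hval : ∀ x ∈ L, x ≠ 0 → ∃ n : ℤ, absN K x = absN K w ^ n) : IsTotallyRamified K L := by
  obtain ⟨r, p, hr, hp, hpv⟩ := exists_uniformizer L hϖ
  rw [hr]
  have hH := (isDyadicBase K hϖ).dyadic
  have hd : Module.finrank K L ≠ 0 := Module.finrank_pos.ne'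
  have hw1 : absN K w < 1 := by
    by_contra h
    exact (one_le_pow₀ (not_lt.1 h)).not_gt (hw ▸ hH.lt_one)
  have hw0 : absN K w ≠ 0 := by
    intro h; rw [h, zero_pow hd] at hw; exact hH.pos.ne hw
  have hwpos := lt_of_le_of_ne ((absN K).nonneg w) hw0.symm
  obtain ⟨k, hk⟩ := hpv w (by rintro rfl; simp at hw0) hw1.le
  have hp0 : (p : AlgebraicClosure K) ≠ 0 := by
    intro h
    have hr0 : r ≠ 0 := by rintro rfl; rw [pow_zero] at hp; exact hH.lt_one.ne hp
    rw [h, map_zero, zero_pow hr0] at hp; exact hH.pos.ne' hp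
  obtain ⟨n, hn⟩ := hval p p.2 hp0
  have hinj := zpow_right_injective₀ hwpos hw1.ne
  -- The values of `w` and of the uniformizer `p` are powers of each other, so they agree up to
  -- inversion; the sign is fixed by `n * r = [L : K]`, which is positive.
  have h1 : n * k = 1 := hinj (show absN K w ^ (n * k) = absN K w ^ (1 : ℤ) by
    rw [zpow_mul, zpow_natCast, ← hn, ← hk, zpow_one])
  have h2 : n * r = Module.finrank K L := hinj (show absN K w ^ (n * r) = absN K w ^ _ by
    rw [zpow_mul, zpow_natCast, ← hn, ← hp, zpow_natCast, hw])
  rcases Int.eq_one_or_neg_one_of_mul_eq_one h1 with rfl | rfl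
  · omega
  · omega

end Ramification


/-! ### Quartic fields as towers of ramified quadratic extensions. -/

section Tower

variable {F Ω : Type*} [Field F] [Field Ω] [Algebra F Ω]

/-- The constant coefficient of the minimal polynomial of a quadratic element. -/
theorem norm_const_coeff [IsGalois F Ω] {N : AbsoluteValue Ω ℝ}
    (hinv : ∀ (σ : Ω ≃ₐ[F] Ω) (x : Ω), N (σ x) = N x) {x : Ω} {a b : F}
    (hx : x ^ 2 + algebraMap F Ω a * x + algebraMap F Ω b = 0)
    (hxF : ∀ c : F, algebraMap F Ω c ≠ x) : N (algebraMap F Ω b) = N x ^ 2 := by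
  obtain ⟨σ, hσ⟩ := exists_conj hx hxF
  have h1 : algebraMap F Ω b = x * σ x := by rw [hσ]; linear_combination hx
  rw [h1, map_mul, hinv, sq]

namespace IsDyadicBase

variable {N : AbsoluteValue Ω ℝ} {ρ : ℝ} {q e : ℕ} (H : IsDyadicBase F N ρ q e)
include H

omit H in
theorem sqrt_eq {w : Ω} (hw : N w ^ 2 = ρ) : √ρ = N w := by
  rw [← hw, Real.sqrt_sq (N.nonneg w)]

theorem extend_sqrt [IsGalois F Ω] [IsAlgClosed Ω] {E : IntermediateField F Ω}
    (hE : E ∈ ramQuadratics F N ρ) : IsDyadicBase E N √ρ q (2 * e) := by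
  obtain ⟨h2, w, hwE, hw⟩ := hE
  rw [sqrt_eq hw]
  exact H.extend h2 hwE hw

/-- A quadratic subfield of a totally ramified quartic field is totally ramified, and so is the
quartic field over it. -/
theorem ramQuadratics_of_le [IsGalois F Ω] {L E : IntermediateField F Ω}
    (hL : Module.finrank F L = 4) {w : Ω} (hwL : w ∈ L) (hw : N w ^ 4 = ρ) (hEL : E ≤ L)
    (hE : Module.finrank F E = 2) :
    E ∈ ramQuadratics F N ρ ∧ IntermediateField.extendScalars hEL ∈ ramQuadratics E N √ρ := by
  have hfin : Module.finrank E (IntermediateField.extendScalars hEL) = 2 := by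
    have h1 := Module.finrank_mul_finrank F E (IntermediateField.extendScalars hEL)
    have h2 : Module.finrank F (IntermediateField.extendScalars hEL) = 4 := hL
    rw [hE] at h1
    have h3 := h1.trans h2
    omega
  have hwF (c : F) : algebraMap F Ω c ≠ w := by
    rintro rfl
    refine H.not_mem_range (x := algebraMap F Ω (c ^ 2)) ?_ (c ^ 2) rfl
    rw [← hw, map_pow, map_pow]; ring
  -- If `w` were in `E`, the constant coefficient of its equation over `F` would have absolute value
  -- `N w ^ 2`, of exponent one half.
  have hwE (c : E) : algebraMap E Ω c ≠ w := by
    rintro rfl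
    obtain ⟨-, a, b, hab⟩ := exists_quadratic_of_finrank hE c.2 hwF
    refine H.not_mem_range (x := algebraMap F Ω b) ?_ b rfl
    rw [norm_const_coeff H.inv hab hwF, ← hw]
    change (N c ^ 2) ^ 2 = N c ^ 4
    ring
  obtain ⟨-, a, b, hab⟩ := exists_quadratic_of_finrank hfin
    ((IntermediateField.mem_extendScalars hEL).2 hwL) hwE
  -- The constant coefficient of the equation of `w` over `E` is thus the uniformizer of `E` that is
  -- sought.
  have hb : N b = N w ^ 2 := norm_const_coeff (F := E) (fun σ x => H.inv (σ.restrictScalars F) x) hab hwE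
  have hb2 : N b ^ 2 = ρ := by rw [hb, ← hw]; ring
  refine ⟨⟨hE, b, b.2, hb2⟩, hfin, w, (IntermediateField.mem_extendScalars hEL).2 hwL, ?_⟩
  rw [sqrt_eq hb2, hb]

omit H in
theorem finrank_restrictScalars {E : IntermediateField F Ω} (hE : E ∈ ramQuadratics F N ρ)
    {M : IntermediateField E Ω} (hM : M ∈ ramQuadratics E N √ρ) :
    Module.finrank F (M.restrictScalars F) = 4 := by
  have h1 := Module.finrank_mul_finrank F E M
  rw [hE.1, hM.1] at h1
  exact h1.symm

theorem exists_norm_tower [IsGalois F Ω] [IsAlgClosed Ω] {E : IntermediateField F Ω}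
    (hE : E ∈ ramQuadratics F N ρ) {M : IntermediateField E Ω} (hM : M ∈ ramQuadratics E N √ρ) :
    ∃ w ∈ M.restrictScalars F, N w ^ 4 = ρ ∧
      ∀ x ∈ M.restrictScalars F, x ≠ 0 → ∃ n : ℤ, N x = N w ^ n := by
  have HE := H.extend_sqrt hE
  obtain ⟨h2, w, hwM, hw⟩ := hM
  refine ⟨w, hwM, ?_, fun x hx hx0 => HE.norm_eq_sqrt_zpow h2 hwM hw hx hx0⟩
  rw [show N w ^ 4 = (N w ^ 2) ^ 2 by ring, hw, Real.sq_sqrt H.dyadic.pos.le]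

end IsDyadicBase

end Tower

section Base

variable (K : Type*) [Field K] [Algebra ℚ_[2] K] [FiniteDimensional ℚ_[2] K]
  [Algebra ℤ_[2] K] [IsScalarTower ℤ_[2] ℚ_[2] K]

variable {K} in
/-- The discriminant exponent in a tower of totally ramified quadratic extensions. -/
theorem discrVal_tower {ϖ : integers K} (hϖ : Irreducible ϖ)
    {E : IntermediateField K (AlgebraicClosure K)} {d d' : ℕ}
    (hE : E ∈ ramQuadratics K (absN K) (absN K (algebraMap K _ (ϖ : K))))
    (hd : HasDisc (absN K) (absN K (algebraMap K _ (ϖ : K))) E d)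
    {M : IntermediateField E (AlgebraicClosure K)}
    (hM : M ∈ ramQuadratics E (absN K) √(absN K (algebraMap K _ (ϖ : K))))
    (hd' : HasDisc (absN K) √(absN K (algebraMap K _ (ϖ : K))) M d') :
    discrVal K (M.restrictScalars K) = 2 * d + d' := by
  have := charZero_base K
  have : IsGalois K (AlgebraicClosure K) := ⟨⟩
  have H := isDyadicBase K hϖ
  have HE := H.extend_sqrt hE
  obtain ⟨w, hwE, hw, a, b, hab, hdab⟩ := hd
  obtain ⟨w', hwM, hw', a', b', hab', hdab'⟩ := hd'
  set ρ := absN K (algebraMap K _ (ϖ : K)) with hρ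
  let B := IsDyadicBase.pairBasis (w := ⟨w, hwE⟩) hE.1 (H.not_mem_range hw)
  let C := IsDyadicBase.pairBasis (w := ⟨w', hwM⟩) hM.1 (HE.not_mem_range hw')
  have hB0 : B 0 = 1 := by simp only [B, IsDyadicBase.coe_pairBasis]; rfl
  have hB1 : B 1 = ⟨w, hwE⟩ := by simp only [B, IsDyadicBase.coe_pairBasis]; rfl
  have hC0 : C 0 = 1 := by simp only [C, IsDyadicBase.coe_pairBasis]; rfl
  have hC1 : C 1 = ⟨w', hwM⟩ := by simp only [C, IsDyadicBase.coe_pairBasis]; rfl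
  have hBC : Algebra.discr K (B.smulTower' C) =
      (a ^ 2 - 4 * b) ^ 2 * Algebra.norm K (a' ^ 2 - 4 * b') := by
    rw [discr_smulTower, Fintype.card_fin, IsDyadicBase.discr_pairBasis _ _ hab,
      IsDyadicBase.discr_pairBasis _ _ hab']
  have : FiniteDimensional K E := Module.finite_of_finrank_pos (by rw [hE.1]; norm_num)
  have hnorm := restrictAbs_norm H.inv E (a' ^ 2 - 4 * b')
  have hw1 : absN K w ≤ 1 := by
    by_contra h; nlinarith [H.dyadic.lt_one]
  have hw1' : absN K w' ≤ 1 := by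
    by_contra h; nlinarith [HE.dyadic.lt_one]
  have hint (x : M) : IsIntegral (integers K) x ↔ absN K x ≤ 1 :=
    isIntegral_iff_absN_ext (M.restrictScalars K) x
  -- The products of `1, w` and `1, w'` form an integral basis: `coords_le_one` is applied over `E`
  -- and then over `K`.
  have h1 : absN K (algebraMap K _ (Algebra.discr K (B.smulTower' C))) = ρ ^ discrVal K M := by
    refine absN_discr _ ?_ ?_ hϖ
    · rintro ⟨j, i⟩
      rw [hint, Module.Basis.smulTower'_apply]
      have h2 : ((B i • C j : M) : AlgebraicClosure K) = B i * C j := by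
        rw [Algebra.smul_def]; rfl
      rw [h2, map_mul]
      refine mul_le_one₀ ?_ ((absN K).nonneg _) ?_
      · fin_cases i
        · exact (congrArg (absN K) (congrArg Subtype.val hB0)).trans_le (map_one _).le
        · exact (congrArg (absN K) (congrArg Subtype.val hB1)).trans_le hw1
      · fin_cases j
        · exact (congrArg (absN K) (congrArg Subtype.val hC0)).trans_le (map_one _).le
        · exact (congrArg (absN K) (congrArg Subtype.val hC1)).trans_le hw1'
    · rintro x hx ⟨j, i⟩
      rw [hint] at hx
      rw [Module.Basis.smulTower'_repr, isIntegral_iff_absN_base]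
      have hxe : (x : AlgebraicClosure K) = algebraMap E _ (C.repr x 0) + algebraMap E _ (C.repr x 1) * w' := by
        conv_lhs => rw [← C.sum_repr x]
        rw [Fin.sum_univ_two, hC0, hC1, Algebra.smul_def, Algebra.smul_def, mul_one]
        rfl
      have hj : absN K (C.repr x j) ≤ 1 := by
        rw [hxe] at hx
        have := HE.coords_le_one hw' hx
        fin_cases j
        · exact this.1
        · exact this.2
      generalize C.repr x j = y at hj
      have hye : (y : AlgebraicClosure K) = algebraMap K _ (B.repr y 0) + algebraMap K _ (B.repr y 1) * w := by
        conv_lhs => rw [← B.sum_repr y]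
        rw [Fin.sum_univ_two, hB0, hB1, Algebra.smul_def, Algebra.smul_def, mul_one]
        rfl
      rw [hye] at hj
      have := H.coords_le_one hw hj
      fin_cases i
      · exact this.1
      · exact this.2
  have hpos := H.dyadic.pos
  have h2 : ρ ^ discrVal K M = ρ ^ (2 * d + d') := by
    rw [← h1, hBC, map_mul, map_mul, map_pow, map_pow, ← restrictAbs_apply, ← restrictAbs_apply,
      hdab, hnorm, hE.1]
    have h3 : absN K ((a' ^ 2 - 4 * b' : E) : AlgebraicClosure K) = √ρ ^ d' := hdab'
    rw [h3, ← pow_mul, ← pow_mul, mul_comm d' 2, pow_mul √ρ, Real.sq_sqrt hpos.le, pow_add, mul_comm d 2]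
  exact pow_right_injective₀ hpos H.dyadic.lt_one.ne h2

end Base


/-! ### From isomorphism classes to subfields of the algebraic closure. -/

section Fibres

/-- There are `[L : K]` embeddings of `L` into `Ω`. Once an isomorphism from `L` to each conjugate
is chosen, an embedding amounts to its image and an automorphism of `L`. -/
theorem card_conjugates_mul_card_aut {K Ω : Type*} [Field K] [Field Ω] [Algebra K Ω] [IsAlgClosed Ω]
    (L : IntermediateField K Ω) [FiniteDimensional K L] [Algebra.IsSeparable K L] :
    Nat.card {L' : IntermediateField K Ω // Nonempty (L ≃ₐ[K] L')} * Nat.card (L ≃ₐ[K] L) =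
      Module.finrank K L := by
  rw [← Nat.card_prod, ← AlgHom.card K L Ω, ← Nat.card_eq_fintype_card]
  refine Nat.card_congr (Equiv.ofBijective
    (fun p => p.1.1.val.comp ((p.2.trans p.1.2.some : L ≃ₐ[K] p.1.1) : L →ₐ[K] p.1.1)) ⟨?_, ?_⟩)
  · rintro ⟨⟨L', h⟩, σ⟩ ⟨⟨L'', h'⟩, τ⟩ heq
    have hr (L' : IntermediateField K Ω) (g : L ≃ₐ[K] L') :
        (L'.val.comp (g : L →ₐ[K] L')).fieldRange = L' := by
      ext x
      constructor
      · rintro ⟨y, rfl⟩; exact (g y).2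
      · intro hx; exact ⟨g.symm ⟨x, hx⟩, by simp⟩
    have hL : L' = L'' := by
      rw [← hr L' (σ.trans h.some), ← hr L'' (τ.trans h'.some)]
      exact congrArg AlgHom.fieldRange heq
    subst hL
    congr 1
    ext x
    have h1 := DFunLike.congr_fun heq x
    have h2 : h.some (σ x) = h.some (τ x) := Subtype.ext h1
    exact congrArg Subtype.val (h.some.injective h2)
  · intro f
    let g : L ≃ₐ[K] f.fieldRange := AlgEquiv.ofInjectiveField f
    have hg : Nonempty (L ≃ₐ[K] f.fieldRange) := ⟨g⟩
    refine ⟨⟨⟨f.fieldRange, hg⟩, g.trans hg.some.symm⟩, ?_⟩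
    ext x
    change ((hg.some (hg.some.symm (g x)) : f.fieldRange) : Ω) = f x
    rw [AlgEquiv.apply_symm_apply]
    rfl

variable (K : Type*) [Field K] [Algebra ℚ_[2] K] [FiniteDimensional ℚ_[2] K]
  [Algebra ℤ_[2] K] [IsScalarTower ℤ_[2] ℚ_[2] K]

variable {K} in
theorem discrVal_congr {L L' : Type*} [Field L] [Algebra K L] [Field L'] [Algebra K L']
    (f : L ≃ₐ[K] L') : discrVal K L = discrVal K L' := by
  rw [discrVal, discrIdeal_congr f, discrVal]

variable {K} in
/-- The mass of a set of isomorphism classes as a sum over subfields of the algebraic closure. -/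
theorem mass_image {n : ℕ} (hn : n ≠ 0) {S : Set (IntermediateField K (AlgebraicClosure K))}
    (hS : S.Finite) (hdeg : ∀ L ∈ S, Module.finrank K L = n)
    (hcl : ∀ L ∈ S, ∀ L' : IntermediateField K (AlgebraicClosure K), Nonempty (L ≃ₐ[K] L') → L' ∈ S) :
    mass K (Quotient.mk (extensionSetoid K) '' S) =
      (n : ℝ)⁻¹ * ∑ L ∈ hS.toFinset, ((residueCard K : ℝ) ^ discrVal K L)⁻¹ := by
  classical
  have := charZero_base K
  have hfin := hS.image (Quotient.mk (extensionSetoid K))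
  rw [mass, finsum_mem_eq_finite_toFinset_sum _ hfin, Finset.mul_sum,
    ← Finset.sum_fiberwise_of_maps_to (s := hS.toFinset) (t := hfin.toFinset)
      (g := Quotient.mk (extensionSetoid K))
      (fun L hL => hfin.mem_toFinset.2 ⟨L, hS.mem_toFinset.1 hL, rfl⟩)]
  refine Finset.sum_congr rfl fun c hc => ?_
  obtain ⟨L, hL, rfl⟩ := hfin.mem_toFinset.1 hc
  have : FiniteDimensional K L := Module.finite_of_finrank_pos (by rw [hdeg L hL]; omega)
  have hcard := card_conjugates_mul_card_aut L
  -- Closure of `S` under isomorphism ensures that the fibre consists of all conjugates of `L`,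
  -- hence has `n / #Aut(L/K)` elements.
  have hfib : (hS.toFinset.filter fun L' => (Quotient.mk (extensionSetoid K) L') =
      Quotient.mk (extensionSetoid K) L).card =
      Nat.card {L' : IntermediateField K (AlgebraicClosure K) // Nonempty (L ≃ₐ[K] L')} := by
    refine (Nat.subtype_card _ fun L' => ?_).symm
    rw [Finset.mem_filter, Set.Finite.mem_toFinset]
    refine ⟨fun h => ?_, fun h => ⟨hcl L hL L' h, (Quotient.sound h).symm⟩⟩
    exact Quotient.exact h.2.symm
  rw [Finset.sum_congr rfl (g := fun _ => (n : ℝ)⁻¹ * ((residueCard K : ℝ) ^ discrVal K L)⁻¹)]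
  · rw [Finset.sum_const, hfib, nsmul_eq_mul]
    change weight K L = _
    rw [weight]
    rw [hdeg L hL] at hcard
    have hn' : (n : ℝ) ≠ 0 := by exact_mod_cast hn
    have hA : (Nat.card (L ≃ₐ[K] L) : ℝ) ≠ 0 := by
      intro h
      have h0 : Nat.card (L ≃ₐ[K] L) = 0 := by exact_mod_cast h
      rw [h0, mul_zero] at hcard
      exact hn hcard.symm
    rw [← hcard]
    push_cast
    rw [mul_inv, div_eq_mul_inv]
    have hC : (Nat.card {L' : IntermediateField K (AlgebraicClosure K) // Nonempty (L ≃ₐ[K] L')} : ℝ) ≠ 0 := by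
      intro h
      rw [← hcard] at hn'
      push_cast at hn'
      rw [h, zero_mul] at hn'
      exact hn' rfl
    field_simp
  · intro L' hL'
    obtain ⟨f⟩ := Quotient.exact (Finset.mem_filter.1 hL').2
    rw [discrVal_congr f]

end Fibres

/-! ### The double count of towers. -/

section Towers

variable (K : Type*) [Field K] [Algebra ℚ_[2] K] [FiniteDimensional ℚ_[2] K]

/-- The totally ramified quartic extensions with a quadratic subextension. -/
def towerQuartics (ρ : ℝ) : Set (IntermediateField K (AlgebraicClosure K)) :=
  {L | Module.finrank K L = 4 ∧ (∃ w ∈ L, absN K w ^ 4 = ρ) ∧ (quadSub L).Nonempty}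

variable [Algebra ℤ_[2] K] [IsScalarTower ℤ_[2] ℚ_[2] K]

variable {K}
variable {ϖ : integers K} (hϖ : Irreducible ϖ)
include hϖ

local notation "ρK" => absN K (algebraMap K (AlgebraicClosure K) (ϖ : K))

/-- The incidence relation seen from both ends: from `L` it counts quadratic subfields, from `E` it
counts ramified quadratic extensions. This is what allows the order of summation to be exchanged. -/
theorem mem_tower_iff (E L : IntermediateField K (AlgebraicClosure K)) :
    (L ∈ towerQuartics K ρK ∧ E ∈ quadSub L) ↔
      (E ∈ ramQuadratics K (absN K) ρK ∧
        L ∈ IntermediateField.restrictScalars K '' ramQuadratics E (absN K) √ρK) := by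
  have := charZero_base K
  have : IsGalois K (AlgebraicClosure K) := ⟨⟩
  have H := isDyadicBase K hϖ
  constructor
  · rintro ⟨⟨hL, ⟨w, hwL, hw⟩, -⟩, hEL, hE⟩
    obtain ⟨h1, h2⟩ := H.ramQuadratics_of_le hL hwL hw hEL hE
    exact ⟨h1, _, h2, IntermediateField.extendScalars_restrictScalars hEL⟩
  · rintro ⟨hE, M, hM, rfl⟩
    have hEM : E ∈ quadSub (M.restrictScalars K) :=
      ⟨fun x hx => M.algebraMap_mem ⟨x, hx⟩, hE.1⟩
    obtain ⟨w, hwM, hw, -⟩ := H.exists_norm_tower hE hM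
    exact ⟨⟨IsDyadicBase.finrank_restrictScalars hE hM, ⟨w, hwM, hw⟩, E, hEM⟩, hEM⟩

theorem finite_quadSub {L : IntermediateField K (AlgebraicClosure K)}
    (hL : L ∈ towerQuartics K ρK) : (quadSub L).Finite := by
  have := charZero_base K
  have : IsGalois K (AlgebraicClosure K) := ⟨⟩
  exact (isDyadicBase K hϖ).sum_ramQuadratics.1.subset fun E hE => ((mem_tower_iff hϖ E L).1 ⟨hL, hE⟩).1

theorem finite_towerQuartics : (towerQuartics K ρK).Finite := by
  have := charZero_base K
  have : IsGalois K (AlgebraicClosure K) := ⟨⟩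
  have H := isDyadicBase K hϖ
  refine (H.sum_ramQuadratics.1.biUnion fun E hE =>
    ((H.extend_sqrt hE).sum_ramQuadratics.1.image (IntermediateField.restrictScalars K))).subset ?_
  rintro L hL
  obtain ⟨E, hE⟩ := hL.2.2
  have := (mem_tower_iff hϖ E L).1 ⟨hL, hE⟩
  exact Set.mem_biUnion this.1 this.2

theorem isTotallyRamified_of_mem {L : IntermediateField K (AlgebraicClosure K)}
    (hL : L ∈ towerQuartics K ρK) : IsTotallyRamified K L := by
  have := charZero_base K
  have : IsGalois K (AlgebraicClosure K) := ⟨⟩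
  have H := isDyadicBase K hϖ
  have : FiniteDimensional K L := Module.finite_of_finrank_pos (by rw [hL.1]; norm_num)
  have h4 := hL.1
  obtain ⟨E, hE⟩ := hL.2.2
  obtain ⟨hE', M, hM, rfl⟩ := (mem_tower_iff hϖ E L).1 ⟨hL, hE⟩
  obtain ⟨w, hwM, hw, hval⟩ := H.exists_norm_tower hE' hM
  exact isTotallyRamified_of_norm hϖ (w := ⟨w, hwM⟩) (by rw [h4]; exact hw) hval

omit hϖ in
variable (K) in
theorem two_le_residueCard : 2 ≤ residueCard K := by
  have := finite_residueField K
  exact Finite.one_lt_card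

/-- The weighted count of quadratic subfields of totally ramified quartic fields. -/
theorem sum_towerQuartics :
    ∑ L ∈ (finite_towerQuartics hϖ).toFinset,
      ((quadSub L).ncard : ℝ) * ((residueCard K : ℝ) ^ discrVal K L)⁻¹ =
    4 * (1 / ((residueCard K : ℝ) ^ 2 + residueCard K + 1) *
      ((residueCard K : ℝ) ^ (-3 * (absRamificationIdx K : ℤ) - 3) +
        (residueCard K : ℝ) ^ (-3 * (absRamificationIdx K : ℤ) - 1) +
        (residueCard K : ℝ) ^ (-2 : ℤ))) := by
  classical
  have := charZero_base K
  have : IsGalois K (AlgebraicClosure K) := ⟨⟩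
  have H := isDyadicBase K hϖ
  have hq := two_le_residueCard K
  set q := residueCard K with hqdef
  have hq0 : (q : ℝ) ≠ 0 := by
    have : q ≠ 0 := by omega
    exact_mod_cast this
  obtain ⟨hR, δ, hδ, hsum⟩ := H.sum_ramQuadratics
  -- The intersection empties the set when `E` is not totally ramified quadratic, so that finiteness
  -- holds for every `E`.
  have hT (E : IntermediateField K (AlgebraicClosure K)) : (IntermediateField.restrictScalars K '' ramQuadratics E (absN K) √ρK ∩
      {_L | E ∈ ramQuadratics K (absN K) ρK}).Finite := by
    by_cases hE : E ∈ ramQuadratics K (absN K) ρK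
    · exact ((H.extend_sqrt hE).sum_ramQuadratics.1.image _).inter_of_left _
    · simp [hE]
  have hinner (E : IntermediateField K (AlgebraicClosure K))
      (hE : E ∈ ramQuadratics K (absN K) ρK) :
      ∑ L ∈ (hT E).toFinset, ((q : ℝ) ^ discrVal K L)⁻¹ = 2 * (q : ℝ)⁻¹ * (((q : ℝ) ^ δ E) ^ 2)⁻¹ := by
    obtain ⟨hM, δ', hδ', hsum'⟩ := (H.extend_sqrt hE).sum_ramQuadratics
    have hset : IntermediateField.restrictScalars K '' ramQuadratics E (absN K) √ρK ∩
        {_L | E ∈ ramQuadratics K (absN K) ρK} =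
        IntermediateField.restrictScalars K '' ramQuadratics E (absN K) √ρK :=
      Set.inter_eq_left.2 fun _ _ => hE
    rw [← finsum_mem_eq_finite_toFinset_sum _ (hT E), hset,
      finsum_mem_image (IntermediateField.restrictScalars_injective K).injOn]
    have h1 (M) (hM : M ∈ ramQuadratics E (absN K) √ρK) :
        ((q : ℝ) ^ discrVal K (M.restrictScalars K))⁻¹ =
          (fun d : ℕ => (((q : ℝ) ^ δ E) ^ 2)⁻¹ * ((q : ℝ) ^ d)⁻¹) (δ' M) := by
      beta_reduce
      rw [discrVal_tower hϖ hE (hδ E hE) hM (hδ' M hM), ← mul_inv, ← pow_mul, ← pow_add, mul_comm 2]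
    rw [finsum_mem_congr rfl h1]
    refine (hsum' fun d => (((q : ℝ) ^ δ E) ^ 2)⁻¹ * ((q : ℝ) ^ d)⁻¹).trans ?_
    -- The ramification index of `E` is `2 e_K`, but the value `2 / q` of the inner sum does not
    -- depend on it.
    rw [← sum_inv_pow (e := 2 * absRamificationIdx K) hq, add_mul,
      Finset.sum_mul]
    congr 1
    · ring
    · exact Finset.sum_congr rfl fun i _ => by ring
  have hswap : ∑ L ∈ (finite_towerQuartics hϖ).toFinset,
      ((quadSub L).ncard : ℝ) * ((q : ℝ) ^ discrVal K L)⁻¹ =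
      ∑ E ∈ hR.toFinset, ∑ L ∈ (hT E).toFinset, ((q : ℝ) ^ discrVal K L)⁻¹ := by
    rw [Finset.sum_comm' (t' := (finite_towerQuartics hϖ).toFinset)
      (s' := fun L => hR.toFinset.filter fun E => E ∈ quadSub L)]
    · refine Finset.sum_congr rfl fun L hL => ?_
      rw [Set.Finite.mem_toFinset] at hL
      rw [Finset.sum_const, nsmul_eq_mul, Set.ncard_eq_toFinset_card _ (finite_quadSub hϖ hL)]
      congr 3
      ext E
      simp only [Set.Finite.mem_toFinset, Finset.mem_filter]
      exact ⟨fun hE => ⟨((mem_tower_iff hϖ E L).1 ⟨hL, hE⟩).1, hE⟩, fun h => h.2⟩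
    · intro E L
      have := mem_tower_iff hϖ E L
      simp only [Set.Finite.mem_toFinset, Finset.mem_filter, Set.mem_inter_iff, Set.mem_ofPred_eq]
      tauto
  rw [hswap, Finset.sum_congr rfl (fun E hE => hinner E (hR.mem_toFinset.1 hE)),
    ← finsum_mem_eq_finite_toFinset_sum _ hR,
    hsum (fun d => 2 * (q : ℝ)⁻¹ * (((q : ℝ) ^ d) ^ 2)⁻¹)]
  have h2 := sum_inv_sq_pow (e := absRamificationIdx K) hq
  have h3 : (4 : ℝ) = 2 * (q : ℝ)⁻¹ * (2 * q) := by field_simp; norm_num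
  rw [h3, mul_assoc (2 * (q : ℝ)⁻¹), ← h2, mul_add, Finset.mul_sum]
  congr 1
  · ring
  · exact Finset.sum_congr rfl fun i _ => by ring

end Towers


/-! ### Masses by Galois group and the final identity. -/

section Final

variable (K : Type*) [Field K] [Algebra ℚ_[2] K] [FiniteDimensional ℚ_[2] K]

omit [FiniteDimensional ℚ_[2] K] in
variable {K} in
theorem ncard_quadSub_eq {L : IntermediateField K (AlgebraicClosure K)}
    (hL : Module.finrank K L = 4) {n : ℕ}
    (h : ∀ [Finite (GaloisClosureGroup K L)] {H : Subgroup (GaloisClosureGroup K L)},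
      H.index = 4 → H.normalCore = ⊥ → (indexTwo H).ncard = n) : (quadSub L).ncard = n := by
  have := charZero_base K
  have := finiteDimensional_closure L hL
  rw [ncard_quadSub L hL]
  exact h (index_relGaloisGroup L hL) (normalCore_relGaloisGroup L hL)

variable [Algebra ℤ_[2] K] [IsScalarTower ℤ_[2] ℚ_[2] K]

variable {K}
variable {ϖ : integers K} (hϖ : Irreducible ϖ)
include hϖ

local notation "ρK" => absN K (algebraMap K (AlgebraicClosure K) (ϖ : K))

open Classical in
/-- The mass of the quartics of a given type with quadratic subfields. -/
theorem mass_quartics (G : Type*) [Group G]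
    (hG : ∀ L : IntermediateField K (AlgebraicClosure K), Module.finrank K L = 4 →
      Nonempty (GaloisClosureGroup K L ≃* G) → (quadSub L).ncard ≠ 0) :
    (quartics K G).Finite ∧ mass K (quartics K G) = 4⁻¹ *
      ∑ L ∈ (finite_towerQuartics hϖ).toFinset with Nonempty (GaloisClosureGroup K L ≃* G),
        ((residueCard K : ℝ) ^ discrVal K L)⁻¹ := by
  have := charZero_base K
  have : IsGalois K (AlgebraicClosure K) := ⟨⟩
  have H := isDyadicBase K hϖ
  let S : Set (IntermediateField K (AlgebraicClosure K)) :=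
    {L | L ∈ towerQuartics K ρK ∧ Nonempty (GaloisClosureGroup K L ≃* G)}
  have hS : S.Finite := (finite_towerQuartics hϖ).subset fun L hL => hL.1
  have himg : quartics K G = Quotient.mk (extensionSetoid K) '' S := by
    ext c
    constructor
    · rintro ⟨L, rfl, h4, hT, hg⟩
      refine ⟨L, ⟨⟨h4, ?_, Set.nonempty_of_ncard_ne_zero (hG L h4 hg)⟩, hg⟩, rfl⟩
      have : FiniteDimensional K L := Module.finite_of_finrank_pos (by rw [h4]; norm_num)
      obtain ⟨r, p, hr, hp, -⟩ := exists_uniformizer L hϖ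
      rw [hr.1 hT, h4] at hp
      exact ⟨p, p.2, hp.symm⟩
    · rintro ⟨L, ⟨hL, hg⟩, rfl⟩
      exact ⟨L, rfl, hL.1, isTotallyRamified_of_mem hϖ hL, hg⟩
  refine ⟨himg ▸ hS.image _, ?_⟩
  rw [himg, mass_image (n := 4) four_ne_zero hS (fun L hL => hL.1.1)]
  · norm_num
    refine Finset.sum_congr ?_ fun _ _ => rfl
    ext L
    rw [Finset.mem_filter, Set.Finite.mem_toFinset, Set.Finite.mem_toFinset]
    rfl
  · rintro L ⟨hL, ⟨g⟩⟩ L' ⟨f⟩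
    obtain ⟨f'⟩ := closureGroup_congr f
    have h4 : Module.finrank K L' = 4 := by rw [← f.toLinearEquiv.finrank_eq]; exact hL.1
    have hg : Nonempty (GaloisClosureGroup K L' ≃* G) := ⟨f'.symm.trans g⟩
    obtain ⟨w, hwL, hw⟩ := hL.2.1
    refine ⟨⟨h4, ⟨f ⟨w, hwL⟩, Subtype.property _, ?_⟩,
      Set.nonempty_of_ncard_ne_zero (hG L' h4 hg)⟩, hg⟩
    rw [← hw]
    exact congrArg (· ^ 4) (map_embedding_eq H.inv L (L'.val.comp (f : L →ₐ[K] L')) ⟨w, hwL⟩)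

omit hϖ in
variable (K) in
/-- The mass of the totally ramified quartic extensions with dihedral Galois closure. -/
theorem mass_quartics_D4 : (quartics K D4).Finite ∧ (quartics K C4).Finite ∧ (quartics K V4).Finite ∧
    mass K (quartics K D4) = 1 / ((residueCard K : ℝ) ^ 2 + residueCard K + 1) *
        ((residueCard K : ℝ) ^ (-3 * (absRamificationIdx K : ℤ) - 3) +
          (residueCard K : ℝ) ^ (-3 * (absRamificationIdx K : ℤ) - 1) +
          (residueCard K : ℝ) ^ (-2 : ℤ)) - mass K (quartics K C4) - 3 * mass K (quartics K V4) := by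
  classical
  have := charZero_base K
  obtain ⟨ϖ, hϖ⟩ := IsDiscreteValuationRing.exists_irreducible (integers K)
  have hD (L : IntermediateField K (AlgebraicClosure K)) (hL : Module.finrank K L = 4)
      (h : Nonempty (GaloisClosureGroup K L ≃* D4)) : (quadSub L).ncard = 1 :=
    ncard_quadSub_eq hL fun h1 h2 => ncard_indexTwo_D4 h1 h2 h.some
  have hC (L : IntermediateField K (AlgebraicClosure K)) (hL : Module.finrank K L = 4)
      (h : Nonempty (GaloisClosureGroup K L ≃* C4)) : (quadSub L).ncard = 1 :=
    ncard_quadSub_eq hL fun h1 h2 => ncard_indexTwo_C4 h1 h2 h.some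
  have hV (L : IntermediateField K (AlgebraicClosure K)) (hL : Module.finrank K L = 4)
      (h : Nonempty (GaloisClosureGroup K L ≃* V4)) : (quadSub L).ncard = 3 :=
    ncard_quadSub_eq hL fun h1 _ => ncard_indexTwo_V4 h1 h.some
  obtain ⟨fD, mD⟩ := mass_quartics hϖ D4 fun L hL h => by rw [hD L hL h]; norm_num
  obtain ⟨fC, mC⟩ := mass_quartics hϖ C4 fun L hL h => by rw [hC L hL h]; norm_num
  obtain ⟨fV, mV⟩ := mass_quartics hϖ V4 fun L hL h => by rw [hV L hL h]; norm_num
  refine ⟨fD, fC, fV, ?_⟩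
  have hsum := sum_towerQuartics hϖ
  -- The number of quadratic subfields equals the coefficient of the Galois type of `L`: 1 for D4, 1
  -- for C4, 3 for V4. V4 is told apart by this number, D4 and C4 by their orders.
  have key (L : IntermediateField K (AlgebraicClosure K))
      (hL : L ∈ (finite_towerQuartics hϖ).toFinset) : ((quadSub L).ncard : ℝ) =
      (if Nonempty (GaloisClosureGroup K L ≃* D4) then 1 else 0) +
      (if Nonempty (GaloisClosureGroup K L ≃* C4) then 1 else 0) +
      3 * (if Nonempty (GaloisClosureGroup K L ≃* V4) then 1 else 0) := by
    rw [Set.Finite.mem_toFinset] at hL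
    have h4 := hL.1
    have := finiteDimensional_closure L h4
    have hfin : Finite (GaloisClosureGroup K L) := inferInstance
    have hDC (h : Nonempty (GaloisClosureGroup K L ≃* D4)) :
        ¬ Nonempty (GaloisClosureGroup K L ≃* C4) := fun h' => by
      have := Nat.card_congr (h.some.symm.trans h'.some).toEquiv
      rw [DihedralGroup.nat_card] at this
      simp at this
    have hne : (indexTwo (relGaloisGroup L)).Nonempty := by
      refine Set.nonempty_of_ncard_ne_zero ?_
      rw [← ncard_quadSub L h4]
      exact ((Set.ncard_pos (finite_quadSub hϖ hL)).2 hL.2.2).ne'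
    rcases nonempty_mulEquiv_of_indexTwo (index_relGaloisGroup L h4)
      (normalCore_relGaloisGroup L h4) hne with h | h | h
    · have h1 := hDC h
      have h2 : ¬ Nonempty (GaloisClosureGroup K L ≃* V4) := fun h' => by
        have := hV L h4 h'; rw [hD L h4 h] at this; omega
      rw [hD L h4 h]; simp [h, h1, h2]
    · have h1 : ¬ Nonempty (GaloisClosureGroup K L ≃* D4) := fun h' => hDC h' h
      have h2 : ¬ Nonempty (GaloisClosureGroup K L ≃* V4) := fun h' => by
        have := hV L h4 h'; rw [hC L h4 h] at this; omega
      rw [hC L h4 h]; simp [h, h1, h2]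
    · have h1 : ¬ Nonempty (GaloisClosureGroup K L ≃* D4) := fun h' => by
        have := hD L h4 h'; rw [hV L h4 h] at this; omega
      have h2 : ¬ Nonempty (GaloisClosureGroup K L ≃* C4) := fun h' => by
        have := hC L h4 h'; rw [hV L h4 h] at this; omega
      rw [hV L h4 h]; simp [h, h1, h2]
  rw [Finset.sum_congr rfl fun L hL => by rw [key L hL]] at hsum
  simp only [add_mul, mul_assoc, Finset.sum_add_distrib, ← Finset.mul_sum, ite_mul, one_mul,
    zero_mul, ← Finset.sum_filter] at hsum
  rw [mD, mC, mV]
  linear_combination (1 / 4 : ℝ) * hsum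

end Final

end TwoAdic

theorem mainTheorem7 (K : Type*) [Field K] [Algebra ℚ_[2] K] [FiniteDimensional ℚ_[2] K]
    [Algebra ℤ_[2] K] [IsScalarTower ℤ_[2] ℚ_[2] K] (q : ℝ) (hq : q = TwoAdic.residueCard K)
    (e : ℤ) (he : e = TwoAdic.absRamificationIdx K) :
    (TwoAdic.quartics K TwoAdic.D4).Finite ∧
    (TwoAdic.quartics K TwoAdic.C4).Finite ∧
    (TwoAdic.quartics K TwoAdic.V4).Finite ∧
    TwoAdic.mass K (TwoAdic.quartics K TwoAdic.D4) =
      1 / (q ^ 2 + q + 1) * (q ^ (-3 * e - 3) + q ^ (-3 * e - 1) + q ^ (-2 : ℤ))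
        - TwoAdic.mass K (TwoAdic.quartics K TwoAdic.C4)
        - 3 * TwoAdic.mass K (TwoAdic.quartics K TwoAdic.V4) := by
  rw [hq, he]
  exact TwoAdic.mass_quartics_D4 K
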